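/- Let $G=(V,E)$ be a strongly connected directed graph with countable vertex set $V$, without multiple edges, and let $i_0\in V$. Let $\mathcal T$ be the directed cover of $G$ rooted in $i_0$: its vertices are the finite paths $\langle i_0,i_1,\dots,i_n\rangle$ in $G$, the root $o$ is $\langle i_0\rangle$, the ancestor $x^-$ of $x\neq o$ is obtained by deleting the last vertex of the path, the label $\tau(x)\in V$ is the last vertex of the path, and $|x|$ is the distance from $o$ to $x$. Let $p_G(i,j)\ge 0$ be transition probabilities on $V$ with $\sum_j p_G(i,j)=1$ and $p_G(i,j)>0$ if and only if $(i,j)\in E$, and let $p(-i)$, $i\in V$, satisfy $\varepsilon<p(-i)<1-\varepsilon$ for all $i$ and some $\varepsilon\in(0,1)$. Put $p(i,j):=(1-p(-i))\,p_G(i,j)$. Let $(X_n)_{n\ge 0}$ be the random walk on $\mathcal T$ with $X_0=o$ which moves from a vertex $x$ with label $i$ to a successor with label $j$ with probability $p(i,j)$, and to $x^-$ with probability $p(-i)$, where $o^-:=o$ (a loop at the root). Assume that $(X_n)$ is transient. For $i\in V$ choose $x\neq o$ with $\tau(x)=i$ and put $$F(-i|z)=\sum_{n\ge0}\mathbb P[X_n=x^-,\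 X_m\ne x^-\ \forall m<n\mid X_0=x]\,z^n,\qquad \overline G_i(z)=\sum_{n\ge0}\mathbb P[X_n=x,\ X_m\neq x^-\ \forall m<n\mid X_0=x]\,z^n,$$ which do not depend on the choice of $x$; write $F(-i)=F(-i|1)$, let $F'(-i|1)\in[0,\infty]$ be the value at $1$ of the formal derivative of the power series $F(-i|z)$, and let $$q(i,j)=\frac{1-F(-j)}{1-F(-i)}\,p(i,j)\,\overline G_i(1),\qquad Q=(q(i,j))_{i,j\in V}.$$ Suppose that $Q$ is positive recurrent with invariant probability measure $\nu$, and let $$\Lambda:=\sum_{i\in V}\nu(i)\,\frac{F'(-i|1)}{F(-i)}\in[0,\infty].$$ For a bounded function $w:V\times V\to\mathbb R$ define $l(o)=0$ and $l(x)=l(x^-)+w(\tau(x^-),\tau(x))$ for $x\ne o$. Then the following hold. 1. If $\Lambda<\infty$, then for every bounded $w:V\times V\to\mathbb R$ the sum below converges absolutely and $$\lim_{n\to\infty}\frac{l(X_n)}{n}=\Big(\sum_{i,j\in V}w(i,j)\,\nu(i)\,q(i,j)\Big)\cdot\Lambda^{-1}\quad\text{almost surely.}$$ Moreover there is a constant $\ell>0$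 with $\lim_{n\to\infty}|X_n|/n=\ell$ almost surely. 2. If the spectral radius of $(X_n)$, that is, the inverse of the radius of convergence of $\sum_{n\ge0}\mathbb P[X_n=o\mid X_0=o]\,z^n$, is strictly smaller than $1$, then $\Lambda<\infty$. 3. If $\Lambda=\infty$, then for every bounded $w:V\times V\to\mathbb R$ one has $\liminf_{n\to\infty}|l(X_n)|/n=0$ almost surely; in particular $\liminf_{n\to\infty}l(X_n)/n=0$ almost surely if $w\ge 0$ (for instance for $l(x)=|x|$). -/

import Mathlib

open MeasureTheory Filter Topology
open scoped ENNReal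

noncomputable section

/-! Chains on a countable state space, given by a transition matrix with entries in `[0, ∞]`. -/

open Classical in
/-- `pathProb P A n x y` is the probability that the chain with transition matrix `P`, started
at `x`, is at `y` at time `n` and is outside `A` at all times `m < n`. For `A = ∅` this is the
`n`-step transition probability. -/
def pathProb {S : Type*} (P : S → S → ℝ≥0∞) (A : Set S) : ℕ → S → S → ℝ≥0∞
  | 0, x, y => if x = y then 1 else 0
  | n + 1, x, y => if x ∈ A then 0 else ∑' z, P x z * pathProb P A n z y

/-- The probability that the chain started at `i` returns to `i` for the first time at
time `n + 1`. -/
def firstReturnProb {S : Type*} (P : S → S → ℝ≥0∞) (i : S) (n : ℕ) : ℝ≥0∞ :=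
  ∑' z, P i z * pathProb P {i} n z i

/-- Every state is recurrent and has a finite mean return time. -/
def IsPositiveRecurrent {S : Type*} (P : S → S → ℝ≥0∞) : Prop :=
  ∀ i, ∑' n, firstReturnProb P i n = 1 ∧ ∑' n : ℕ, ((n : ℝ≥0∞) + 1) * firstReturnProb P i n < ∞

/-- `ν` is an invariant probability measure of `P`. -/
def IsInvariantLaw {S : Type*} (P : S → S → ℝ≥0∞) (ν : PMF S) : Prop :=
  ∀ j, ∑' i, ν i * P i j = ν j

/-- `X` is a Markov chain under `μ` with transition matrix `P` and initial state `x₀`. -/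
structure IsMarkovChain {S Ω : Type*} [MeasurableSpace S] [MeasurableSpace Ω]
    (μ : Measure Ω) (X : ℕ → Ω → S) (P : S → S → ℝ≥0∞) (x₀ : S) : Prop where
  measurable : ∀ n, Measurable (X n)
  start : ∀ᵐ ω ∂μ, X 0 ω = x₀
  path : ∀ (n : ℕ) (x : ℕ → S), x 0 = x₀ →
    μ {ω | ∀ k ≤ n, X k ω = x k} = ∏ k ∈ Finset.range n, P (x k) (x (k + 1))

/-! The directed cover. -/

/-- A vertex of the directed cover of `G` rooted in `i₀` is a finite path
`⟨i₀, i₁, …, iₙ⟩` in `G`; it is written as the list `[iₙ, …, i₁]`, last label first. -/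
def IsCoverPath {V : Type*} (G : Digraph V) (i₀ : V) : List V → Prop
  | [] => True
  | j :: s => IsCoverPath G i₀ s ∧ G.Adj (s.headD i₀) j

/-- The vertex set of the directed cover of `G` rooted in `i₀`. -/
def Cover {V : Type*} (G : Digraph V) (i₀ : V) : Type _ := {s : List V // IsCoverPath G i₀ s}

namespace Cover

variable {V : Type*} {G : Digraph V} {i₀ : V}

instance : MeasurableSpace (Cover G i₀) := ⊤

/-- The root `o`. -/
def root : Cover G i₀ := ⟨[], trivial⟩

/-- The label `τ(x)`; the root has label `i₀`. -/
def label (x : Cover G i₀) : V := x.1.headD i₀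

/-- The ancestor `x⁻`, with the convention `o⁻ = o` (there is a loop at the root). -/
def parent : Cover G i₀ → Cover G i₀
  | ⟨[], _⟩ => root
  | ⟨_ :: s, h⟩ => ⟨s, h.1⟩

/-- The distance `|x|` of `x` from the root. -/
def height (x : Cover G i₀) : ℕ := x.1.length

/-- `l(o) = 0` and `l(x) = l(x⁻) + w(τ(x⁻), τ(x))` otherwise. -/
def weightedLengthAux (w : V → V → ℝ) (i₀ : V) : List V → ℝ
  | [] => 0
  | j :: s => weightedLengthAux w i₀ s + w (s.headD i₀) j

/-- The length `l(x)` of `x` with respect to the weight function `w`. -/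
def weightedLength (w : V → V → ℝ) (x : Cover G i₀) : ℝ := weightedLengthAux w i₀ x.1

end Cover

/-! Nearest neighbour random walks on directed covers. -/

/-- The data defining a nearest neighbour random walk on the directed cover of a strongly
connected directed graph. -/
structure CoverWalk (V : Type*) where
  /-- the graph `G` -/
  graph : Digraph V
  /-- the label `i₀` of the root -/
  base : V
  /-- `G` is strongly connected -/
  connected : ∀ i j, Relation.ReflTransGen graph.Adj i j
  /-- the transition probabilities `p_G(i, j)` on `G` -/
  pG : V → V → ℝ
  pG_nonneg : ∀ i j, 0 ≤ pG i j
  pG_pos_iff : ∀ i j, 0 < pG i j ↔ graph.Adj i j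
  pG_sum : ∀ i, HasSum (pG i) 1
  /-- the backward probabilities `p(-i)` -/
  back : V → ℝ
  /-- the backward probabilities are uniformly bounded away from `0` and `1` -/
  back_bounds : ∃ ε : ℝ, 0 < ε ∧ ε < 1 ∧ ∀ i, ε < back i ∧ back i < 1 - ε

namespace CoverWalk

variable {V : Type*} (W : CoverWalk V)

/-- The directed cover on which the walk lives. -/
abbrev Tree : Type _ := Cover W.graph W.base

/-- The forward probabilities `p(i, j) = (1 - p(-i)) p_G(i, j)`. -/
def forward (i j : V) : ℝ := (1 - W.back i) * W.pG i j

open Classical in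
/-- The transition probabilities on the tree: from `x` to a successor `y` with probability
`p(τ(x), τ(y))`, from `x` to `x⁻` with probability `p(-τ(x))`, where `o⁻ = o`. -/
def step (x y : W.Tree) : ℝ≥0∞ :=
  if y ≠ Cover.root ∧ y.parent = x then ENNReal.ofReal (W.forward x.label y.label)
  else if y = x.parent then ENNReal.ofReal (W.back x.label)
  else 0

/-- The Green function `G(x, y | z)` for `z ≥ 0`. -/
def green (x y : W.Tree) (z : ℝ≥0∞) : ℝ≥0∞ := ∑' n, pathProb W.step ∅ n x y * z ^ n

/-- The walk is transient. -/
def IsTransient : Prop := W.green Cover.root Cover.root 1 < ∞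

/-- The spectral radius: the inverse of the radius of convergence of `G(o, o | z)`. -/
def spectralRadius : ℝ≥0∞ :=
  (FormalMultilinearSeries.ofScalars ℂ
    (fun n => ((pathProb W.step ∅ n Cover.root Cover.root).toReal : ℂ))).radius⁻¹

/-- Every element of `V` is the label of a vertex of the tree other than the root. -/
theorem exists_label (i : V) : ∃ x : W.Tree, x ≠ Cover.root ∧ x.label = i := by
  have key : ∀ j, Relation.ReflTransGen W.graph.Adj W.base j → ∃ x : W.Tree, x.label = j := by
    intro j h
    induction h with
    | refl => exact ⟨Cover.root, rfl⟩
    | @tail b c _ hbc ih =>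
      obtain ⟨x, hx⟩ := ih
      refine ⟨⟨c :: x.1, x.2, ?_⟩, rfl⟩
      have : x.1.headD W.base = b := hx
      rw [this]
      exact hbc
  have hpred : ∃ k, W.graph.Adj k i := by
    rcases Relation.ReflTransGen.cases_tail (W.connected W.base i) with h | ⟨c, _, hc⟩
    · have h1 : ∃ k, W.graph.Adj i k := by
        by_contra hno
        push Not at hno
        have h0 : W.pG i = fun _ => 0 := by
          funext k
          by_contra hne
          exact hno k ((W.pG_pos_iff i k).1 (lt_of_le_of_ne (W.pG_nonneg i k) (Ne.symm hne)))
        have h2 := W.pG_sum i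
        rw [h0] at h2
        exact zero_ne_one (hasSum_zero.unique h2)
      obtain ⟨k, hk⟩ := h1
      rcases Relation.ReflTransGen.cases_tail (W.connected k i) with h' | ⟨c, _, hc⟩
      · exact ⟨i, by rw [← h'] at hk; exact hk⟩
      · exact ⟨c, hc⟩
    · exact ⟨c, hc⟩
  obtain ⟨k, hk⟩ := hpred
  obtain ⟨x, hx⟩ := key k (W.connected W.base k)
  refine ⟨⟨i :: x.1, x.2, ?_⟩, ?_, rfl⟩
  · have : x.1.headD W.base = k := hx
    rw [this]
    exact hk
  · intro h
    exact List.cons_ne_nil _ _ (congrArg Subtype.val h)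

/-- A vertex `x ≠ o` of the tree with label `i`. The functions `F(-i | z)` and `Ḡ_i(z)` below
do not depend on the choice of `x`. -/
def vertexOf (i : V) : W.Tree := (W.exists_label i).choose

/-- `ℙ[X_n = x⁻, X_m ≠ x⁻ for all m < n | X_0 = x]` for `x ≠ o` with label `i`. -/
def passageProb (i : V) (n : ℕ) : ℝ≥0∞ :=
  pathProb W.step {(W.vertexOf i).parent} n (W.vertexOf i) (W.vertexOf i).parent

/-- The generating function `F(-i | z)` for `z ≥ 0`. -/
def F (i : V) (z : ℝ≥0∞) : ℝ≥0∞ := ∑' n, W.passageProb i n * z ^ n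

/-- The derivative `F'(-i | z)` of the power series `F(-i | z)`, for `z ≥ 0`. -/
def F' (i : V) (z : ℝ≥0∞) : ℝ≥0∞ := ∑' n : ℕ, n * W.passageProb i n * z ^ (n - 1)

/-- `Ḡ_i(z) = ∑ₙ ℙ[X_n = x, X_m ≠ x⁻ for all m < n | X_0 = x] zⁿ` for `x ≠ o` with
label `i`, for `z ≥ 0`. -/
def GBar (i : V) (z : ℝ≥0∞) : ℝ≥0∞ :=
  ∑' n, pathProb W.step {(W.vertexOf i).parent} n (W.vertexOf i) (W.vertexOf i) * z ^ n

/-- The transition matrix `Q` of the labels of the walk at its exit times. -/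
def q (i j : V) : ℝ≥0∞ :=
  (1 - W.F j 1) / (1 - W.F i 1) * ENNReal.ofReal (W.forward i j) * W.GBar i 1

/-- `Λ = ∑ᵢ ν(i) F'(-i | 1) / F(-i)`, possibly infinite. -/
def Lam (ν : PMF V) : ℝ≥0∞ := ∑' i, ν i * (W.F' i 1 / W.F i 1)

end CoverWalk

end

/-!
The walk on the directed cover is transient, so it converges to an end of the tree: it visits each
vertex only finitely often and leaves the cones along a ray one after the other. Let `e k` be the
time of the `k`-th exit, that is, the time after the last visit to the `k`-th vertex of that ray.

Given that the walk never leaves the cone of a vertex `x` with label `i`, the exit from `x` at time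
`m + 1` to a child with label `j` means that the walk is at `x` at time `m` without having visited
the ancestor of `x`, steps to the child, and never returns to `x` (`CoverWalk.apply_exit`). As the
probability of never leaving a cone is `1 - F(-i)`, which is positive by transience
(`CoverWalk.F_one_lt`), the marks (label, next label, holding time) of the successive exits form a
Markov chain (`CoverWalk.apply_exitMarks_pathCylinder`): the labels move according to `Q`, and the
holding time at a vertex with label `i` has generating function `z Ḡ_i(z) / Ḡ_i(1)`, independently
of the next label. Since `F(-i | z) = p(-i) z Ḡ_i(z)`, its mean is `F'(-i | 1) / F(-i)`, so that
`Λ` is the mean holding time in the stationary regime (`CoverWalk.tsum_stationaryMark_mul_hold`).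

The chain of marks is irreducible and has an invariant probability measure, built from `ν`. Hence
the shift on its path space is ergodic (`IsPathFamily.ergodic_shiftPath`), and Birkhoff's theorem,
proved here from the maximal ergodic inequality, gives the limits of `e k / k` and of
`l(X_{e k}) / k`, the former also if `Λ` is infinite. As the weighted length has bounded
increments, one interpolates between exit times if `Λ < ∞`, which yields the law of large numbers;
if `Λ = ∞`, then `l(X_{e k}) / e k` tends to `0`.

If the spectral radius is smaller than one, then `Ḡ_i` converges at some `1 + d > 1` for every `i`.
Writing `Ḡ_i = 1 / (1 - U_i)`, where `U_i` is the generating function of the excursions into the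
cone, one has `U_i(1 + d) ≤ 1`, hence `U_i'(1) ≤ 1 / d` and `Ḡ_i'(1) ≤ Ḡ_i(1)² / d`
(`IsRenewalSequence.mul_tsum_nat_mul_le`). Together with `Ḡ_i(1) ≤ 1 / p(-i) ≤ 1 / ε` this bounds
the mean holding times uniformly in `i`, and so `Λ < ∞`.
-/


/-! ### Laws of Markov chains on path space -/

section PathLaw

variable {S : Type*}

/-- The path that starts at `x` and continues with `y`. -/
def consPath (x : S) (y : ℕ → S) : ℕ → S
  | 0 => x
  | n + 1 => y n

/-- The path `y` with its first `n` steps removed. -/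
def shiftPath (n : ℕ) (y : ℕ → S) : ℕ → S := fun k => y (n + k)

/-- The set of paths that agree with `a` up to time `n`. -/
def pathCylinder (n : ℕ) (a : ℕ → S) : Set (ℕ → S) := {y | ∀ k ≤ n, y k = a k}

@[simp] theorem consPath_zero (x : S) (y : ℕ → S) : consPath x y 0 = x := rfl

@[simp] theorem consPath_succ (x : S) (y : ℕ → S) (n : ℕ) : consPath x y (n + 1) = y n := rfl

@[simp] theorem shiftPath_apply (n : ℕ) (y : ℕ → S) (k : ℕ) : shiftPath n y k = y (n + k) := rfl

theorem shiftPath_zero (y : ℕ → S) : shiftPath 0 y = y := by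
  funext k; simp

theorem shiftPath_one_consPath (x : S) (y : ℕ → S) : shiftPath 1 (consPath x y) = y := by
  funext k; simp [Nat.add_comm 1 k]

theorem shiftPath_succ_consPath (n : ℕ) (x : S) (y : ℕ → S) :
    shiftPath (n + 1) (consPath x y) = shiftPath n y := by
  funext k; simp [Nat.add_right_comm n 1 k]

theorem shiftPath_shiftPath (m n : ℕ) (y : ℕ → S) :
    shiftPath m (shiftPath n y) = shiftPath (n + m) y := by
  funext k; simp [Nat.add_assoc]

theorem preimage_frestrictLe_singleton (n : ℕ) (a : ℕ → S) :
    (Preorder.frestrictLe (π := fun _ : ℕ => S) n) ⁻¹' {fun i => a i.1} = pathCylinder n a := by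
  ext y
  simp only [Set.mem_preimage, Set.mem_singleton_iff, pathCylinder, Set.mem_ofPred_eq]
  constructor
  · intro h k hk
    exact congrFun h ⟨k, Finset.mem_Iic.2 hk⟩
  · intro h
    funext ⟨k, hk⟩
    exact h k (Finset.mem_Iic.1 hk)

variable [MeasurableSpace S]

@[fun_prop]
theorem measurable_consPath (x : S) : Measurable (consPath x) := by
  refine measurable_pi_lambda _ fun n => ?_
  cases n with
  | zero => exact measurable_const
  | succ n => exact measurable_pi_apply n

@[fun_prop]
theorem measurable_shiftPath (n : ℕ) : Measurable (shiftPath (S := S) n) :=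
  measurable_pi_lambda _ fun k => measurable_pi_apply (n + k)

variable [DiscreteMeasurableSpace S]

theorem measurableSet_pathCylinder (n : ℕ) (a : ℕ → S) : MeasurableSet (pathCylinder n a) := by
  have : pathCylinder n a = ⋂ k, ⋂ (_ : k ≤ n), (fun y : ℕ → S => y k) ⁻¹' {a k} := by
    ext y; simp [pathCylinder]
  rw [this]
  exact MeasurableSet.iInter fun k => MeasurableSet.iInter fun _ =>
    measurable_pi_apply k (MeasurableSet.of_discrete)

theorem measurableSet_visit (A : Set S) (n : ℕ) (z : S) :
    MeasurableSet {y : ℕ → S | (∀ k < n, y k ∉ A) ∧ y n = z} := by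
  have : {y : ℕ → S | (∀ k < n, y k ∉ A) ∧ y n = z} =
      (⋂ k, ⋂ (_ : k < n), (fun y : ℕ → S => y k) ⁻¹' Aᶜ) ∩ (fun y : ℕ → S => y n) ⁻¹' {z} := by
    ext y; simp
  rw [this]
  exact (MeasurableSet.iInter fun k => MeasurableSet.iInter fun _ =>
    measurable_pi_apply k MeasurableSet.of_discrete).inter
      (measurable_pi_apply n MeasurableSet.of_discrete)

variable [Countable S]

/-- A finite measure on path space is determined by its values on the cylinders. -/
theorem ext_of_pathCylinder {μ ν : Measure (ℕ → S)} [IsFiniteMeasure μ] [IsFiniteMeasure ν]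
    (h : ∀ n a, μ (pathCylinder n a) = ν (pathCylinder n a)) : μ = ν := by
  have key : ∀ n : ℕ, μ.map (Preorder.frestrictLe (π := fun _ : ℕ => S) n) =
      ν.map (Preorder.frestrictLe (π := fun _ : ℕ => S) n) := by
    intro n
    refine Measure.ext_of_singleton fun r => ?_
    rw [Measure.map_apply (Preorder.measurable_frestrictLe n) (measurableSet_singleton r),
      Measure.map_apply (Preorder.measurable_frestrictLe n) (measurableSet_singleton r)]
    let a : ℕ → S := fun k => if hk : k ≤ n then r ⟨k, Finset.mem_Iic.2 hk⟩ else r ⟨0, by simp⟩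
    have hr : r = fun i => a i.1 := by
      funext ⟨k, hk⟩
      simp [a, Finset.mem_Iic.1 hk]
    rw [hr, preimage_frestrictLe_singleton, h]
  refine IsProjectiveLimit.unique (P := fun I : Finset ℕ => ν.map I.restrict) ?_ (fun I => rfl)
  intro I
  have hI : I ⊆ Finset.Iic (I.sup id) := I.subset_Iic_sup_id
  have h1 : Finset.restrict (π := fun _ : ℕ => S) I =
      (Finset.restrict₂ (π := fun _ : ℕ => S) hI) ∘
          (Preorder.frestrictLe (π := fun _ : ℕ => S) (I.sup id)) := rfl
  rw [h1, ← Measure.map_map (Finset.measurable_restrict₂ hI) (Preorder.measurable_frestrictLe _),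
    key, Measure.map_map (Finset.measurable_restrict₂ hI) (Preorder.measurable_frestrictLe _)]
  rfl

open Classical in
/-- `M x` is, for every state `x`, the law on path space of the Markov chain with transition
matrix `P` started at `x`. -/
structure IsPathFamily (P : S → S → ℝ≥0∞) (M : S → Measure (ℕ → S)) : Prop where
  prob : ∀ x, IsProbabilityMeasure (M x)
  cyl : ∀ x n a, M x (pathCylinder n a) =
    if a 0 = x then ∏ k ∈ Finset.range n, P (a k) (a (k + 1)) else 0

/-- Markov chains on a countable state space exist; this is the Ionescu-Tulcea theorem. -/
theorem exists_isPathFamily (P : S → S → ℝ≥0∞) (hP : ∀ x, ∑' y, P x y = 1) :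
    ∃ M, IsPathFamily P M := by
  classical
  let p : S → PMF S := fun x => ⟨P x, by rw [← hP x]; exact ENNReal.summable.hasSum⟩
  let κ : (n : ℕ) → ProbabilityTheory.Kernel (Π _ : Finset.Iic n, S) S := fun n =>
    ⟨fun z => (p (z ⟨n, by simp⟩)).toMeasure, measurable_of_countable _⟩
  have : ∀ n, ProbabilityTheory.IsMarkovKernel (κ n) := fun n =>
    ⟨fun z => PMF.toMeasure.isProbabilityMeasure _⟩
  let M : S → Measure (ℕ → S) := fun x =>
    ProbabilityTheory.Kernel.traj (X := fun _ => S) κ 0 (fun _ => x)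
  refine ⟨M, ⟨fun x => inferInstance, fun x n a => ?_⟩⟩
  induction n with
  | zero =>
    have h0 := ProbabilityTheory.Kernel.traj_map_frestrictLe_of_le (X := fun _ => S) (κ := κ)
      (le_refl 0)
    have h1 := congrArg (fun k => k (fun _ => x) {fun i => a i.1}) h0
    beta_reduce at h1
    rw [ProbabilityTheory.Kernel.map_apply' _ (Preorder.measurable_frestrictLe _) _
      (measurableSet_singleton _),
      ProbabilityTheory.Kernel.deterministic_apply' _ _ (measurableSet_singleton _)] at h1
    have h2 : (Preorder.frestrictLe (π := fun _ : ℕ => S) 0) ⁻¹' {fun i => a i.1} =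
        pathCylinder 0 a := preimage_frestrictLe_singleton 0 a
    rw [h2] at h1
    rw [h1]
    simp only [Finset.range_zero, Finset.prod_empty, Set.indicator_apply, Set.mem_singleton_iff]
    congr 1
    apply propext
    constructor
    · intro h; exact (congrFun h ⟨0, by simp⟩).symm
    · intro h
      funext ⟨k, hk⟩
      have : k = 0 := by simpa using hk
      subst this
      exact h.symm
  | succ n ih =>
    have h0 := ProbabilityTheory.Kernel.traj_comp_partialTraj (X := fun _ => S) (κ := κ)
      (Nat.zero_le n)
    have h1 := congrArg (fun k => k (fun _ => x) (pathCylinder (n + 1) a)) h0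
    beta_reduce at h1
    rw [ProbabilityTheory.Kernel.comp_apply' _ _ _ (measurableSet_pathCylinder _ _)] at h1
    have h2 : ∀ z : (Π _ : Finset.Iic n, S),
        ProbabilityTheory.Kernel.traj (X := fun _ => S) κ n z (pathCylinder (n + 1) a) =
        Set.indicator {fun i : Finset.Iic n => a i.1} (fun _ => P (a n) (a (n + 1))) z := by
      intro z
      have h3 := ProbabilityTheory.Kernel.traj_map_frestrictLe_of_le (X := fun _ => S) (κ := κ)
        (le_refl n)
      have h3' := congrArg (fun k => k z {z}) h3
      beta_reduce at h3'
      rw [ProbabilityTheory.Kernel.map_apply' _ (Preorder.measurable_frestrictLe _) _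
        (measurableSet_singleton _),
        ProbabilityTheory.Kernel.deterministic_apply' _ _ (measurableSet_singleton _)] at h3'
      have h4 : ∀ᵐ y ∂(ProbabilityTheory.Kernel.traj (X := fun _ => S) κ n z),
          Preorder.frestrictLe (π := fun _ : ℕ => S) n y = z := by
        refine (mem_ae_iff_prob_eq_one (s := Preorder.frestrictLe (π := fun _ : ℕ => S) n ⁻¹' {z})
          (Preorder.measurable_frestrictLe n (measurableSet_singleton z))).2 ?_
        rw [h3', Set.indicator_of_mem]
        exact Set.mem_singleton z
      have h5 := ProbabilityTheory.Kernel.map_traj_succ_self (X := fun _ => S) (κ := κ) (a := n)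
      have h5' := congrArg (fun k => k z {a (n + 1)}) h5
      beta_reduce at h5'
      rw [ProbabilityTheory.Kernel.map_apply' _ (by fun_prop) _ (measurableSet_singleton _)] at h5'
      have h6 : κ n z {a (n + 1)} = P (z ⟨n, by simp⟩) (a (n + 1)) := by
        change (p (z ⟨n, by simp⟩)).toMeasure {a (n + 1)} = _
        rw [PMF.toMeasure_apply_singleton _ _ (measurableSet_singleton _)]
        rfl
      by_cases hz : z = fun i : Finset.Iic n => a i.1
      · rw [Set.indicator_of_mem (by simpa using hz)]
        rw [h6, hz] at h5'
        rw [← h5', ← hz]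
        refine measure_congr ?_
        filter_upwards [h4] with y hy
        apply propext
        constructor
        · intro h; exact h (n + 1) le_rfl
        · intro h k hk
          rcases Nat.lt_or_ge n k with h' | h'
          · have : k = n + 1 := by omega
            subst this; exact h
          · have := congrFun hy ⟨k, Finset.mem_Iic.2 h'⟩
            rw [hz] at this
            exact this
      · rw [Set.indicator_of_notMem (by simpa using hz)]
        refine (measure_eq_zero_iff_ae_notMem).2 ?_
        filter_upwards [h4] with y hy hy'
        apply hz
        rw [← hy]
        funext ⟨k, hk⟩
        exact hy' k ((Finset.mem_Iic.1 hk).trans (Nat.le_succ n))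
    simp only [h2] at h1
    rw [lintegral_indicator_const (measurableSet_singleton _),
      ← ProbabilityTheory.Kernel.traj_map_frestrictLe_apply,
      Measure.map_apply (Preorder.measurable_frestrictLe _) (measurableSet_singleton _)] at h1
    have h7 : (Preorder.frestrictLe (π := fun _ : ℕ => S) n) ⁻¹' {fun i => a i.1} =
        pathCylinder n a := preimage_frestrictLe_singleton n a
    rw [h7] at h1
    change M x _ = _
    rw [← h1]
    change _ * M x _ = _
    rw [ih, Finset.prod_range_succ]
    split_ifs
    · rw [mul_comm]
    · simp

namespace IsPathFamily

variable {P : S → S → ℝ≥0∞} {M : S → Measure (ℕ → S)}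

omit [Countable S] in
theorem ae_start (hM : IsPathFamily P M) (x : S) : ∀ᵐ y ∂M x, y 0 = x := by
  have := hM.prob x
  have h1 : M x (pathCylinder 0 fun _ => x) = 1 := by simp [hM.cyl]
  have h2 := (mem_ae_iff_prob_eq_one (measurableSet_pathCylinder _ _)).2 h1
  filter_upwards [h2] with y hy using hy 0 le_rfl

omit [Countable S] in
theorem apply_of_start_ne (hM : IsPathFamily P M) {x : S} {C : Set (ℕ → S)}
    (h : ∀ y ∈ C, y 0 ≠ x) : M x C = 0 := by
  refine measure_eq_zero_iff_ae_notMem.2 ?_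
  filter_upwards [hM.ae_start x] with y hy hC using h y hC hy

/-- The Markov property at time one. -/
theorem apply_eq_tsum (hM : IsPathFamily P M) (x : S) {C : Set (ℕ → S)} (hC : MeasurableSet C) :
    M x C = ∑' z, P x z * M z (consPath x ⁻¹' C) := by
  classical
  have := hM.prob
  let N : Measure (ℕ → S) := Measure.sum fun z => P x z • (M z).map (consPath x)
  have hN : ∀ {C : Set (ℕ → S)}, MeasurableSet C → N C = ∑' z, P x z * M z (consPath x ⁻¹' C) := by
    intro C hC
    simp only [N, Measure.sum_apply _ hC, Measure.smul_apply, smul_eq_mul]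
    congr 1; funext z
    rw [Measure.map_apply (measurable_consPath x) hC]
  have hcyl : ∀ n a, M x (pathCylinder (n + 1) a) = N (pathCylinder (n + 1) a) := by
    intro n a
    rw [hN (measurableSet_pathCylinder _ _), hM.cyl]
    by_cases h : a 0 = x
    · have h1 : consPath x ⁻¹' pathCylinder (n + 1) a = pathCylinder n fun k => a (k + 1) := by
        ext y
        constructor
        · intro hy k hk
          exact hy (k + 1) (by omega)
        · intro hy k hk
          cases k with
          | zero => exact h.symm
          | succ k => exact hy k (by omega)
      rw [if_pos h, h1, tsum_eq_single (a 1), hM.cyl, if_pos rfl, Finset.prod_range_succ', h,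
        mul_comm]
      intro z hz
      rw [hM.cyl, if_neg (Ne.symm hz), mul_zero]
    · have h1 : consPath x ⁻¹' pathCylinder (n + 1) a = ∅ := by
        ext y
        simp only [Set.mem_preimage, Set.mem_empty_iff_false, iff_false]
        intro hy
        exact h (hy 0 (by omega)).symm
      simp [h1, h]
  have h0 : ∀ (L : Measure (ℕ → S)) (a : ℕ → S), L (pathCylinder 0 a) =
      ∑' z, L (pathCylinder 1 fun k => if k = 0 then a 0 else z) := by
    intro L a
    rw [← measure_iUnion]
    · congr 1
      ext y
      simp only [pathCylinder, Set.mem_ofPred_eq, Set.mem_iUnion]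
      constructor
      · intro h
        refine ⟨y 1, fun k hk => ?_⟩
        interval_cases k
        · simpa using h 0 le_rfl
        · simp
      · rintro ⟨z, h⟩ k hk
        interval_cases k
        simpa using h 0 (by omega)
    · intro z z' hz
      rw [Function.onFun, Set.disjoint_left]
      intro y hy hy'
      apply hz
      have h1 := hy 1 le_rfl
      have h2 := hy' 1 le_rfl
      simp only [one_ne_zero, if_false] at h1 h2
      rw [← h1, h2]
    · exact fun z => measurableSet_pathCylinder _ _
  have hall : ∀ n a, M x (pathCylinder n a) = N (pathCylinder n a) := by
    intro n a
    cases n with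
    | zero => rw [h0, h0 N]; simp only [hcyl 0]
    | succ n => exact hcyl n a
  have hfin : IsFiniteMeasure N := by
    constructor
    have huniv : ∀ L : Measure (ℕ → S), L Set.univ = ∑' z, L (pathCylinder 0 fun _ => z) := by
      intro L
      rw [← measure_iUnion]
      · congr 1
        ext y
        simp [pathCylinder]
      · intro z z' hz
        rw [Function.onFun, Set.disjoint_left]
        intro y hy hy'
        exact hz ((hy 0 le_rfl).symm.trans (hy' 0 le_rfl))
      · exact fun z => measurableSet_pathCylinder _ _
    rw [huniv]
    simp only [← hall]
    rw [← huniv]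
    exact measure_lt_top _ _
  rw [ext_of_pathCylinder hall, hN hC]

/-- The Markov property at time `n` on the event that `A` is avoided before. -/
theorem apply_inter_shiftPath (hM : IsPathFamily P M) (A : Set S) (n : ℕ) (x z : S)
    {C : Set (ℕ → S)} (hC : MeasurableSet C) :
    M x ({y | (∀ k < n, y k ∉ A) ∧ y n = z} ∩ shiftPath n ⁻¹' C) =
      pathProb P A n x z * M z C := by
  classical
  have hmeas : ∀ n, MeasurableSet
      ({y : ℕ → S | (∀ k < n, y k ∉ A) ∧ y n = z} ∩ shiftPath n ⁻¹' C) := by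
    intro n
    exact (measurableSet_visit A n z).inter (measurable_shiftPath n hC)
  induction n generalizing x with
  | zero =>
    by_cases hxz : x = z
    · subst hxz
      simp only [pathProb, if_true, one_mul]
      refine measure_congr ?_
      filter_upwards [hM.ae_start x] with y hy
      apply propext
      constructor
      · intro h
        have := h.2
        rwa [Set.mem_preimage, shiftPath_zero] at this
      · intro h
        refine ⟨⟨by simp, hy⟩, ?_⟩
        rw [Set.mem_preimage, shiftPath_zero]
        exact h
    · simp only [pathProb, if_neg hxz, zero_mul]
      refine hM.apply_of_start_ne fun y hy h => hxz ?_
      rw [← h]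
      exact hy.1.2
  | succ n ih =>
    rw [hM.apply_eq_tsum x (hmeas (n + 1))]
    by_cases hxA : x ∈ A
    · simp only [pathProb, if_pos hxA, zero_mul]
      rw [ENNReal.tsum_eq_zero]
      intro w
      convert mul_zero _
      convert measure_empty (μ := M w)
      ext y
      simp only [Set.mem_preimage, Set.mem_empty_iff_false, iff_false]
      intro hy
      exact hy.1.1 0 (by omega) hxA
    · simp only [pathProb, if_neg hxA]
      rw [← ENNReal.tsum_mul_right]
      congr 1; funext w
      rw [mul_assoc, ← ih w]
      congr 2
      ext y
      simp only [Set.mem_preimage, Set.mem_inter_iff, shiftPath_succ_consPath, Set.mem_ofPred_eq,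
        consPath_succ]
      refine and_congr_left fun _ => and_congr_left fun _ => ?_
      constructor
      · intro h k hk
        exact h (k + 1) (by omega)
      · intro h k hk
        cases k with
        | zero => exact hxA
        | succ k => exact h k (by omega)

theorem apply_visit (hM : IsPathFamily P M) (A : Set S) (n : ℕ) (x z : S) :
    M x {y | (∀ k < n, y k ∉ A) ∧ y n = z} = pathProb P A n x z := by
  have := hM.prob z
  have h := hM.apply_inter_shiftPath A n x z MeasurableSet.univ
  simpa using h

/-- The Markov property at a fixed time. -/
theorem apply_shiftPath (hM : IsPathFamily P M) (n : ℕ) (x : S) {C : Set (ℕ → S)}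
    (hC : MeasurableSet C) :
    M x (shiftPath n ⁻¹' C) = ∑' z, pathProb P ∅ n x z * M z C := by
  have h : shiftPath n ⁻¹' C =
      ⋃ z, {y : ℕ → S | (∀ k < n, y k ∉ (∅ : Set S)) ∧ y n = z} ∩ shiftPath n ⁻¹' C := by
    ext y; simp
  conv_lhs => rw [h]
  rw [measure_iUnion]
  · congr 1; funext z
    exact hM.apply_inter_shiftPath ∅ n x z hC
  · intro z z' hz
    rw [Function.onFun, Set.disjoint_left]
    intro y hy hy'
    exact hz (hy.1.2.symm.trans hy'.1.2)
  · intro z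
    refine MeasurableSet.inter ?_ (measurable_shiftPath n hC)
    exact measurableSet_visit ∅ n z

/-- Almost surely the chain only makes steps of positive probability. -/
theorem ae_step_ne_zero (hM : IsPathFamily P M) (x : S) :
    ∀ᵐ y ∂M x, ∀ n, P (y n) (y (n + 1)) ≠ 0 := by
  refine ae_all_iff.2 fun n => ?_
  have h1 : MeasurableSet {y : ℕ → S | P (y 0) (y 1) = 0} := by
    have : {y : ℕ → S | P (y 0) (y 1) = 0} =
        (fun y : ℕ → S => (y 0, y 1)) ⁻¹' {p | P p.1 p.2 = 0} := rfl
    rw [this]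
    exact ((measurable_pi_apply 0).prodMk (measurable_pi_apply 1)) MeasurableSet.of_discrete
  have h2 := hM.apply_shiftPath n x h1
  have h3 : ∀ z, M z {y : ℕ → S | P (y 0) (y 1) = 0} = 0 := by
    intro z
    rw [hM.apply_eq_tsum z h1, ENNReal.tsum_eq_zero]
    intro w
    by_cases hw : P z w = 0
    · rw [hw, zero_mul]
    · rw [hM.apply_of_start_ne, mul_zero]
      intro y hy h
      apply hw
      rw [← h]
      exact hy
  simp only [h3, mul_zero, tsum_zero] at h2
  exact measure_eq_zero_iff_ae_notMem.1 h2

end IsPathFamily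

end PathLaw

/-! ### Birkhoff's pointwise ergodic theorem for ergodic maps -/

section Birkhoff

variable {α : Type*}

/-- The largest of the Birkhoff sums of order at most `N`, including the empty sum. -/
def birkhoffMax (T : α → α) (f : α → ℝ) : ℕ → α → ℝ
  | 0, _ => 0
  | N + 1, x => max 0 (f x + birkhoffMax T f N (T x))

theorem birkhoffMax_nonneg (T : α → α) (f : α → ℝ) (N : ℕ) (x : α) :
    0 ≤ birkhoffMax T f N x := by
  cases N with
  | zero => exact le_rfl
  | succ N => exact le_max_left _ _

theorem birkhoffMax_le_succ (T : α → α) (f : α → ℝ) (N : ℕ) (x : α) :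
    birkhoffMax T f N x ≤ birkhoffMax T f (N + 1) x := by
  induction N generalizing x with
  | zero => exact birkhoffMax_nonneg T f 1 x
  | succ N ih => exact max_le_max le_rfl (add_le_add le_rfl (ih (T x)))

theorem birkhoffSum_le_birkhoffMax (T : α → α) (f : α → ℝ) (N : ℕ) (x : α) :
    birkhoffSum T f N x ≤ birkhoffMax T f N x := by
  induction N generalizing x with
  | zero => simp [birkhoffMax]
  | succ N ih =>
    rw [birkhoffSum_succ']
    exact (add_le_add le_rfl (ih (T x))).trans (le_max_right _ _)

variable [MeasurableSpace α] {μ : Measure α}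

theorem measurable_birkhoffMax {T : α → α} (hT : Measurable T) {f : α → ℝ} (hf : Measurable f)
    (N : ℕ) : Measurable (birkhoffMax T f N) := by
  induction N with
  | zero => exact measurable_const
  | succ N ih => exact measurable_const.max (hf.add (ih.comp hT))

theorem integrable_birkhoffMax {T : α → α} (hT : MeasurePreserving T μ μ) {f : α → ℝ}
    (hf : Integrable f μ) (N : ℕ) : Integrable (birkhoffMax T f N) μ := by
  induction N with
  | zero => exact integrable_zero _ _ _
  | succ N ih => exact (integrable_zero _ _ _).sup (hf.add (hT.integrable_comp_of_integrable ih))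

/-- The maximal ergodic inequality: `f` has nonnegative integral over the set where some Birkhoff
sum of order at most `N + 1` is positive. -/
theorem setIntegral_birkhoffMax_pos_nonneg {T : α → α} (hT : MeasurePreserving T μ μ) {f : α → ℝ}
    (hfm : Measurable f) (hf : Integrable f μ) (N : ℕ) :
    0 ≤ ∫ x in {x | 0 < birkhoffMax T f (N + 1) x}, f x ∂μ := by
  have hE : MeasurableSet {x | 0 < birkhoffMax T f (N + 1) x} :=
    measurableSet_lt measurable_const (measurable_birkhoffMax hT.measurable hfm _)
  rw [← integral_indicator hE]
  have h1 : ∫ x, (birkhoffMax T f (N + 1) x - birkhoffMax T f N (T x)) ∂μ ≤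
      ∫ x, Set.indicator {x | 0 < birkhoffMax T f (N + 1) x} f x ∂μ := by
    refine integral_mono ((integrable_birkhoffMax hT hf _).sub
      (hT.integrable_comp_of_integrable (integrable_birkhoffMax hT hf N))) (hf.indicator hE) ?_
    intro x
    by_cases hx : 0 < birkhoffMax T f (N + 1) x
    · rw [Set.indicator_of_mem (by exact hx)]
      have h2 : birkhoffMax T f (N + 1) x = f x + birkhoffMax T f N (T x) := by
        simp only [birkhoffMax] at hx ⊢
        rcases le_total 0 (f x + birkhoffMax T f N (T x)) with h | h
        · exact max_eq_right h
        · rw [max_eq_left h] at hx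
          exact absurd hx (lt_irrefl _)
      simp only [h2]
      linarith
    · rw [Set.indicator_of_notMem (by exact hx)]
      have h2 := birkhoffMax_nonneg T f N (T x)
      have h3 := not_lt.1 hx
      simp only
      linarith
  refine le_trans ?_ h1
  have hc : ∫ x, birkhoffMax T f N (T x) ∂μ = ∫ x, birkhoffMax T f N x ∂μ := by
    have h := integral_map (μ := μ) hT.measurable.aemeasurable (f := birkhoffMax T f N)
      (measurable_birkhoffMax hT.measurable hfm N).aestronglyMeasurable
    rw [hT.map_eq] at h
    exact h.symm
  have hi : Integrable (fun x => birkhoffMax T f N (T x)) μ :=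
    hT.integrable_comp_of_integrable (integrable_birkhoffMax hT hf N)
  rw [integral_sub (integrable_birkhoffMax hT hf _) hi, hc, sub_nonneg]
  exact integral_mono (integrable_birkhoffMax hT hf _) (integrable_birkhoffMax hT hf _)
    (birkhoffMax_le_succ T f N)

/-- If `f` has negative integral, then its Birkhoff sums are almost surely bounded above. -/
theorem ae_birkhoffSum_le_of_integral_neg [IsProbabilityMeasure μ] {T : α → α} (hT : Ergodic T μ)
    {f : α → ℝ} (hfm : Measurable f) (hf : Integrable f μ) (hneg : ∫ x, f x ∂μ < 0) :
    ∀ᵐ x ∂μ, ∃ c : ℕ, ∀ n, birkhoffSum T f n x ≤ c := by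
  have hTm := hT.measurable
  have hSm : ∀ n, Measurable (birkhoffSum T f n) := fun n =>
    Finset.measurable_sum _ fun k _ => hfm.comp (hTm.iterate k)
  let A : Set α := {x | ∀ c : ℕ, ∃ n, (c : ℝ) < birkhoffSum T f n x}
  have hA : MeasurableSet A := by
    have : A = ⋂ c : ℕ, ⋃ n, {x | (c : ℝ) < birkhoffSum T f n x} := by
      ext x; simp [A]
    rw [this]
    exact MeasurableSet.iInter fun c => MeasurableSet.iUnion fun n =>
      measurableSet_lt measurable_const (hSm n)
  have hinv : T ⁻¹' A = A := by
    ext x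
    constructor
    · intro h c
      obtain ⟨c', hc'⟩ := exists_nat_ge (c - f x)
      obtain ⟨n, hn⟩ := h c'
      refine ⟨n + 1, ?_⟩
      rw [birkhoffSum_succ']
      linarith
    · intro h c
      obtain ⟨c', hc'⟩ := exists_nat_ge (c + |f x|)
      obtain ⟨n, hn⟩ := h c'
      have hc0 : (0 : ℝ) ≤ c := Nat.cast_nonneg c
      cases n with
      | zero =>
        rw [birkhoffSum_zero] at hn
        have := abs_nonneg (f x)
        linarith
      | succ n =>
        rw [birkhoffSum_succ'] at hn
        refine ⟨n, ?_⟩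
        have := le_abs_self (f x)
        linarith
  rcases hT.toPreErgodic.prob_eq_zero_or_one hA hinv with h | h
  · filter_upwards [measure_eq_zero_iff_ae_notMem.1 h] with x hx
    have hx' : ¬ ∀ c : ℕ, ∃ n, (c : ℝ) < birkhoffSum T f n x := hx
    push Not at hx'
    exact hx'
  · exfalso
    let E : ℕ → Set α := fun N => {x | 0 < birkhoffMax T f (N + 1) x}
    have hE : ∀ N, MeasurableSet (E N) := fun N =>
      measurableSet_lt measurable_const (measurable_birkhoffMax hTm hfm _)
    have hmono : Monotone E := monotone_nat_of_le_succ fun N x hx =>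
      lt_of_lt_of_le hx (birkhoffMax_le_succ T f (N + 1) x)
    have hlim := tendsto_setIntegral_of_monotone hE hmono hf.integrableOn
    have hU : ∫ x in ⋃ N, E N, f x ∂μ = ∫ x, f x ∂μ := by
      rw [setIntegral_congr_set (t := Set.univ), setIntegral_univ]
      filter_upwards [(mem_ae_iff_prob_eq_one hA).2 h] with x hx
      refine propext ⟨fun _ => trivial, fun _ => ?_⟩
      obtain ⟨n, hn⟩ := hx 0
      refine Set.mem_iUnion.2 ⟨n, ?_⟩
      refine lt_of_lt_of_le ?_ (birkhoffMax_le_succ T f n x)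
      refine lt_of_lt_of_le ?_ (birkhoffSum_le_birkhoffMax T f n x)
      simpa using hn
    rw [hU] at hlim
    have := ge_of_tendsto' hlim fun N =>
      setIntegral_birkhoffMax_pos_nonneg hT.toMeasurePreserving hfm hf N
    linarith

/-- Every number above the mean bounds the Birkhoff averages up to an error of order `1 / n`. -/
theorem ae_birkhoffSum_le_add [IsProbabilityMeasure μ] {T : α → α} (hT : Ergodic T μ)
    {f : α → ℝ} (hfm : Measurable f) (hf : Integrable f μ) {b : ℝ} (hb : ∫ x, f x ∂μ < b) :
    ∀ᵐ x ∂μ, ∃ c : ℕ, ∀ n : ℕ, birkhoffSum T f n x ≤ c + n * b := by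
  have h1 : ∫ x, (f x - b) ∂μ < 0 := by
    rw [integral_sub hf (integrable_const b)]
    simp only [integral_const, probReal_univ, smul_eq_mul, one_mul]
    linarith
  filter_upwards [ae_birkhoffSum_le_of_integral_neg hT (hfm.sub_const b)
    (hf.sub (integrable_const b)) h1] with x ⟨c, hc⟩
  refine ⟨c, fun n => ?_⟩
  have h2 := hc n
  have h3 : birkhoffSum T (fun x => f x - b) n x = birkhoffSum T f n x - n * b := by
    simp [birkhoffSum, Finset.sum_sub_distrib]
  linarith

/-- Birkhoff's theorem for an ergodic map. -/
theorem ae_tendsto_birkhoffSum_div [IsProbabilityMeasure μ] {T : α → α} (hT : Ergodic T μ)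
    {f : α → ℝ} (hfm : Measurable f) (hf : Integrable f μ) :
    ∀ᵐ x ∂μ, Tendsto (fun n : ℕ => birkhoffSum T f n x / n) atTop (𝓝 (∫ x, f x ∂μ)) := by
  have hup : ∀ k : ℕ, ∀ᵐ x ∂μ, ∃ c : ℕ, ∀ n : ℕ,
      birkhoffSum T f n x ≤ c + n * (∫ x, f x ∂μ + 1 / ((k : ℝ) + 1)) := fun k =>
    ae_birkhoffSum_le_add hT hfm hf (by have := Nat.one_div_pos_of_nat (α := ℝ) (n := k); linarith)
  have hlo : ∀ k : ℕ, ∀ᵐ x ∂μ, ∃ c : ℕ, ∀ n : ℕ,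
      birkhoffSum T (-f) n x ≤ c + n * (-∫ x, f x ∂μ + 1 / ((k : ℝ) + 1)) := fun k =>
    ae_birkhoffSum_le_add hT hfm.neg hf.neg (by
      have := Nat.one_div_pos_of_nat (α := ℝ) (n := k)
      simp only [Pi.neg_apply, integral_neg]
      linarith)
  filter_upwards [ae_all_iff.2 hup, ae_all_iff.2 hlo] with x hx1 hx2
  rw [Metric.tendsto_atTop]
  intro ε hε
  obtain ⟨k, hk⟩ := exists_nat_one_div_lt (half_pos hε)
  obtain ⟨c, hc⟩ := hx1 k
  obtain ⟨d, hd⟩ := hx2 k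
  obtain ⟨N, hN⟩ := exists_nat_gt ((c + d) / (ε / 2))
  refine ⟨N + 1, fun n hn => ?_⟩
  have hn0 : (0 : ℝ) < n := by exact_mod_cast (by omega : 0 < n)
  have hNn : (N : ℝ) ≤ n := by exact_mod_cast (by omega : N ≤ n)
  have h1 : (c : ℝ) + d < n * (ε / 2) := by
    rw [div_lt_iff₀ (half_pos hε)] at hN
    nlinarith
  have h2 := hc n
  have h3 := hd n
  have h4 : birkhoffSum T (-f) n x = -birkhoffSum T f n x := by simp [birkhoffSum]
  rw [h4] at h3
  have hc0 : (0 : ℝ) ≤ c := Nat.cast_nonneg c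
  have hd0 : (0 : ℝ) ≤ d := Nat.cast_nonneg d
  have h5 : (n : ℝ) * (1 / ((k : ℝ) + 1)) < n * (ε / 2) := by gcongr
  rw [Real.dist_eq, abs_lt]
  constructor
  · have : (-ε + ∫ x, f x ∂μ) < birkhoffSum T f n x / n := by
      rw [lt_div_iff₀ hn0]
      nlinarith
    linarith
  · have : birkhoffSum T f n x / n < ε + ∫ x, f x ∂μ := by
      rw [div_lt_iff₀ hn0]
      nlinarith
    linarith

end Birkhoff

/-! ### Ergodicity of stationary Markov chains -/

section StationaryChain

variable {S : Type*} [MeasurableSpace S] [DiscreteMeasurableSpace S] [Countable S]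
  {P : S → S → ℝ≥0∞} {M : S → Measure (ℕ → S)}

/-- The law of the chain whose initial state has law `π`. -/
noncomputable def mixedLaw (M : S → Measure (ℕ → S)) (π : S → ℝ≥0∞) : Measure (ℕ → S) :=
  Measure.sum fun z => π z • M z

omit [DiscreteMeasurableSpace S] [Countable S] in
theorem mixedLaw_apply (M : S → Measure (ℕ → S)) (π : S → ℝ≥0∞) {C : Set (ℕ → S)}
    (hC : MeasurableSet C) : mixedLaw M π C = ∑' z, π z * M z C := by
  simp [mixedLaw, Measure.sum_apply _ hC]

omit [DiscreteMeasurableSpace S] in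
theorem ae_mixedLaw_iff {π : S → ℝ≥0∞} {p : (ℕ → S) → Prop} :
    (∀ᵐ y ∂mixedLaw M π, p y) ↔ ∀ z, π z ≠ 0 → ∀ᵐ y ∂M z, p y := by
  rw [mixedLaw, Measure.ae_sum_iff]
  refine forall_congr' fun z => ?_
  constructor
  · intro h hz
    exact (Measure.ae_ennreal_smul_measure_iff hz).1 h
  · intro h
    by_cases hz : π z = 0
    · simp [hz]
    · exact (Measure.ae_ennreal_smul_measure_iff hz).2 (h hz)

namespace IsPathFamily

omit [DiscreteMeasurableSpace S] [Countable S] in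
theorem isProbabilityMeasure_mixedLaw (hM : IsPathFamily P M) (π : PMF S) :
    IsProbabilityMeasure (mixedLaw M π) := by
  constructor
  rw [mixedLaw_apply _ _ MeasurableSet.univ, ← π.tsum_coe]
  congr 1; funext z
  have := hM.prob z
  simp

theorem apply_shiftPath_one (hM : IsPathFamily P M) (x : S) {C : Set (ℕ → S)}
    (hC : MeasurableSet C) : M x (shiftPath 1 ⁻¹' C) = ∑' z, P x z * M z C := by
  rw [hM.apply_eq_tsum x (measurable_shiftPath 1 hC)]
  congr 1; funext z
  congr 2
  ext y
  simp [shiftPath_one_consPath]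

theorem measurePreserving_shiftPath (hM : IsPathFamily P M) {π : PMF S}
    (hπ : IsInvariantLaw P π) (n : ℕ) :
    MeasurePreserving (shiftPath n) (mixedLaw M π) (mixedLaw M π) := by
  have h1 : MeasurePreserving (shiftPath 1) (mixedLaw M π) (mixedLaw M π) := by
    refine ⟨measurable_shiftPath 1, ?_⟩
    ext C hC
    rw [Measure.map_apply (measurable_shiftPath 1) hC,
      mixedLaw_apply _ _ (measurable_shiftPath 1 hC), mixedLaw_apply _ _ hC]
    calc ∑' x, π x * M x (shiftPath 1 ⁻¹' C)
        = ∑' x, ∑' z, π x * P x z * M z C := by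
          congr 1; funext x
          rw [hM.apply_shiftPath_one x hC, ← ENNReal.tsum_mul_left]
          simp only [mul_assoc]
      _ = ∑' z, ∑' x, π x * P x z * M z C := ENNReal.tsum_comm
      _ = ∑' z, π z * M z C := by
          congr 1; funext z
          rw [ENNReal.tsum_mul_right, hπ z]
  induction n with
  | zero =>
    have : shiftPath (S := S) 0 = id := by funext y; exact shiftPath_zero y
    rw [this]
    exact MeasurePreserving.id _
  | succ n ih =>
    have : shiftPath (S := S) (n + 1) = shiftPath n ∘ shiftPath 1 := by
      funext y
      rw [Function.comp, shiftPath_shiftPath, Nat.add_comm]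
    rw [this]
    exact ih.comp h1

/-- The Markov property on a cylinder. -/
theorem apply_pathCylinder_inter_shiftPath (hM : IsPathFamily P M) (n : ℕ) (x : S) (a : ℕ → S)
    {C : Set (ℕ → S)} (hC : MeasurableSet C) :
    M x (pathCylinder n a ∩ shiftPath n ⁻¹' C) = M x (pathCylinder n a) * M (a n) C := by
  induction n generalizing x a with
  | zero =>
    by_cases h : a 0 = x
    · have hp := hM.prob x
      rw [hM.cyl, if_pos h, Finset.range_zero, Finset.prod_empty, one_mul, h]
      refine measure_congr ?_
      filter_upwards [hM.ae_start x] with y hy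
      refine propext ⟨fun h1 => ?_, fun h1 => ⟨fun k hk => ?_, ?_⟩⟩
      · have h2 : shiftPath 0 y ∈ C := h1.2
        rwa [shiftPath_zero] at h2
      · rw [Nat.le_zero.1 hk, hy, h]
      · rw [Set.mem_preimage, shiftPath_zero]
        exact h1
    · rw [hM.cyl, if_neg h, zero_mul]
      exact hM.apply_of_start_ne fun y hy hx => h (by rw [← hx]; exact (hy.1 0 le_rfl).symm)
  | succ n ih =>
    rw [hM.apply_eq_tsum x ((measurableSet_pathCylinder _ _).inter (measurable_shiftPath _ hC)),
      hM.apply_eq_tsum x (measurableSet_pathCylinder _ _), ← ENNReal.tsum_mul_right]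
    congr 1; funext z
    rw [mul_assoc]
    congr 1
    by_cases h : a 0 = x
    · have h1 : consPath x ⁻¹' pathCylinder (n + 1) a = pathCylinder n fun k => a (k + 1) := by
        ext y
        constructor
        · intro hy k hk
          exact hy (k + 1) (by omega)
        · intro hy k hk
          cases k with
          | zero => exact h.symm
          | succ k => exact hy k (by omega)
      have h2 : consPath x ⁻¹' (shiftPath (n + 1) ⁻¹' C) = shiftPath n ⁻¹' C := by
        ext y
        simp [shiftPath_succ_consPath]
      rw [Set.preimage_inter, h1, h2]
      exact ih z fun k => a (k + 1)
    · have h1 : consPath x ⁻¹' pathCylinder (n + 1) a = ∅ := by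
        ext y
        simp only [Set.mem_preimage, Set.mem_empty_iff_false, iff_false]
        intro hy
        exact h (hy 0 (by omega)).symm
      simp [h1]

/-- A stationary irreducible chain visits every state. Being invariant under the shift up to a
null set, the event of never visiting `s` has probability zero from every state that is reachable
from `s`. -/
theorem ae_exists_visit (hM : IsPathFamily P M) {π : PMF S} (hπ : IsInvariantLaw P π)
    {s z : S} (hs : π s ≠ 0) {n : ℕ} (hsz : pathProb P ∅ n s z ≠ 0) :
    ∀ᵐ y ∂M z, ∃ t, y t = s := by
  let D : Set (ℕ → S) := {y | ∀ t, y t ≠ s}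
  have hD : MeasurableSet D := by
    have : D = ⋂ t, (fun y : ℕ → S => y t) ⁻¹' {s}ᶜ := by ext y; simp [D]
    rw [this]
    exact MeasurableSet.iInter fun t => measurable_pi_apply t MeasurableSet.of_discrete
  have hDn : D ⊆ shiftPath n ⁻¹' D := fun y hy t => hy (n + t)
  have hp := hM.isProbabilityMeasure_mixedLaw π
  have h1 : mixedLaw M π (shiftPath n ⁻¹' D \ D) = 0 := by
    rw [measure_sdiff hDn hD.nullMeasurableSet (measure_ne_top _ _),
      (hM.measurePreserving_shiftPath hπ n).measure_preimage hD.nullMeasurableSet, tsub_self]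
  have h2 : ∀ᵐ y ∂M s, ¬ shiftPath n y ∈ D := by
    have h3 := ae_mixedLaw_iff.1 (measure_eq_zero_iff_ae_notMem.1 h1) s hs
    filter_upwards [h3, hM.ae_start s] with y hy hy0 hyD
    exact hy ⟨hyD, fun h => h 0 hy0⟩
  have h4 : M s (shiftPath n ⁻¹' D) = 0 := measure_eq_zero_iff_ae_notMem.2 h2
  rw [hM.apply_shiftPath n s hD, ENNReal.tsum_eq_zero] at h4
  have h5 : M z D = 0 := (mul_eq_zero.1 (h4 z)).resolve_left hsz
  filter_upwards [measure_eq_zero_iff_ae_notMem.1 h5] with y hy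
  have hy' : ¬ ∀ t, y t ≠ s := hy
  push Not at hy'
  exact hy'

/-- A shift-invariant event has the same probability from `z` as from a state that the chain
started at `z` visits almost surely. -/
theorem apply_eq_of_invariant (hM : IsPathFamily P M) {s z : S}
    (hv : ∀ᵐ y ∂M z, ∃ t, y t = s) {A : Set (ℕ → S)} (hA : MeasurableSet A)
    (hinv : ∀ n, shiftPath n ⁻¹' A = A) : M z A = M s A := by
  have key : ∀ C : Set (ℕ → S), MeasurableSet C → (∀ n, shiftPath n ⁻¹' C = C) →
      M z C = (∑' t, pathProb P {s} t z s) * M s C := by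
    intro C hC hCinv
    have h1 : M z C =
        M z (⋃ t, {y : ℕ → S | (∀ k < t, y k ∉ ({s} : Set S)) ∧ y t = s} ∩ C) := by
      refine measure_congr ?_
      filter_upwards [hv] with y hy
      refine propext ⟨fun h => ?_, fun h => ?_⟩
      · classical
        refine Set.mem_iUnion.2 ⟨Nat.find hy, ⟨fun k hk => ?_, Nat.find_spec hy⟩, h⟩
        exact Nat.find_min hy hk
      · obtain ⟨t, ht⟩ := Set.mem_iUnion.1 h
        exact ht.2
    rw [h1, measure_iUnion, ← ENNReal.tsum_mul_right]
    · congr 1; funext t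
      rw [← hM.apply_inter_shiftPath {s} t z s hC, hCinv]
    · intro t t' ht
      rw [Function.onFun, Set.disjoint_left]
      rintro y ⟨hy, -⟩ ⟨hy', -⟩
      rcases lt_or_gt_of_ne ht with h | h
      · exact hy'.1 t h hy.2
      · exact hy.1 t' h hy'.2
    · exact fun t => (measurableSet_visit _ _ _).inter hC
  have h1 := key Set.univ MeasurableSet.univ fun _ => rfl
  have := hM.prob z
  have := hM.prob s
  rw [measure_univ, measure_univ, mul_one] at h1
  rw [key A hA hinv, ← h1, one_mul]

/-- The shift is ergodic for a stationary irreducible chain. Starting from any relevant state, an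
invariant event has the same probability; by the Markov property it is therefore independent of
every cylinder, hence of itself. -/
theorem ergodic_shiftPath (hM : IsPathFamily P M) {π : PMF S} (hπ : IsInvariantLaw P π)
    (hirr : ∀ x y, π x ≠ 0 → π y ≠ 0 → ∃ n, pathProb P ∅ n x y ≠ 0) :
    Ergodic (shiftPath 1) (mixedLaw M π) := by
  have hp := hM.isProbabilityMeasure_mixedLaw π
  refine ⟨hM.measurePreserving_shiftPath hπ 1, ⟨fun A hA hinv1 => ?_⟩⟩
  have hinv : ∀ n, shiftPath n ⁻¹' A = A := by
    intro n
    induction n with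
    | zero => ext y; simp [shiftPath_zero]
    | succ n ih =>
      conv_rhs => rw [← hinv1, ← ih]
      ext y
      simp only [Set.mem_preimage, shiftPath_shiftPath]
      rw [Nat.add_comm]
  obtain ⟨s, hs⟩ := π.support_nonempty
  have hs : π s ≠ 0 := (PMF.mem_support_iff _ _).1 hs
  have hconst : ∀ z, π z ≠ 0 → M z A = M s A := fun z hz => by
    obtain ⟨n, hn⟩ := hirr s z hs hz
    exact hM.apply_eq_of_invariant (hM.ae_exists_visit hπ hs hn) hA hinv
  have hfin : ∀ z, IsFiniteMeasure (M z) := fun z => by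
    have := hM.prob z; infer_instance
  have hmul : (mixedLaw M π).restrict A = M s A • mixedLaw M π := by
    have : IsFiniteMeasure (M s A • mixedLaw M π) :=
      Measure.smul_finite _ (measure_ne_top _ _)
    refine ext_of_pathCylinder fun n a => ?_
    have hcyl := measurableSet_pathCylinder n a
    rw [Measure.restrict_apply hcyl, Measure.smul_apply, smul_eq_mul]
    by_cases ha : π (a n) = 0
    · have h0 : mixedLaw M π (pathCylinder n a) = 0 := by
        have hm : MeasurableSet {y : ℕ → S | y 0 = a n} :=
          measurable_pi_apply (X := fun _ : ℕ => S) 0 (measurableSet_singleton (a n))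
        have h1 : mixedLaw M π {y | y 0 = a n} = 0 := by
          rw [mixedLaw_apply _ _ hm, ENNReal.tsum_eq_zero]
          intro z
          by_cases hz : z = a n
          · rw [hz, ha, zero_mul]
          · rw [hM.apply_of_start_ne, mul_zero]
            intro y hy h
            exact hz (h.symm.trans hy)
        rw [← (hM.measurePreserving_shiftPath hπ n).measure_preimage hm.nullMeasurableSet] at h1
        exact measure_mono_null (fun y hy => hy n le_rfl) h1
      rw [h0, mul_zero]
      exact measure_mono_null Set.inter_subset_left h0
    · rw [mixedLaw_apply _ _ (hcyl.inter hA), mixedLaw_apply _ _ hcyl, ← ENNReal.tsum_mul_left]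
      congr 1; funext z
      have h1 := hM.apply_pathCylinder_inter_shiftPath n z a hA
      rw [hinv, hconst _ ha] at h1
      rw [h1]
      ring
  have h1 : mixedLaw M π A = M s A := by
    have := congrArg (fun m => m Set.univ) hmul
    simpa [Measure.restrict_apply MeasurableSet.univ] using this
  have h2 : mixedLaw M π A = M s A * mixedLaw M π A := by
    have := congrArg (fun m => m A) hmul
    simpa [Measure.restrict_apply hA] using this
  rw [← h1] at h2
  rw [Filter.eventuallyConst_set']
  by_cases h0 : mixedLaw M π A = 0
  · left
    exact ae_eq_empty.2 h0
  · right
    have h3 : mixedLaw M π A = 1 := by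
      have h4 : mixedLaw M π A * 1 = mixedLaw M π A * mixedLaw M π A := by rw [mul_one]; exact h2
      exact ((ENNReal.mul_right_inj h0 (measure_ne_top _ _)).1 h4).symm
    exact eventuallyEq_univ.2 ((mem_ae_iff_prob_eq_one hA).2 h3)

/-- The ergodic theorem for chains with an invariant law: the time averages of an integrable
function converge to its mean under the invariant law. -/
theorem ae_tendsto_average (hM : IsPathFamily P M) {π : PMF S} (hπ : IsInvariantLaw P π)
    (hirr : ∀ x y, π x ≠ 0 → π y ≠ 0 → ∃ n, pathProb P ∅ n x y ≠ 0) {f : S → ℝ}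
    (hf : Integrable f π.toMeasure) {z : S} (hz : π z ≠ 0) :
    ∀ᵐ y ∂M z, Tendsto (fun n : ℕ => (∑ k ∈ Finset.range n, f (y k)) / n) atTop
      (𝓝 (∫ x, f x ∂π.toMeasure)) := by
  have hp := hM.isProbabilityMeasure_mixedLaw π
  have h0 : Measurable fun y : ℕ → S => y 0 := measurable_pi_apply 0
  have hmap : (mixedLaw M π).map (fun y => y 0) = π.toMeasure := by
    refine Measure.ext_of_singleton fun x => ?_
    rw [Measure.map_apply h0 (measurableSet_singleton x),
      PMF.toMeasure_apply_singleton _ _ (measurableSet_singleton x),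
      mixedLaw_apply _ _ (h0 (measurableSet_singleton x)), tsum_eq_single x]
    · have := hM.prob x
      have h1 : M x ((fun y => y 0) ⁻¹' {x}) = 1 :=
        (mem_ae_iff_prob_eq_one (h0 (measurableSet_singleton x))).1 (hM.ae_start x)
      rw [h1, mul_one]
    · intro w hw
      rw [hM.apply_of_start_ne, mul_zero]
      intro y hy h
      exact hw (h.symm.trans hy)
  have hfm : Measurable f := measurable_of_countable f
  have hf' : Integrable (fun y : ℕ → S => f (y 0)) (mixedLaw M π) := by
    rw [← hmap] at hf
    exact hf.comp_measurable h0
  have h1 := ae_tendsto_birkhoffSum_div (hM.ergodic_shiftPath hπ hirr) (hfm.comp h0) hf'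
  have h2 : ∫ y, f (y 0) ∂mixedLaw M π = ∫ x, f x ∂π.toMeasure := by
    rw [← hmap, integral_map h0.aemeasurable hfm.aestronglyMeasurable]
  filter_upwards [ae_mixedLaw_iff.1 h1 z hz] with y hy
  have h3 : ∀ n, birkhoffSum (shiftPath 1) (f ∘ fun y : ℕ → S => y 0) n y =
      ∑ k ∈ Finset.range n, f (y k) := by
    intro n
    have h4 : ∀ k, (shiftPath (S := S) 1)^[k] y = shiftPath k y := by
      intro k
      induction k with
      | zero => exact (shiftPath_zero y).symm
      | succ k ih => rw [Function.iterate_succ_apply', ih, shiftPath_shiftPath]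
    simp [birkhoffSum, h4]
  simp only [h3] at hy
  rw [← h2]
  exact hy

/-- The ergodic theorem for a nonnegative function of infinite mean. -/
theorem ae_tendsto_average_atTop (hM : IsPathFamily P M) {π : PMF S} (hπ : IsInvariantLaw P π)
    (hirr : ∀ x y, π x ≠ 0 → π y ≠ 0 → ∃ n, pathProb P ∅ n x y ≠ 0) {f : S → ℕ}
    (hf : ∑' x, π x * f x = ∞) {z : S} (hz : π z ≠ 0) :
    ∀ᵐ y ∂M z, Tendsto (fun n : ℕ => (∑ k ∈ Finset.range n, (f (y k) : ℝ)) / n) atTop atTop := by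
  -- the truncations of `f` are bounded and their means increase to infinity
  have hint : ∀ N : ℕ, Integrable (fun x => ((min (f x) N : ℕ) : ℝ)) π.toMeasure := fun N =>
    Integrable.of_bound (measurable_of_countable _).aestronglyMeasurable (N : ℝ)
      (Filter.Eventually.of_forall fun x => by
        rw [Real.norm_of_nonneg (Nat.cast_nonneg _)]
        exact_mod_cast min_le_right _ _)
  have hmean : Tendsto (fun N : ℕ => ∫ x, ((min (f x) N : ℕ) : ℝ) ∂π.toMeasure) atTop atTop := by
    have h1 : Tendsto (fun N : ℕ => ∫⁻ x, ((min (f x) N : ℕ) : ℝ≥0∞) ∂π.toMeasure) atTop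
        (𝓝 (∫⁻ x, (f x : ℝ≥0∞) ∂π.toMeasure)) := by
      refine lintegral_tendsto_of_tendsto_of_monotone
        (fun N => (measurable_of_countable _).aemeasurable) ?_ ?_
      · refine Filter.Eventually.of_forall fun x N N' h => ?_
        exact Nat.cast_le.2 (min_le_min le_rfl h)
      · refine Filter.Eventually.of_forall fun x => ?_
        refine tendsto_const_nhds.congr' ?_
        filter_upwards [eventually_ge_atTop (f x)] with N hN
        rw [min_eq_left hN]
    have h2 : ∫⁻ x, (f x : ℝ≥0∞) ∂π.toMeasure = ∞ := by
      rw [lintegral_countable', ← hf]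
      congr 1; funext x
      rw [PMF.toMeasure_apply_singleton _ _ (measurableSet_singleton x), mul_comm]
    rw [h2] at h1
    have h3 : ∀ N : ℕ, ∫⁻ x, ((min (f x) N : ℕ) : ℝ≥0∞) ∂π.toMeasure =
        ENNReal.ofReal (∫ x, ((min (f x) N : ℕ) : ℝ) ∂π.toMeasure) := by
      intro N
      rw [ofReal_integral_eq_lintegral_ofReal (hint N)
        (Filter.Eventually.of_forall fun x => Nat.cast_nonneg _)]
      simp only [ENNReal.ofReal_natCast]
    simp only [h3] at h1
    exact ENNReal.tendsto_ofReal_nhds_top.1 h1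
  have h1 : ∀ᵐ y ∂M z, ∀ N : ℕ, Tendsto
      (fun n : ℕ => (∑ k ∈ Finset.range n, ((min (f (y k)) N : ℕ) : ℝ)) / n) atTop
      (𝓝 (∫ x, ((min (f x) N : ℕ) : ℝ) ∂π.toMeasure)) :=
    ae_all_iff.2 fun N => hM.ae_tendsto_average hπ hirr (hint N) hz
  filter_upwards [h1] with y hy
  rw [tendsto_atTop]
  intro b
  obtain ⟨N, hN⟩ := (hmean.eventually_gt_atTop b).exists
  filter_upwards [(hy N).eventually (eventually_gt_nhds hN)] with n hn
  refine hn.le.trans ?_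
  gcongr
  exact min_le_left _ _

end IsPathFamily

end StationaryChain

/-! ### First visits, renewal equations and their moments -/

section Renewal

variable {S : Type*} {P : S → S → ℝ≥0∞}

theorem pathProb_zero_self (P : S → S → ℝ≥0∞) (A : Set S) (x : S) : pathProb P A 0 x x = 1 :=
  if_pos rfl

theorem pathProb_zero_of_ne (P : S → S → ℝ≥0∞) (A : Set S) {x y : S} (h : x ≠ y) :
    pathProb P A 0 x y = 0 :=
  if_neg h

theorem pathProb_succ_of_mem {A : Set S} {x : S} (hx : x ∈ A) (n : ℕ) (y : S) :
    pathProb P A (n + 1) x y = 0 :=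
  if_pos hx

theorem pathProb_succ_of_notMem {A : Set S} {x : S} (hx : x ∉ A) (n : ℕ) (y : S) :
    pathProb P A (n + 1) x y = ∑' z, P x z * pathProb P A n z y :=
  if_neg hx

theorem pathProb_eq_zero_of_mem {A : Set S} {x y : S} (hx : x ∈ A) (hxy : x ≠ y) (n : ℕ) :
    pathProb P A n x y = 0 := by
  cases n with
  | zero => exact pathProb_zero_of_ne P A hxy
  | succ n => exact pathProb_succ_of_mem hx n y

theorem pathProb_anti {A B : Set S} (hAB : A ⊆ B) (n : ℕ) (x y : S) :
    pathProb P B n x y ≤ pathProb P A n x y := by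
  induction n generalizing x with
  | zero => exact le_rfl
  | succ n ih =>
    by_cases hB : x ∈ B
    · rw [pathProb_succ_of_mem hB]
      exact zero_le
    · rw [pathProb_succ_of_notMem hB, pathProb_succ_of_notMem fun h => hB (hAB h)]
      exact ENNReal.tsum_le_tsum fun z => mul_le_mul_right (ih z) _

theorem pathProb_mul_le (m n : ℕ) (x y z : S) :
    pathProb P ∅ m x y * pathProb P ∅ n y z ≤ pathProb P ∅ (m + n) x z := by
  induction m generalizing x with
  | zero =>
    by_cases h : x = y
    · rw [h, pathProb_zero_self, one_mul, Nat.zero_add]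
    · rw [pathProb_zero_of_ne P ∅ h, zero_mul]
      exact zero_le
  | succ m ih =>
    rw [Nat.add_right_comm, pathProb_succ_of_notMem (Set.notMem_empty _),
      pathProb_succ_of_notMem (Set.notMem_empty _), ← ENNReal.tsum_mul_right]
    refine ENNReal.tsum_le_tsum fun w => ?_
    rw [mul_assoc]
    exact mul_le_mul_right (ih w) _

theorem pathProb_one (x y : S) : pathProb P ∅ 1 x y = P x y := by
  rw [pathProb_succ_of_notMem (Set.notMem_empty _), tsum_eq_single y, pathProb_zero_self, mul_one]
  intro z hz
  rw [pathProb_zero_of_ne P ∅ hz, mul_zero]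

/-- Decomposition of a passage to `s` according to the time of the first visit to `s`. -/
theorem pathProb_eq_sum_first_visit {A : Set S} {s : S} (hs : s ∉ A) (n : ℕ) (x : S) :
    pathProb P A n x s =
      ∑ k ∈ Finset.range (n + 1), pathProb P (insert s A) k x s * pathProb P A (n - k) s s := by
  have hsA : s ∈ insert s A := Set.mem_insert s A
  induction n generalizing x with
  | zero =>
    simp only [Nat.zero_add, Finset.sum_range_one, Nat.sub_self, pathProb_zero_self, mul_one]
    rfl
  | succ n ih =>
    rw [Finset.sum_range_succ']
    simp only [Nat.add_sub_add_right, Nat.sub_zero]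
    by_cases hxs : x = s
    · subst hxs
      simp only [pathProb_succ_of_mem hsA, zero_mul, Finset.sum_const_zero, zero_add,
        pathProb_zero_self, one_mul]
    · rw [pathProb_zero_of_ne _ _ hxs, zero_mul, add_zero]
      by_cases hxA : x ∈ A
      · simp only [pathProb_succ_of_mem hxA, pathProb_succ_of_mem (Set.mem_insert_of_mem s hxA),
          zero_mul, Finset.sum_const_zero]
      · have hx' : x ∉ insert s A := fun h => (Set.mem_insert_iff.1 h).elim hxs hxA
        simp only [pathProb_succ_of_notMem hxA, pathProb_succ_of_notMem hx', ih]
        simp only [← ENNReal.tsum_mul_right, Finset.mul_sum, ← mul_assoc]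
        exact Summable.tsum_finsetSum fun _ _ => ENNReal.summable

/-- The renewal equation for returns to `s`. -/
theorem pathProb_succ_eq_sum_return {A : Set S} {s : S} (hs : s ∉ A) (n : ℕ) :
    pathProb P A (n + 1) s s =
      ∑ k ∈ Finset.range (n + 1),
        (∑' z, P s z * pathProb P (insert s A) k z s) * pathProb P A (n - k) s s := by
  rw [pathProb_succ_of_notMem hs]
  simp only [pathProb_eq_sum_first_visit hs n, ← ENNReal.tsum_mul_right, Finset.mul_sum,
    ← mul_assoc]
  exact Summable.tsum_finsetSum fun _ _ => ENNReal.summable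

theorem ENNReal.tsum_sum_range_mul (a b : ℕ → ℝ≥0∞) :
    ∑' n, ∑ k ∈ Finset.range (n + 1), a k * b (n - k) = (∑' k, a k) * ∑' l, b l := by
  have h1 : ∀ n, ∑ k ∈ Finset.range (n + 1), a k * b (n - k) =
      ∑ p ∈ Finset.HasAntidiagonal.antidiagonal n, a p.1 * b p.2 := fun n =>
    (Finset.Nat.sum_antidiagonal_eq_sum_range_succ (fun k l => a k * b l) n).symm
  simp only [h1]
  rw [← ENNReal.tsum_mul_right]
  simp only [← ENNReal.tsum_mul_left]
  rw [← ENNReal.tsum_prod, ← Finset.HasAntidiagonal.sigmaAntidiagonalEquivProd.tsum_eq, ENNReal.tsum_sigma']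
  congr 1; funext n
  rw [tsum_fintype, ← Finset.sum_coe_sort]
  rfl

/-- `h` is the renewal sequence of `u`: the sequence of probabilities of a renewal at time `n`
if `u k` is the probability that the first renewal takes place at time `k + 1`. -/
structure IsRenewalSequence (u h : ℕ → ℝ≥0∞) : Prop where
  zero : h 0 = 1
  succ : ∀ n, h (n + 1) = ∑ k ∈ Finset.range (n + 1), u k * h (n - k)

namespace IsRenewalSequence

variable {u h : ℕ → ℝ≥0∞}

theorem tsum_mul_pow (H : IsRenewalSequence u h) (r : ℝ≥0∞) :
    ∑' n, h n * r ^ n = 1 + (∑' k, u k * r ^ (k + 1)) * ∑' n, h n * r ^ n := by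
  rw [← ENNReal.tsum_sum_range_mul, tsum_eq_zero_add' ENNReal.summable, H.zero, pow_zero, mul_one]
  congr 2; funext n
  rw [H.succ, Finset.sum_mul]
  refine Finset.sum_congr rfl fun k hk => ?_
  have hk' : k ≤ n := by simpa [Nat.lt_succ_iff] using hk
  have h1 : r ^ (n + 1) = r ^ (k + 1) * r ^ (n - k) := by
    rw [← pow_add]; congr 1; omega
  rw [h1]; ring

theorem tsum_eq (H : IsRenewalSequence u h) :
    ∑' n, h n = 1 + (∑' k, u k) * ∑' n, h n := by
  simpa using H.tsum_mul_pow 1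

theorem one_le_tsum (H : IsRenewalSequence u h) : 1 ≤ ∑' n, h n := by
  rw [H.tsum_eq]
  exact le_self_add

theorem tsum_nat_mul (H : IsRenewalSequence u h) :
    ∑' n : ℕ, n * h n =
      (∑' k : ℕ, ((k : ℝ≥0∞) + 1) * u k) * ∑' n, h n + (∑' k, u k) * ∑' n : ℕ, n * h n := by
  rw [← ENNReal.tsum_sum_range_mul, ← ENNReal.tsum_sum_range_mul, ← ENNReal.tsum_add,
    tsum_eq_zero_add' ENNReal.summable, Nat.cast_zero, zero_mul, zero_add]
  congr 1; funext n
  rw [H.succ, Finset.mul_sum, ← Finset.sum_add_distrib]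
  refine Finset.sum_congr rfl fun k hk => ?_
  have hk' : k ≤ n := by simpa [Nat.lt_succ_iff] using hk
  have h1 : ((n + 1 : ℕ) : ℝ≥0∞) = (k + 1) + ((n - k : ℕ) : ℝ≥0∞) := by
    exact_mod_cast (by omega : n + 1 = k + 1 + (n - k))
  rw [h1]; ring

theorem nat_mul_le_one_add_pow (d : ℝ≥0∞) (n : ℕ) : n * d ≤ (1 + d) ^ n := by
  have : 1 + n * d ≤ (1 + d) ^ n := by
    induction n with
    | zero => simp
    | succ n ih =>
      calc 1 + ((n + 1 : ℕ) : ℝ≥0∞) * d = (1 + n * d) + d * 1 := by push_cast; ring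
        _ ≤ (1 + d) ^ n + d * (1 + d) ^ n :=
          add_le_add ih (mul_le_mul_right (one_le_pow₀ le_self_add) _)
        _ = (1 + d) ^ (n + 1) := by ring
  exact le_add_self.trans this

/-- If the generating function of a renewal sequence converges at `1 + d`, then the first moment
of the sequence is bounded in terms of `d` and of its sum alone. Differentiating
`h = 1 / (1 - u)` gives `h' = u' h²`, and `u' (1) ≤ u (1 + d) / d ≤ 1 / d`. -/
theorem mul_tsum_nat_mul_le (H : IsRenewalSequence u h) {d : ℝ≥0∞} (hd : d ≠ 0)
    (hfin : ∑' n, h n * (1 + d) ^ n ≠ ∞) :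
    d * ∑' n : ℕ, n * h n ≤ (∑' n, h n) ^ 2 := by
  set a := ∑' n, h n with ha
  set U := ∑' k, u k with hU
  set E := ∑' n : ℕ, (n : ℝ≥0∞) * h n with hE
  set U' := ∑' k : ℕ, ((k : ℝ≥0∞) + 1) * u k with hU'
  have h1 : a = 1 + U * a := H.tsum_eq
  have h2 : E = U' * a + U * E := H.tsum_nat_mul
  have ha_fin : a ≠ ∞ := by
    refine ne_top_of_le_ne_top hfin (ENNReal.tsum_le_tsum fun n => ?_)
    calc h n = h n * 1 := (mul_one _).symm
      _ ≤ _ := mul_le_mul_right (one_le_pow₀ le_self_add) _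
  have hdE : d * E ≤ ∑' n, h n * (1 + d) ^ n := by
    rw [hE, ← ENNReal.tsum_mul_left]
    refine ENNReal.tsum_le_tsum fun n => ?_
    calc d * (n * h n) = h n * (n * d) := by ring
      _ ≤ _ := mul_le_mul_right (nat_mul_le_one_add_pow d n) _
  have hE_fin : E ≠ ∞ := by
    intro h
    rw [h, ENNReal.mul_top hd] at hdE
    exact hfin (top_le_iff.1 hdE)
  have hUr : ∑' k, u k * (1 + d) ^ (k + 1) ≤ 1 := by
    have h3 := H.tsum_mul_pow (1 + d)
    by_contra hlt
    rw [not_le] at hlt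
    set T := ∑' n, h n * (1 + d) ^ n with hT
    have h4 : T < T := by
      calc T < 1 + T := by
            rw [add_comm]; exact ENNReal.lt_add_right hfin one_ne_zero
        _ = 1 + 1 * T := by rw [one_mul]
        _ ≤ 1 + (∑' k, u k * (1 + d) ^ (k + 1)) * T :=
          add_le_add le_rfl (mul_le_mul_left hlt.le _)
        _ = T := h3.symm
    exact lt_irrefl _ h4
  have hdU' : d * U' ≤ 1 := by
    refine le_trans ?_ hUr
    rw [hU', ← ENNReal.tsum_mul_left]
    refine ENNReal.tsum_le_tsum fun k => ?_
    have h3 := nat_mul_le_one_add_pow d (k + 1)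
    push_cast at h3
    calc d * (((k : ℝ≥0∞) + 1) * u k) = u k * (((k : ℝ≥0∞) + 1) * d) := by ring
      _ ≤ _ := mul_le_mul_right h3 _
  have hU_fin : U ≠ ∞ := by
    intro h
    rw [h] at h1
    have : a = ∞ := by
      rw [h1, ENNReal.top_mul, add_top]
      have := H.one_le_tsum
      exact (lt_of_lt_of_le one_pos this).ne'
    exact ha_fin this
  have hEU : E = U' * a ^ 2 := by
    have h5 : U * a * E + E = U * a * E + U' * a ^ 2 := by
      calc U * a * E + E = (1 + U * a) * E := by ring
        _ = a * E := by rw [← h1]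
        _ = a * (U' * a + U * E) := by rw [← h2]
        _ = U * a * E + U' * a ^ 2 := by ring
    exact (ENNReal.add_right_inj
      (ENNReal.mul_ne_top (ENNReal.mul_ne_top hU_fin ha_fin) hE_fin)).1 h5
  calc d * E = (d * U') * a ^ 2 := by rw [hEU]; ring
    _ ≤ 1 * a ^ 2 := mul_le_mul_left hdU' _
    _ = a ^ 2 := one_mul _

end IsRenewalSequence

theorem isRenewalSequence_pathProb {A : Set S} {s : S} (hs : s ∉ A) :
    IsRenewalSequence (fun k => ∑' z, P s z * pathProb P (insert s A) k z s)
      (fun n => pathProb P A n s s) :=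
  ⟨pathProb_zero_self P A s, fun n => pathProb_succ_eq_sum_return hs n⟩

end Renewal

/-! ### The walk on all words -/

namespace Cover

variable {V : Type*} {G : Digraph V} {i₀ : V}

/-- The word that represents a vertex of the directed cover. -/
def word (x : Cover G i₀) : List V := x.1

theorem word_injective : Function.Injective (word : Cover G i₀ → List V) :=
  fun _ _ h => Subtype.ext h

theorem isCoverPath_word (x : Cover G i₀) : IsCoverPath G i₀ x.word := x.2

theorem word_parent (x : Cover G i₀) : x.parent.word = x.word.tail := by
  rcases x with ⟨_ | ⟨j, s⟩, h⟩ <;> rfl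

theorem eq_root_iff (x : Cover G i₀) : x = root ↔ x.word = [] :=
  ⟨fun h => by rw [h]; rfl, fun h => Subtype.ext h⟩

end Cover

namespace CoverWalk

variable {V : Type*} (W : CoverWalk V)

/-- The probability `p(-i)`. -/
noncomputable def bwd (i : V) : ℝ≥0∞ := ENNReal.ofReal (W.back i)

/-- The probability `p(i, j)`. -/
noncomputable def fwd (i j : V) : ℝ≥0∞ := ENNReal.ofReal (W.forward i j)

/-- The last label of a word, the empty word having the label of the root. -/
def lastLabel (u : List V) : V := u.headD W.base

@[simp] theorem lastLabel_cons (j : V) (u : List V) : W.lastLabel (j :: u) = j := rfl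

theorem lastLabel_append_cons (s : List V) (i : V) (r r' : List V) :
    W.lastLabel (s ++ i :: r) = W.lastLabel (s ++ i :: r') := by
  cases s <;> rfl

open Classical in
/-- The walk of `W.step`, extended to all words over `V`, whether or not they are paths of the
graph. This removes the dependence on the proof that a word is a path. -/
noncomputable def wordStep (u v : List V) : ℝ≥0∞ :=
  if v ≠ [] ∧ v.tail = u then W.fwd (W.lastLabel u) (W.lastLabel v)
  else if v = u.tail then W.bwd (W.lastLabel u)
  else 0

theorem one_sub_back_pos (i : V) : 0 < 1 - W.back i := by
  obtain ⟨ε, h0, -, h⟩ := W.back_bounds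
  have := h i
  linarith

theorem back_pos (i : V) : 0 < W.back i := by
  obtain ⟨ε, h0, -, h⟩ := W.back_bounds
  have := h i
  linarith

theorem bwd_ne_zero (i : V) : W.bwd i ≠ 0 := (ENNReal.ofReal_pos.2 (W.back_pos i)).ne'

theorem bwd_ne_top (i : V) : W.bwd i ≠ ∞ := ENNReal.ofReal_ne_top

theorem fwd_ne_top (i j : V) : W.fwd i j ≠ ∞ := ENNReal.ofReal_ne_top

theorem fwd_ne_zero_iff (i j : V) : W.fwd i j ≠ 0 ↔ W.graph.Adj i j := by
  rw [fwd, ← pos_iff_ne_zero, ENNReal.ofReal_pos, forward, mul_pos_iff_of_pos_left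
    (W.one_sub_back_pos i), W.pG_pos_iff]

theorem bwd_add_tsum_fwd (i : V) : W.bwd i + ∑' j, W.fwd i j = 1 := by
  have h1 : HasSum (W.forward i) (1 - W.back i) := by
    have h := (W.pG_sum i).mul_left (1 - W.back i)
    rwa [mul_one] at h
  have h0 : ∀ j, 0 ≤ W.forward i j := fun j =>
    mul_nonneg (W.one_sub_back_pos i).le (W.pG_nonneg i j)
  have h2 : ∑' j, W.fwd i j = ENNReal.ofReal (1 - W.back i) := by
    rw [← h1.tsum_eq, ENNReal.ofReal_tsum_of_nonneg h0 h1.summable]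
    rfl
  rw [h2, bwd, ← ENNReal.ofReal_add (W.back_pos i).le (W.one_sub_back_pos i).le]
  simp

/-- A step of the walk removes or adds a label. -/
theorem tsum_wordStep_mul (u : List V) (f : List V → ℝ≥0∞) :
    ∑' v, W.wordStep u v * f v =
      W.bwd (W.lastLabel u) * f u.tail + ∑' j, W.fwd (W.lastLabel u) j * f (j :: u) := by
  classical
  have hne : ∀ v : List V, v = u.tail → ¬ (v ≠ [] ∧ v.tail = u) := by
    rintro v rfl ⟨h1, h2⟩
    have h3 := congrArg List.length h2
    have h4 : u.tail.length ≠ 0 := fun h => h1 (List.length_eq_zero_iff.1 h)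
    simp only [List.length_tail] at h3 h4
    omega
  let g₁ : List V → ℝ≥0∞ := fun v => if v = u.tail then W.bwd (W.lastLabel u) * f v else 0
  let g₂ : List V → ℝ≥0∞ := fun v =>
    if v ≠ [] ∧ v.tail = u then W.fwd (W.lastLabel u) (W.lastLabel v) * f v else 0
  have hsplit : ∀ v, W.wordStep u v * f v = g₁ v + g₂ v := by
    intro v
    by_cases h1 : v = u.tail
    · simp only [wordStep, g₁, g₂, if_neg (hne v h1), if_pos h1, add_zero]
    · by_cases h2 : v ≠ [] ∧ v.tail = u
      · simp only [wordStep, g₁, g₂, if_pos h2, if_neg h1, zero_add]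
      · simp only [wordStep, g₁, g₂, if_neg h2, if_neg h1, zero_add, zero_mul]
  simp only [hsplit]
  rw [ENNReal.tsum_add, tsum_ite_eq]
  congr 1
  have hinj : Function.Injective fun j : V => j :: u := fun j j' h => (List.cons.inj h).1
  rw [← hinj.tsum_eq]
  · congr 1; funext j
    simp [g₂]
  · intro v hv
    have h2 : v ≠ [] ∧ v.tail = u := by
      by_contra h
      exact hv (if_neg h)
    cases v with
    | nil => exact absurd rfl h2.1
    | cons j v => exact ⟨j, by rw [← h2.2]; rfl⟩

theorem tsum_wordStep (u : List V) : ∑' v, W.wordStep u v = 1 := by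
  have h := W.tsum_wordStep_mul u fun _ => 1
  simp only [mul_one] at h
  rw [h, W.bwd_add_tsum_fwd]

theorem wordStep_cons (u : List V) (j : V) :
    W.wordStep u (j :: u) = W.fwd (W.lastLabel u) j := by
  simp [wordStep]

theorem eq_tail_or_cons_of_wordStep_ne_zero {u v : List V} (h : W.wordStep u v ≠ 0) :
    v = u.tail ∨ ∃ j, v = j :: u := by
  by_cases h2 : v ≠ [] ∧ v.tail = u
  · right
    cases v with
    | nil => exact absurd rfl h2.1
    | cons j v => exact ⟨j, by rw [← h2.2]; rfl⟩
  · left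
    by_contra h1
    exact h (by rw [wordStep, if_neg h2, if_neg h1])

theorem isCoverPath_of_wordStep_ne_zero {u v : List V} (hu : IsCoverPath W.graph W.base u)
    (h : W.wordStep u v ≠ 0) : IsCoverPath W.graph W.base v := by
  rcases W.eq_tail_or_cons_of_wordStep_ne_zero h with rfl | ⟨j, rfl⟩
  · cases u with
    | nil => exact hu
    | cons j u => exact hu.1
  · rw [wordStep_cons, fwd_ne_zero_iff] at h
    exact ⟨hu, h⟩

theorem step_eq_wordStep (x y : W.Tree) : W.step x y = W.wordStep x.word y.word := by
  have h1 : y = Cover.root ↔ y.word = [] := y.eq_root_iff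
  have h3 : y.parent = x ↔ y.word.tail = x.word := by
    rw [← Cover.word_parent, Cover.word_injective.eq_iff]
  have h4 : y = x.parent ↔ y.word = x.word.tail := by
    rw [← Cover.word_parent, Cover.word_injective.eq_iff]
  rw [step, wordStep]
  by_cases h5 : y ≠ Cover.root ∧ y.parent = x
  · have h5' : y.word ≠ [] ∧ y.word.tail = x.word := ⟨fun h => h5.1 (h1.2 h), h3.1 h5.2⟩
    rw [if_pos h5, if_pos h5']
    rfl
  · have h5' : ¬ (y.word ≠ [] ∧ y.word.tail = x.word) :=
      fun h => h5 ⟨fun h' => h.1 (h1.1 h'), h3.2 h.2⟩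
    rw [if_neg h5, if_neg h5']
    by_cases h6 : y = x.parent
    · rw [if_pos h6, if_pos (h4.1 h6)]
      rfl
    · rw [if_neg h6, if_neg (fun h => h6 (h4.2 h))]

theorem pathProb_step_eq (A : Set W.Tree) (n : ℕ) (x y : W.Tree) :
    pathProb W.step A n x y = pathProb W.wordStep (Cover.word '' A) n x.word y.word := by
  have hinj : Function.Injective (Cover.word : W.Tree → List V) := Cover.word_injective
  induction n generalizing x with
  | zero =>
    by_cases h : x = y
    · rw [h, pathProb_zero_self, pathProb_zero_self]
    · rw [pathProb_zero_of_ne _ _ h, pathProb_zero_of_ne _ _ fun h' => h (hinj h')]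
  | succ n ih =>
    by_cases hx : x ∈ A
    · rw [pathProb_succ_of_mem hx, pathProb_succ_of_mem (Set.mem_image_of_mem _ hx)]
    · have hx' : x.word ∉ Cover.word '' A := fun h => hx ((hinj.mem_set_image).1 h)
      rw [pathProb_succ_of_notMem hx, pathProb_succ_of_notMem hx', ← hinj.tsum_eq]
      · simp only [ih, step_eq_wordStep]
      · intro v hv
        have hv' : W.wordStep x.word v ≠ 0 := fun h => hv (by simp only [h, zero_mul])
        exact ⟨⟨v, W.isCoverPath_of_wordStep_ne_zero x.isCoverPath_word hv'⟩, rfl⟩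

/-! ### Passages through a cone -/

/-- The probability that the walk started at a vertex with label `i` is there at time `n` and has
not visited the ancestor of that vertex before. -/
noncomputable def stayProb (i : V) (n : ℕ) : ℝ≥0∞ := pathProb W.wordStep {[]} n [i] [i]

theorem pathProb_wordStep_cone (r : List V) (i : V) (n : ℕ) (s : List V) :
    pathProb W.wordStep {r} n (s ++ i :: r) (i :: r) =
      pathProb W.wordStep {[]} n (s ++ [i]) [i] := by
  induction n generalizing s with
  | zero =>
    by_cases h : s = []
    · subst h
      exact (pathProb_zero_self _ _ _).trans (pathProb_zero_self _ _ _).symm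
    · rw [pathProb_zero_of_ne, pathProb_zero_of_ne] <;> simpa using h
  | succ n ih =>
    have h1 : s ++ i :: r ∉ ({r} : Set (List V)) := by
      intro h
      have := congrArg List.length (Set.mem_singleton_iff.1 h)
      simp only [List.length_append, List.length_cons] at this
      omega
    have h2 : s ++ [i] ∉ ({[]} : Set (List V)) := by simp
    rw [pathProb_succ_of_notMem h1, pathProb_succ_of_notMem h2, tsum_wordStep_mul,
      tsum_wordStep_mul, W.lastLabel_append_cons s i r []]
    congr 1
    · congr 1
      cases s with
      | nil =>
        refine (pathProb_eq_zero_of_mem (Set.mem_singleton r) ?_ n).trans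
          (pathProb_eq_zero_of_mem (Set.mem_singleton []) ?_ n).symm
        · exact (List.cons_ne_self _ _).symm
        · simp
      | cons j s => exact ih s
    · congr 1; funext j
      congr 1
      exact ih (j :: s)

theorem pathProb_wordStep_self (i : V) (r : List V) (n : ℕ) :
    pathProb W.wordStep {r} n (i :: r) (i :: r) = W.stayProb i n :=
  W.pathProb_wordStep_cone r i n []

/-- The ancestor of a vertex is reached by a step backwards from that vertex. -/
theorem pathProb_wordStep_exit (r : List V) (i : V) (n : ℕ) (s : List V) :
    pathProb W.wordStep {r} (n + 1) (s ++ i :: r) r =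
      pathProb W.wordStep {r} n (s ++ i :: r) (i :: r) * W.bwd i := by
  have h1 : ∀ s, s ++ i :: r ∉ ({r} : Set (List V)) := by
    intro s h
    have := congrArg List.length (Set.mem_singleton_iff.1 h)
    simp only [List.length_append, List.length_cons] at this
    omega
  have h2 : ∀ s, s ++ i :: r ≠ r := fun s h => h1 s h
  induction n generalizing s with
  | zero =>
    rw [pathProb_succ_of_notMem (h1 s), tsum_wordStep_mul]
    have h3 : ∀ j, pathProb W.wordStep {r} 0 (j :: (s ++ i :: r)) r = 0 := fun j =>
      pathProb_zero_of_ne _ _ (h2 (j :: s))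
    simp only [h3, mul_zero, tsum_zero, add_zero]
    cases s with
    | nil =>
      simp only [List.nil_append, lastLabel_cons, List.tail_cons, pathProb_zero_self, mul_one,
        one_mul]
    | cons j s =>
      rw [List.cons_append, List.tail_cons, pathProb_zero_of_ne _ _ (h2 s),
        pathProb_zero_of_ne, zero_mul, mul_zero]
      intro h
      have := congrArg List.length h
      simp only [List.length_append, List.length_cons] at this
      omega
  | succ n ih =>
    rw [pathProb_succ_of_notMem (h1 s), pathProb_succ_of_notMem (h1 s), tsum_wordStep_mul,
      tsum_wordStep_mul, add_mul, ← ENNReal.tsum_mul_right]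
    congr 1
    · rw [mul_assoc]
      congr 1
      cases s with
      | nil =>
        rw [List.nil_append, List.tail_cons, pathProb_succ_of_mem (Set.mem_singleton r),
          pathProb_eq_zero_of_mem (Set.mem_singleton r) (List.cons_ne_self _ _).symm, zero_mul]
      | cons j s => exact ih s
    · congr 1; funext j
      rw [mul_assoc]
      congr 1
      exact ih (j :: s)

/-- The first passage probabilities from a vertex with label `i` to its ancestor. -/
noncomputable def exitProb (i : V) : ℕ → ℝ≥0∞
  | 0 => 0
  | n + 1 => W.stayProb i n * W.bwd i

theorem pathProb_wordStep_parent (i : V) (r : List V) (n : ℕ) :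
    pathProb W.wordStep {r} n (i :: r) r = W.exitProb i n := by
  cases n with
  | zero => exact pathProb_zero_of_ne _ _ (List.cons_ne_self _ _)
  | succ n =>
    have h := W.pathProb_wordStep_exit r i n []
    rw [List.nil_append, pathProb_wordStep_self] at h
    exact h

/-- A walk in the cone above a child of `r` has to visit `r` before it can visit a set that does
not meet the cone. -/
theorem pathProb_wordStep_insert {r : List V} {B : Set (List V)}
    (hB : ∀ s j, s ++ j :: r ∉ B) (n : ℕ) (s : List V) (j : V) :
    pathProb W.wordStep (insert r B) n (s ++ j :: r) r =
      pathProb W.wordStep {r} n (s ++ j :: r) r := by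
  induction n generalizing s j with
  | zero => rfl
  | succ n ih =>
    have h1 : s ++ j :: r ∉ ({r} : Set (List V)) := by
      intro h
      have := congrArg List.length (Set.mem_singleton_iff.1 h)
      simp only [List.length_append, List.length_cons] at this
      omega
    have h2 : s ++ j :: r ∉ insert r B := fun h =>
      (Set.mem_insert_iff.1 h).elim (fun h => h1 h) (hB s j)
    rw [pathProb_succ_of_notMem h1, pathProb_succ_of_notMem h2, tsum_wordStep_mul,
      tsum_wordStep_mul]
    congr 1
    · congr 1
      cases s with
      | nil =>
        rw [List.nil_append, List.tail_cons]
        cases n with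
        | zero => rfl
        | succ n =>
          rw [pathProb_succ_of_mem (Set.mem_insert r B), pathProb_succ_of_mem (Set.mem_singleton r)]
      | cons k s => exact ih s j
    · congr 1; funext k
      congr 1
      exact ih (k :: s) j

/-- The return probabilities to a vertex with label `i` by excursions into its cone. -/
noncomputable def excursionProb (i : V) (k : ℕ) : ℝ≥0∞ := ∑' j, W.fwd i j * W.exitProb j k

theorem isRenewalSequence_stayProb (i : V) :
    IsRenewalSequence (W.excursionProb i) (W.stayProb i) := by
  have h := isRenewalSequence_pathProb (P := W.wordStep) (A := {[]}) (s := [i]) (by simp)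
  change IsRenewalSequence _ (fun n => pathProb W.wordStep {[]} n [i] [i])
  convert h using 1
  funext k
  rw [tsum_wordStep_mul, List.tail_cons, pathProb_eq_zero_of_mem (by simp) (by simp), mul_zero,
    zero_add]
  simp only [excursionProb, lastLabel_cons]
  congr 1; funext j
  have h1 := W.pathProb_wordStep_insert (r := [i]) (B := {[]}) (by simp) k [] j
  rw [List.nil_append, pathProb_wordStep_parent] at h1
  rw [h1]

theorem isRenewalSequence_root :
    IsRenewalSequence
      (fun k => W.bwd W.base * pathProb W.wordStep {[]} k [] [] + W.excursionProb W.base k)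
      (fun n => pathProb W.wordStep ∅ n [] []) := by
  have h := isRenewalSequence_pathProb (P := W.wordStep) (A := ∅) (s := []) (by simp)
  convert h using 1
  funext k
  have h0 : (insert [] ∅ : Set (List V)) = {[]} := by simp
  rw [h0, tsum_wordStep_mul]
  congr 1
  simp only [excursionProb]
  congr 1; funext j
  have h1 := W.pathProb_wordStep_parent j [] k
  rw [h1]
  rfl

/-! ### The functions `F` and `Ḡ` -/

theorem vertexOf_eq (i : V) : ∃ r, (W.vertexOf i).word = i :: r ∧ (W.vertexOf i).parent.word = r := by
  obtain ⟨h1, h2⟩ : W.vertexOf i ≠ Cover.root ∧ (W.vertexOf i).label = i :=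
    (W.exists_label i).choose_spec
  revert h1 h2
  generalize W.vertexOf i = x
  rcases x with ⟨_ | ⟨j, s⟩, h⟩
  · intro h1 _
    exact absurd rfl h1
  · intro _ h2
    exact ⟨s, by rw [← h2]; rfl, rfl⟩

theorem passageProb_eq (i : V) (n : ℕ) : W.passageProb i n = W.exitProb i n := by
  obtain ⟨r, h1, h2⟩ := W.vertexOf_eq i
  rw [passageProb, pathProb_step_eq, Set.image_singleton, h1, h2, pathProb_wordStep_parent]

theorem GBar_eq (i : V) (z : ℝ≥0∞) : W.GBar i z = ∑' n, W.stayProb i n * z ^ n := by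
  obtain ⟨r, h1, h2⟩ := W.vertexOf_eq i
  simp only [GBar, pathProb_step_eq, Set.image_singleton, h1, h2, pathProb_wordStep_self]

/-- The value `Ḡ_i(1)`. -/
noncomputable def stayTotal (i : V) : ℝ≥0∞ := ∑' n, W.stayProb i n

theorem GBar_one (i : V) : W.GBar i 1 = W.stayTotal i := by
  simp [GBar_eq, stayTotal]

theorem F_one (i : V) : W.F i 1 = ∑' n, W.exitProb i n := by
  simp [F, passageProb_eq]

theorem F_one_eq_mul (i : V) : W.F i 1 = W.stayTotal i * W.bwd i := by
  rw [F_one, tsum_eq_zero_add' ENNReal.summable, stayTotal, ← ENNReal.tsum_mul_right]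
  exact zero_add _

theorem F'_one (i : V) :
    W.F' i 1 = (∑' n : ℕ, ((n : ℝ≥0∞) + 1) * W.stayProb i n) * W.bwd i := by
  simp only [F', passageProb_eq, one_pow, mul_one]
  rw [tsum_eq_zero_add' ENNReal.summable, ← ENNReal.tsum_mul_right, Nat.cast_zero, zero_mul,
    zero_add]
  congr 1; funext n
  rw [exitProb]
  push_cast
  ring

theorem one_le_stayTotal (i : V) : 1 ≤ W.stayTotal i :=
  (W.isRenewalSequence_stayProb i).one_le_tsum

theorem stayTotal_ne_zero (i : V) : W.stayTotal i ≠ 0 :=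
  (lt_of_lt_of_le one_pos (W.one_le_stayTotal i)).ne'

theorem tsum_excursionProb (i : V) : ∑' k, W.excursionProb i k = ∑' j, W.fwd i j * W.F j 1 := by
  simp only [excursionProb, F_one, ← ENNReal.tsum_mul_left]
  exact ENNReal.tsum_comm

theorem stayTotal_eq (i : V) :
    W.stayTotal i = 1 + (∑' j, W.fwd i j * W.F j 1) * W.stayTotal i := by
  have h := (W.isRenewalSequence_stayProb i).tsum_eq
  rwa [tsum_excursionProb] at h

end CoverWalk

/-! ### Survival probabilities and holding times -/

theorem tsum_pathProb_first_visit_le {S : Type*} {P : S → S → ℝ≥0∞}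
    (hP : ∀ x, ∑' y, P x y = 1) (s x : S) : ∑' n, pathProb P {s} n x s ≤ 1 := by
  refine ENNReal.tsum_le_of_sum_range_le fun N => ?_
  induction N generalizing x with
  | zero => simp
  | succ N ih =>
    rw [Finset.sum_range_succ']
    by_cases hx : x = s
    · subst hx
      simp only [pathProb_succ_of_mem (Set.mem_singleton x), Finset.sum_const_zero, zero_add,
        pathProb_zero_self, le_refl]
    · have hx' : x ∉ ({s} : Set S) := hx
      simp only [pathProb_succ_of_notMem hx', pathProb_zero_of_ne P {s} hx, add_zero]
      rw [← Summable.tsum_finsetSum fun _ _ => ENNReal.summable, ← hP x]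
      refine ENNReal.tsum_le_tsum fun z => ?_
      rw [← Finset.mul_sum]
      calc P x z * _ ≤ P x z * 1 := mul_le_mul_right (ih z) _
        _ = P x z := mul_one _

namespace CoverWalk

variable {V : Type*} (W : CoverWalk V)

theorem F_one_le (i : V) : W.F i 1 ≤ 1 := by
  have h := tsum_pathProb_first_visit_le W.tsum_wordStep [] [i]
  simp only [pathProb_wordStep_parent] at h
  rwa [F_one]

theorem stayTotal_ne_top (i : V) : W.stayTotal i ≠ ∞ := by
  intro h
  have h1 := W.F_one_le i
  rw [F_one_eq_mul, h, ENNReal.top_mul (W.bwd_ne_zero i)] at h1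
  exact absurd h1 (by simp)

/-- The probability of never leaving the cone of a vertex with label `i`. -/
noncomputable def surv (i : V) : ℝ≥0∞ := 1 - W.F i 1

theorem surv_add_F (i : V) : W.surv i + W.F i 1 = 1 := tsub_add_cancel_of_le (W.F_one_le i)

theorem surv_ne_top (i : V) : W.surv i ≠ ∞ := ne_top_of_le_ne_top ENNReal.one_ne_top tsub_le_self

theorem bwd_add_lt_one {i j : V} (hij : W.graph.Adj i j) (hj : W.F j 1 < 1) :
    W.bwd i + ∑' j, W.fwd i j * W.F j 1 < 1 := by
  have h1 := W.bwd_add_tsum_fwd i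
  have hne : ∑' j, W.fwd i j ≠ ∞ := fun h => by
    rw [h, add_top] at h1
    exact ENNReal.top_ne_one h1
  have hle : ∀ k, W.fwd i k * W.F k 1 ≤ W.fwd i k := fun k => by
    calc W.fwd i k * W.F k 1 ≤ W.fwd i k * 1 := mul_le_mul_right (W.F_one_le k) _
      _ = W.fwd i k := mul_one _
  have hne' : ∑' k, W.fwd i k * W.F k 1 ≠ ∞ :=
    ne_top_of_le_ne_top hne (ENNReal.tsum_le_tsum hle)
  have hlt : W.fwd i j * W.F j 1 < W.fwd i j := by
    calc W.fwd i j * W.F j 1 < W.fwd i j * 1 :=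
          ENNReal.mul_lt_mul_right ((W.fwd_ne_zero_iff i j).2 hij) (W.fwd_ne_top i j) hj
      _ = W.fwd i j := mul_one _
  exact lt_of_lt_of_eq
    (ENNReal.add_lt_add_left (W.bwd_ne_top i) (ENNReal.tsum_lt_tsum hne' hle hlt)) h1

theorem F_one_lt_of_adj {i j : V} (hij : W.graph.Adj i j) (hj : W.F j 1 < 1) : W.F i 1 < 1 := by
  set U := ∑' j, W.fwd i j * W.F j 1 with hU
  have h1 : W.stayTotal i = 1 + U * W.stayTotal i := W.stayTotal_eq i
  have h2 : W.bwd i + U < 1 := W.bwd_add_lt_one hij hj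
  have h3 : U * W.stayTotal i ≠ ∞ :=
    ne_top_of_le_ne_top (W.stayTotal_ne_top i) (le_of_le_of_eq le_add_self h1.symm)
  have h4 : W.F i 1 + U * W.stayTotal i < 1 + U * W.stayTotal i := by
    rw [← h1, F_one_eq_mul]
    calc W.stayTotal i * W.bwd i + U * W.stayTotal i = W.stayTotal i * (W.bwd i + U) := by ring
      _ < W.stayTotal i * 1 :=
        ENNReal.mul_lt_mul_right (W.stayTotal_ne_zero i) (W.stayTotal_ne_top i) h2
      _ = W.stayTotal i := mul_one _
  exact (ENNReal.add_lt_add_iff_right h3).1 h4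

/-- The total number of visits of the root. -/
noncomputable def rootTotal : ℝ≥0∞ := ∑' n, pathProb W.wordStep ∅ n [] []

theorem rootTotal_eq :
    W.rootTotal = 1 + (W.bwd W.base + ∑' j, W.fwd W.base j * W.F j 1) * W.rootTotal := by
  have h := W.isRenewalSequence_root.tsum_eq
  have h1 : ∑' k, pathProb W.wordStep {[]} k [] [] = 1 := by
    rw [tsum_eq_single 0, pathProb_zero_self]
    intro n hn
    obtain ⟨m, rfl⟩ := Nat.exists_eq_succ_of_ne_zero hn
    exact pathProb_succ_of_mem (Set.mem_singleton _) _ _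
  rw [ENNReal.tsum_add, ENNReal.tsum_mul_left, h1, mul_one, tsum_excursionProb] at h
  exact h

theorem rootTotal_ne_top (ht : W.IsTransient) : W.rootTotal ≠ ∞ := by
  have h : W.green Cover.root Cover.root 1 = W.rootTotal := by
    simp only [green, one_pow, mul_one, pathProb_step_eq, Set.image_empty]
    rfl
  rw [← h]
  exact ne_of_lt ht

/-- A transient walk stays in any given cone for ever with positive probability. -/
theorem F_one_lt (ht : W.IsTransient) (i : V) : W.F i 1 < 1 := by
  obtain ⟨j, hj⟩ : ∃ j, W.F j 1 < 1 := by
    by_contra hno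
    push Not at hno
    have h1 : ∀ j, W.F j 1 = 1 := fun j => le_antisymm (W.F_one_le j) (hno j)
    have h2 := W.rootTotal_eq
    simp only [h1, mul_one, bwd_add_tsum_fwd, one_mul] at h2
    have h3 : W.rootTotal < 1 + W.rootTotal := by
      rw [add_comm]
      exact ENNReal.lt_add_right (W.rootTotal_ne_top ht) one_ne_zero
    rw [← h2] at h3
    exact lt_irrefl _ h3
  have h := W.connected i j
  induction h using Relation.ReflTransGen.head_induction_on with
  | refl => exact hj
  | head hab _ ih => exact W.F_one_lt_of_adj hab ih

theorem surv_ne_zero (ht : W.IsTransient) (i : V) : W.surv i ≠ 0 :=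
  (tsub_pos_of_lt (W.F_one_lt ht i)).ne'

/-- The time that the walk spends at a vertex with label `i` before it leaves that vertex for
ever, given that it never leaves the cone, has this law. -/
noncomputable def holdLaw (i : V) : ℕ → ℝ≥0∞
  | 0 => 0
  | m + 1 => W.stayProb i m / W.stayTotal i

theorem tsum_holdLaw (i : V) : ∑' m, W.holdLaw i m = 1 := by
  rw [tsum_eq_zero_add' ENNReal.summable]
  simp only [holdLaw, zero_add, div_eq_mul_inv]
  rw [ENNReal.tsum_mul_right]
  exact ENNReal.mul_inv_cancel (W.stayTotal_ne_zero i) (W.stayTotal_ne_top i)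

theorem holdLaw_one_ne_zero (i : V) : W.holdLaw i 1 ≠ 0 := by
  rw [holdLaw, (W.isRenewalSequence_stayProb i).zero]
  exact ENNReal.div_ne_zero.2 ⟨one_ne_zero, W.stayTotal_ne_top i⟩

/-- The mean holding time is `F'(-i | 1) / F(-i)`, because `F(-i | z) = p(-i) z Ḡ_i(z)`. -/
theorem tsum_mul_holdLaw (i : V) : ∑' m : ℕ, m * W.holdLaw i m = W.F' i 1 / W.F i 1 := by
  rw [F'_one, F_one_eq_mul, ENNReal.mul_div_mul_right _ _ (W.bwd_ne_zero i) (W.bwd_ne_top i),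
    tsum_eq_zero_add' ENNReal.summable, Nat.cast_zero, zero_mul, zero_add, div_eq_mul_inv,
    ← ENNReal.tsum_mul_right]
  congr 1; funext m
  rw [holdLaw, div_eq_mul_inv, mul_assoc]
  push_cast
  rfl

theorem surv_mul_q (ht : W.IsTransient) (i j : V) :
    W.surv i * W.q i j = W.fwd i j * W.stayTotal i * W.surv j := by
  have h : W.q i j = W.surv j / W.surv i * W.fwd i j * W.stayTotal i := by
    rw [q, GBar_one]; rfl
  rw [h]
  calc W.surv i * (W.surv j / W.surv i * W.fwd i j * W.stayTotal i)
      = W.surv i * (W.surv j / W.surv i) * W.fwd i j * W.stayTotal i := by ring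
    _ = W.surv j * W.fwd i j * W.stayTotal i := by
        rw [ENNReal.mul_div_cancel (W.surv_ne_zero ht i) (W.surv_ne_top i)]
    _ = _ := by ring

theorem surv_mul_q_mul_holdLaw (ht : W.IsTransient) (i j : V) (m : ℕ) :
    W.surv i * (W.q i j * W.holdLaw i (m + 1)) = W.stayProb i m * W.fwd i j * W.surv j := by
  rw [← mul_assoc, W.surv_mul_q ht, holdLaw]
  calc W.fwd i j * W.stayTotal i * W.surv j * (W.stayProb i m / W.stayTotal i)
      = (W.stayTotal i * (W.stayProb i m / W.stayTotal i)) * W.fwd i j * W.surv j := by ring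
    _ = _ := by rw [ENNReal.mul_div_cancel (W.stayTotal_ne_zero i) (W.stayTotal_ne_top i)]

theorem surv_eq (i : V) :
    W.surv i = W.stayTotal i * ∑' j, W.fwd i j * W.surv j := by
  set U := ∑' j, W.fwd i j * W.F j 1 with hU
  set D := ∑' j, W.fwd i j * W.surv j with hD
  have h1 : W.stayTotal i = 1 + U * W.stayTotal i := W.stayTotal_eq i
  have h2 : W.bwd i + (D + U) = 1 := by
    rw [hD, hU, ← ENNReal.tsum_add]
    simp only [← mul_add, surv_add_F, mul_one, bwd_add_tsum_fwd]
  have h3 : U * W.stayTotal i ≠ ∞ :=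
    ne_top_of_le_ne_top (W.stayTotal_ne_top i) (le_of_le_of_eq le_add_self h1.symm)
  have h4 : W.stayTotal i * D + W.F i 1 = 1 := by
    have h5 : U * W.stayTotal i + (W.stayTotal i * D + W.F i 1) = U * W.stayTotal i + 1 := by
      calc U * W.stayTotal i + (W.stayTotal i * D + W.F i 1)
          = W.stayTotal i * (W.bwd i + (D + U)) := by rw [F_one_eq_mul]; ring
        _ = U * W.stayTotal i + 1 := by rw [h2, mul_one, add_comm]; exact h1
    exact (ENNReal.add_right_inj h3).1 h5
  exact ((ENNReal.add_left_inj (ne_top_of_le_ne_top ENNReal.one_ne_top (W.F_one_le i))).1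
    (h4.trans (W.surv_add_F i).symm)).symm

theorem tsum_q (ht : W.IsTransient) (i : V) : ∑' j, W.q i j = 1 := by
  have h1 : W.surv i * ∑' j, W.q i j = W.surv i * 1 := by
    rw [← ENNReal.tsum_mul_left, mul_one]
    simp only [W.surv_mul_q ht]
    conv_rhs => rw [W.surv_eq i, ← ENNReal.tsum_mul_left]
    congr 1; funext j; ring
  exact (ENNReal.mul_right_inj (W.surv_ne_zero ht i) (W.surv_ne_top i)).1 h1

theorem q_ne_zero_of_adj (ht : W.IsTransient) {i j : V} (h : W.graph.Adj i j) : W.q i j ≠ 0 := by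
  intro h0
  have h1 := W.surv_mul_q ht i j
  rw [h0, mul_zero] at h1
  exact mul_ne_zero (mul_ne_zero ((W.fwd_ne_zero_iff i j).2 h) (W.stayTotal_ne_zero i))
    (W.surv_ne_zero ht j) h1.symm

/-! ### Spectral radius smaller than one -/

theorem wordStep_cons_tail (j : V) (u : List V) : W.wordStep (j :: u) u = W.bwd j := by
  have h : ¬ (u ≠ [] ∧ u.tail = j :: u) := by
    rintro ⟨-, h⟩
    have := congrArg List.length h
    simp only [List.length_tail, List.length_cons] at this
    omega
  rw [wordStep, if_neg h, if_pos List.tail_cons.symm, lastLabel_cons]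

theorem exists_pathProb_root_ne_zero (u : List V) (hu : IsCoverPath W.graph W.base u) :
    (∃ a, pathProb W.wordStep ∅ a [] u ≠ 0) ∧ ∃ b, pathProb W.wordStep ∅ b u [] ≠ 0 := by
  induction u with
  | nil =>
    have h : pathProb W.wordStep ∅ 0 [] [] ≠ 0 := by
      rw [pathProb_zero_self]; exact one_ne_zero
    exact ⟨⟨0, h⟩, ⟨0, h⟩⟩
  | cons j u ih =>
    obtain ⟨⟨a, ha⟩, ⟨b, hb⟩⟩ := ih hu.1
    constructor
    · refine ⟨a + 1, fun h => ?_⟩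
      have h1 := pathProb_mul_le (P := W.wordStep) a 1 [] u (j :: u)
      rw [h, nonpos_iff_eq_zero, pathProb_one, wordStep_cons] at h1
      exact mul_ne_zero ha ((W.fwd_ne_zero_iff _ _).2 hu.2) h1
    · refine ⟨1 + b, fun h => ?_⟩
      have h1 := pathProb_mul_le (P := W.wordStep) 1 b (j :: u) u []
      rw [h, nonpos_iff_eq_zero, pathProb_one, wordStep_cons_tail] at h1
      exact mul_ne_zero (W.bwd_ne_zero j) hb h1

theorem tsum_stayProb_mul_pow_ne_top {r : ℝ≥0∞} (hr : 1 ≤ r)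
    (hfin : ∑' n, pathProb W.wordStep ∅ n [] [] * r ^ n ≠ ∞) (i : V) :
    ∑' n, W.stayProb i n * r ^ n ≠ ∞ := by
  obtain ⟨s, hs, -⟩ := W.vertexOf_eq i
  have hx := (W.vertexOf i).isCoverPath_word
  rw [hs] at hx
  obtain ⟨⟨a, ha⟩, ⟨b, hb⟩⟩ := W.exists_pathProb_root_ne_zero _ hx
  set α := pathProb W.wordStep ∅ a [] (i :: s)
  set β := pathProb W.wordStep ∅ b (i :: s) []
  have h1 : ∀ n, α * W.stayProb i n * β ≤ pathProb W.wordStep ∅ (a + n + b) [] [] := by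
    intro n
    refine le_trans (mul_le_mul_left ?_ _) (pathProb_mul_le (a + n) b [] (i :: s) [])
    refine le_trans (mul_le_mul_right ?_ _) (pathProb_mul_le a n [] (i :: s) (i :: s))
    rw [← W.pathProb_wordStep_self i s n]
    exact pathProb_anti (Set.empty_subset _) n _ _
  have h2 : α * β * ∑' n, W.stayProb i n * r ^ n ≤
      ∑' n, pathProb W.wordStep ∅ n [] [] * r ^ n := by
    calc α * β * ∑' n, W.stayProb i n * r ^ n
        = ∑' n, α * W.stayProb i n * β * r ^ n := by
          rw [← ENNReal.tsum_mul_left]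
          congr 1; funext n; ring
      _ ≤ ∑' n, pathProb W.wordStep ∅ (a + n + b) [] [] * r ^ (a + n + b) := by
          refine ENNReal.tsum_le_tsum fun n => mul_le_mul' (h1 n) ?_
          exact pow_le_pow_right₀ hr (by omega)
      _ ≤ _ := by
          have hinj : Function.Injective fun n : ℕ => a + n + b := fun n m h => by
            simp only at h; omega
          exact ENNReal.tsum_comp_le_tsum_of_injective hinj
            fun n => pathProb W.wordStep ∅ n [] [] * r ^ n
  intro h3
  rw [h3, ENNReal.mul_top (mul_ne_zero ha hb)] at h2
  exact hfin (top_le_iff.1 h2)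

theorem exists_tsum_root_ne_top (h : W.spectralRadius < 1) :
    ∃ d : ℝ≥0∞, d ≠ 0 ∧ d ≠ ∞ ∧ ∑' n, pathProb W.wordStep ∅ n [] [] * (1 + d) ^ n ≠ ∞ := by
  rw [spectralRadius, ENNReal.inv_lt_one] at h
  obtain ⟨r, hr1, hr⟩ := ENNReal.lt_iff_exists_nnreal_btwn.1 h
  have hr1' : 1 < r := by exact_mod_cast hr1
  have hs := FormalMultilinearSeries.summable_norm_mul_pow _ hr
  have hp : ∀ n, pathProb W.step ∅ n Cover.root Cover.root =
      pathProb W.wordStep ∅ n [] [] := fun n => by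
    rw [pathProb_step_eq, Set.image_empty]; rfl
  simp only [FormalMultilinearSeries.ofScalars_norm, hp, Complex.norm_real, Real.norm_eq_abs,
    ENNReal.abs_toReal] at hs
  have hle : ∀ n u v, pathProb W.wordStep ∅ n u v ≤ 1 := by
    intro n
    induction n with
    | zero =>
      intro u v
      by_cases h : u = v
      · rw [h, pathProb_zero_self]
      · rw [pathProb_zero_of_ne _ _ h]; exact zero_le
    | succ n ih =>
      intro u v
      rw [pathProb_succ_of_notMem (Set.notMem_empty _), ← W.tsum_wordStep u]
      refine ENNReal.tsum_le_tsum fun w => ?_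
      calc W.wordStep u w * _ ≤ W.wordStep u w * 1 := mul_le_mul_right (ih w v) _
        _ = _ := mul_one _
  refine ⟨((r - 1 : NNReal) : ℝ≥0∞), ?_, ENNReal.coe_ne_top, ?_⟩
  · exact ENNReal.coe_ne_zero.2 (tsub_pos_of_lt hr1').ne'
  · have h1 : (1 : ℝ≥0∞) + ((r - 1 : NNReal) : ℝ≥0∞) = r := by
      have : 1 + (r - 1) = r := add_tsub_cancel_of_le hr1'.le
      exact_mod_cast congrArg (fun x : NNReal => (x : ℝ≥0∞)) this
    rw [h1]
    have h2 : ∀ n, pathProb W.wordStep ∅ n [] [] * (r : ℝ≥0∞) ^ n =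
        ENNReal.ofReal ((pathProb W.wordStep ∅ n [] []).toReal * (r : ℝ) ^ n) := by
      intro n
      rw [ENNReal.ofReal_mul ENNReal.toReal_nonneg, ENNReal.ofReal_toReal
        (ne_top_of_le_ne_top ENNReal.one_ne_top (hle n _ _)), ENNReal.ofReal_pow r.coe_nonneg,
        ENNReal.ofReal_coe_nnreal]
    simp only [h2]
    rw [← ENNReal.ofReal_tsum_of_nonneg (fun n => by positivity) hs]
    exact ENNReal.ofReal_ne_top

/-- If the spectral radius is smaller than one, then the mean holding times are bounded uniformly
in the label. -/
theorem Lam_lt_top_of_spectralRadius_lt_one (h : W.spectralRadius < 1) (ν : PMF V) :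
    W.Lam ν < ∞ := by
  obtain ⟨d, hd0, hd, hfin⟩ := W.exists_tsum_root_ne_top h
  obtain ⟨ε, hε, -, hb⟩ := W.back_bounds
  have hT : ∀ i, W.stayTotal i ≤ (ENNReal.ofReal ε)⁻¹ := by
    intro i
    rw [← one_div, ENNReal.le_div_iff_mul_le (Or.inl (ENNReal.ofReal_pos.2 hε).ne')
      (Or.inl ENNReal.ofReal_ne_top)]
    refine le_trans (mul_le_mul_right (ENNReal.ofReal_le_ofReal (hb i).1.le) _) ?_
    have := W.F_one_le i
    rwa [F_one_eq_mul] at this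
  have hbound : ∀ i, W.F' i 1 / W.F i 1 ≤ (ENNReal.ofReal ε)⁻¹ / d + 1 := by
    intro i
    have h1 := (W.isRenewalSequence_stayProb i).mul_tsum_nat_mul_le hd0
      (W.tsum_stayProb_mul_pow_ne_top le_self_add hfin i)
    rw [F'_one, F_one_eq_mul, ENNReal.mul_div_mul_right _ _ (W.bwd_ne_zero i) (W.bwd_ne_top i)]
    simp only [add_mul, one_mul]
    rw [ENNReal.tsum_add, ENNReal.add_div]
    refine add_le_add ?_ (le_of_eq (ENNReal.div_self (W.stayTotal_ne_zero i)
      (W.stayTotal_ne_top i)))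
    refine le_trans ?_ (ENNReal.div_le_div_right (hT i) d)
    rw [ENNReal.div_le_iff (W.stayTotal_ne_zero i) (W.stayTotal_ne_top i),
      ENNReal.div_eq_inv_mul, mul_assoc, ← ENNReal.div_eq_inv_mul,
      ENNReal.le_div_iff_mul_le (Or.inl hd0) (Or.inl hd), mul_comm _ d, ← sq]
    exact h1
  have hC : (ENNReal.ofReal ε)⁻¹ / d + 1 < ∞ := by
    refine ENNReal.add_lt_top.2 ⟨ENNReal.div_lt_top ?_ hd0, ENNReal.one_lt_top⟩
    exact ENNReal.inv_ne_top.2 (ENNReal.ofReal_pos.2 hε).ne'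
  refine lt_of_le_of_lt ?_ hC
  calc W.Lam ν ≤ ∑' i, ν i * ((ENNReal.ofReal ε)⁻¹ / d + 1) :=
        ENNReal.tsum_le_tsum fun i => mul_le_mul_right (hbound i) _
    _ = (ENNReal.ofReal ε)⁻¹ / d + 1 := by
        rw [ENNReal.tsum_mul_right, ν.tsum_coe, one_mul]

end CoverWalk

/-! ### Exit times -/

/-- Words carry the discrete σ-algebra. -/
instance List.instMeasurableSpaceTop {V : Type*} : MeasurableSpace (List V) := ⊤

instance List.instDiscreteMeasurableSpaceTop {V : Type*} : DiscreteMeasurableSpace (List V) :=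
  ⟨fun _ => trivial⟩

section ExitTime

variable {S : Type*}

/-- The first time after the last visit of the path `y` to its initial point. The value is `0` if
there are infinitely many such visits. -/
noncomputable def exitTime (y : ℕ → S) : ℕ := sInf {m | ∀ n ≥ m, y n ≠ y 0}

/-- The part of the path `y` after its exit time. -/
noncomputable def exitShift (y : ℕ → S) : ℕ → S := shiftPath (exitTime y) y

theorem exitTime_eq_succ_iff (y : ℕ → S) (m : ℕ) :
    exitTime y = m + 1 ↔ y m = y 0 ∧ ∀ n ≥ m + 1, y n ≠ y 0 := by
  constructor
  · intro h
    have hne : {m | ∀ n ≥ m, y n ≠ y 0}.Nonempty := by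
      by_contra h0
      rw [Set.not_nonempty_iff_eq_empty] at h0
      rw [exitTime, h0, Nat.sInf_empty] at h
      omega
    have h1 : exitTime y ∈ {m | ∀ n ≥ m, y n ≠ y 0} := Nat.sInf_mem hne
    rw [h] at h1
    refine ⟨?_, h1⟩
    have h2 : m ∉ {m | ∀ n ≥ m, y n ≠ y 0} :=
      Nat.notMem_of_lt_sInf (show m < exitTime y by omega)
    simp only [Set.mem_ofPred_eq, not_forall, not_not] at h2
    obtain ⟨n, hn, h3⟩ := h2
    rcases Nat.eq_or_lt_of_le hn with h4 | h4
    · rw [h4]; exact h3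
    · exact absurd h3 (h1 n h4)
  · rintro ⟨h1, h2⟩
    refine le_antisymm (Nat.sInf_le h2) (le_csInf ⟨m + 1, h2⟩ fun k hk => ?_)
    by_contra hlt
    exact hk m (by omega) h1

theorem exitShift_ne (y : ℕ → S) (h : exitTime y ≠ 0) (n : ℕ) : exitShift y n ≠ y 0 := by
  obtain ⟨m, hm⟩ := Nat.exists_eq_succ_of_ne_zero h
  have h1 := ((exitTime_eq_succ_iff y m).1 hm).2
  exact h1 _ (by rw [hm]; exact Nat.le_add_right _ _)

theorem exitTime_ne_zero_iff (y : ℕ → S) : exitTime y ≠ 0 ↔ ∃ m, exitTime y = m + 1 :=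
  ⟨fun h => Nat.exists_eq_succ_of_ne_zero h, fun ⟨m, h⟩ => by omega⟩

variable [MeasurableSpace S] [DiscreteMeasurableSpace S] [Countable S]

@[fun_prop]
theorem measurable_exitTime : Measurable (exitTime (S := S)) := by
  have hpair : ∀ m n : ℕ, MeasurableSet {y : ℕ → S | y m = y n} := by
    intro m n
    have h : Measurable fun y : ℕ → S => (y m, y n) :=
      (measurable_pi_apply m).prodMk (measurable_pi_apply n)
    exact h (MeasurableSet.of_discrete (s := {p : S × S | p.1 = p.2}))
  have hsucc : ∀ m, MeasurableSet {y : ℕ → S | exitTime y = m + 1} := by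
    intro m
    have : {y : ℕ → S | exitTime y = m + 1} =
        {y | y m = y 0} ∩ ⋂ n, ⋂ (_ : n ≥ m + 1), {y | y n = y 0}ᶜ := by
      ext y
      simp [exitTime_eq_succ_iff]
    rw [this]
    exact (hpair m 0).inter (MeasurableSet.iInter fun n => MeasurableSet.iInter fun _ =>
      (hpair n 0).compl)
  refine measurable_to_countable' fun m => ?_
  cases m with
  | succ m => exact hsucc m
  | zero =>
    have : exitTime (S := S) ⁻¹' {0} = (⋃ m, {y | exitTime y = m + 1})ᶜ := by
      ext y
      have := exitTime_ne_zero_iff y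
      simp only [Set.mem_preimage, Set.mem_singleton_iff, Set.mem_compl_iff, Set.mem_iUnion,
        Set.mem_ofPred_eq]
      tauto
    rw [this]
    exact (MeasurableSet.iUnion hsucc).compl

theorem measurable_apply_exitTime (k : ℕ) : Measurable fun y : ℕ → S => y (exitTime y + k) := by
  have h : Measurable fun p : (ℕ → S) × ℕ => p.1 (p.2 + k) :=
    measurable_from_prod_countable_left fun n => measurable_pi_apply (n + k)
  exact h.comp (measurable_id.prodMk measurable_exitTime)

@[fun_prop]
theorem measurable_exitShift : Measurable (exitShift (S := S)) :=
  measurable_pi_lambda _ fun k => measurable_apply_exitTime k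

end ExitTime

namespace CoverWalk

variable {V : Type*} (W : CoverWalk V)

/-- The ancestor of `x`, as a set which is empty if `x` is the root. -/
def ancestorSet (x : List V) : Set (List V) := {v | v = x.tail ∧ v ≠ x}

theorem ancestorSet_nil : ancestorSet ([] : List V) = ∅ := by
  ext v; simp [ancestorSet]

theorem ancestorSet_cons (i : V) (r : List V) : ancestorSet (i :: r) = {r} := by
  ext v
  simp only [ancestorSet, List.tail_cons, Set.mem_ofPred_eq, Set.mem_singleton_iff,
    and_iff_left_iff_imp]
  rintro rfl
  exact (List.cons_ne_self _ _).symm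

/-- Paths in which every step removes or adds one label. -/
def IsNearestNeighbour (y : ℕ → List V) : Prop :=
  ∀ n, y (n + 1) = (y n).tail ∨ ∃ j, y (n + 1) = j :: y n

theorem IsNearestNeighbour.shiftPath {y : ℕ → List V} (h : IsNearestNeighbour y) (m : ℕ) :
    IsNearestNeighbour (shiftPath m y) := fun n => h (m + n)

/-- A nearest neighbour path that starts at a child of `x` and avoids `x` stays in the cone of
that child. -/
theorem IsNearestNeighbour.exists_eq_append {y : ℕ → List V} (h : IsNearestNeighbour y) {j : V}
    {x : List V} (h0 : y 0 = j :: x) (hx : ∀ n, y n ≠ x) (n : ℕ) : ∃ s, y n = s ++ j :: x := by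
  induction n with
  | zero => exact ⟨[], h0⟩
  | succ n ih =>
    obtain ⟨s, hs⟩ := ih
    rcases h n with h1 | ⟨k, h1⟩
    · cases s with
      | nil => exact absurd (by rw [h1, hs]; rfl) (hx (n + 1))
      | cons k s => exact ⟨s, by rw [h1, hs]; rfl⟩
    · exact ⟨k :: s, by rw [h1, hs]; rfl⟩

theorem append_cons_notMem_ancestorSet (s : List V) (j : V) (x : List V) :
    s ++ j :: x ∉ ancestorSet x := by
  rintro ⟨h, -⟩
  have := congrArg List.length h
  simp only [List.length_append, List.length_cons, List.length_tail] at this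
  omega

/-- A nearest neighbour path that never visits the ancestor of its initial point `x` enters a
child of `x` at its exit time. -/
theorem IsNearestNeighbour.apply_exitTime {y : ℕ → List V} (h : IsNearestNeighbour y)
    (ha : ∀ n, y n ∉ ancestorSet (y 0)) (hT : exitTime y ≠ 0) :
    ∃ j, y (exitTime y) = j :: y 0 := by
  obtain ⟨m, hm⟩ := (exitTime_ne_zero_iff y).1 hT
  obtain ⟨h1, h2⟩ := (exitTime_eq_succ_iff y m).1 hm
  rw [hm]
  rcases h m with h3 | ⟨j, h3⟩
  · exact absurd ⟨by rw [h3, h1], h2 (m + 1) le_rfl⟩ (ha (m + 1))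
  · exact ⟨j, by rw [h3, h1]⟩

/-- The label of the initial point of `y`, the label of the point at which `y` is at its exit
time, and the exit time. -/
noncomputable def exitMark (y : ℕ → List V) : V × V × ℕ :=
  (W.lastLabel (y 0), W.lastLabel (y (exitTime y)), exitTime y)

/-- The marks of the successive exits of `y`. -/
noncomputable def exitMarks (y : ℕ → List V) : ℕ → V × V × ℕ :=
  fun k => W.exitMark (exitShift^[k] y)

theorem exitMarks_eq_consPath (y : ℕ → List V) :
    W.exitMarks y = consPath (W.exitMark y) (W.exitMarks (exitShift y)) := by
  funext k
  cases k with
  | zero => rfl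
  | succ k => simp [exitMarks, Function.iterate_succ_apply]

theorem rootTotal_mul_eq_one (ht : W.IsTransient) :
    W.rootTotal * ∑' j, W.fwd W.base j * W.surv j = 1 := by
  set U := W.bwd W.base + ∑' j, W.fwd W.base j * W.F j 1 with hU
  set D := ∑' j, W.fwd W.base j * W.surv j with hD
  have h1 : W.rootTotal = 1 + U * W.rootTotal := W.rootTotal_eq
  have h2 : D + U = 1 := by
    rw [hD, hU, add_left_comm, ← ENNReal.tsum_add]
    simp only [← mul_add, surv_add_F, mul_one, bwd_add_tsum_fwd]
  have h3 : U * W.rootTotal ≠ ∞ :=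
    ne_top_of_le_ne_top (W.rootTotal_ne_top ht) (le_of_le_of_eq le_add_self h1.symm)
  have h4 : U * W.rootTotal + W.rootTotal * D = U * W.rootTotal + 1 := by
    calc U * W.rootTotal + W.rootTotal * D = W.rootTotal * (D + U) := by ring
      _ = U * W.rootTotal + 1 := by rw [h2, mul_one, add_comm]; exact h1
  exact (ENNReal.add_right_inj h3).1 h4

section Measure

variable [Countable V]

@[fun_prop]
theorem measurable_exitMark [MeasurableSpace V] [DiscreteMeasurableSpace V] :
    Measurable W.exitMark := by
  have h : Measurable W.lastLabel := measurable_of_countable _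
  exact (h.comp (measurable_pi_apply 0)).prodMk
    ((h.comp (measurable_apply_exitTime 0)).prodMk measurable_exitTime)

theorem measurable_exitMarks [MeasurableSpace V] [DiscreteMeasurableSpace V] :
    Measurable W.exitMarks :=
  measurable_pi_lambda _ fun k =>
    W.measurable_exitMark.comp (measurable_exitShift.iterate k)

variable {M : List V → Measure (ℕ → List V)}

theorem ae_isNearestNeighbour (hM : IsPathFamily W.wordStep M) (x : List V) :
    ∀ᵐ y ∂M x, IsNearestNeighbour y := by
  filter_upwards [hM.ae_step_ne_zero x] with y hy n
  exact W.eq_tail_or_cons_of_wordStep_ne_zero (hy n)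

theorem measurableSet_forall_notMem {S : Type*} [MeasurableSpace S] [DiscreteMeasurableSpace S]
    (A : Set S) : MeasurableSet {y : ℕ → S | ∀ n, y n ∉ A} := by
  have : {y : ℕ → S | ∀ n, y n ∉ A} = ⋂ n, (fun y : ℕ → S => y n) ⁻¹' Aᶜ := by ext y; simp
  rw [this]
  exact MeasurableSet.iInter fun n => measurable_pi_apply n MeasurableSet.of_discrete

/-- Decomposition of the walk at its exit time from `x`. On the event that the ancestor of `x` is
never visited, the exit at time `m + 1` to the child with label `j` means that the walk is at `x`
at time `m` without having visited the ancestor, steps to the child, and never returns to `x`. -/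
theorem apply_exit (hM : IsPathFamily W.wordStep M) (x : List V) (j : V) (m : ℕ)
    {C : Set (ℕ → List V)} (hC : MeasurableSet C) :
    M x {y | (∀ n, y n ∉ ancestorSet x) ∧ exitTime y = m + 1 ∧ W.lastLabel (y (m + 1)) = j ∧
        exitShift y ∈ C} =
      pathProb W.wordStep (ancestorSet x) m x x * W.fwd (W.lastLabel x) j *
        M (j :: x) ({y | ∀ n, y n ∉ ({x} : Set (List V))} ∩ C) := by
  set D : Set (ℕ → List V) := {y | ∀ n, y n ∉ ({x} : Set (List V))} ∩ C with hD
  have hDm : MeasurableSet D := (measurableSet_forall_notMem _).inter hC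
  set E : Set (ℕ → List V) := {y | y 0 = j :: x} ∩ D with hE
  have hEm : MeasurableSet E :=
    (measurable_pi_apply (X := fun _ : ℕ => List V) 0
      (MeasurableSet.of_discrete (s := {j :: x}))).inter hDm
  have h1 : M x (shiftPath 1 ⁻¹' E) = W.fwd (W.lastLabel x) j * M (j :: x) D := by
    rw [hM.apply_shiftPath_one x hEm, tsum_eq_single (j :: x), wordStep_cons]
    · congr 1
      refine measure_congr ?_
      filter_upwards [hM.ae_start (j :: x)] with y hy
      exact propext ⟨fun h => h.2, fun h => ⟨hy, h⟩⟩
    · intro z hz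
      rw [hM.apply_of_start_ne, mul_zero]
      intro y hy h
      exact hz (h.symm.trans hy.1)
  rw [mul_assoc, ← h1, ← hM.apply_inter_shiftPath _ _ _ _ (measurable_shiftPath 1 hEm)]
  refine measure_congr ?_
  filter_upwards [hM.ae_start x, W.ae_isNearestNeighbour hM x] with y h0 hnn
  refine propext ⟨?_, ?_⟩
  · rintro ⟨ha, hT, hj, hCy⟩
    obtain ⟨hm, hn⟩ := (exitTime_eq_succ_iff y m).1 hT
    obtain ⟨k, hk⟩ := hnn.apply_exitTime (by rw [h0]; exact ha) (by omega)
    rw [hT, h0] at hk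
    rw [hk, lastLabel_cons] at hj
    subst hj
    refine ⟨⟨fun k _ => ha k, hm.trans h0⟩, ?_⟩
    have h2 : exitShift y = shiftPath 1 (shiftPath m y) := by
      rw [exitShift, hT, shiftPath_shiftPath]
    refine ⟨by simpa using hk, fun n => ?_, ?_⟩
    · rw [← h2, Set.mem_singleton_iff, ← h0]
      exact exitShift_ne y (by omega) n
    · rw [← h2]; exact hCy
  · rintro ⟨⟨ha, hm⟩, hEy⟩
    have h2 : shiftPath 1 (shiftPath m y) = shiftPath (m + 1) y := shiftPath_shiftPath _ _ _
    have hEy' : shiftPath (m + 1) y ∈ E := by rw [← h2]; exact hEy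
    obtain ⟨hy0, hav, hCy⟩ := hEy'
    have hT : exitTime y = m + 1 := by
      refine (exitTime_eq_succ_iff y m).2 ⟨hm.trans h0.symm, fun n hn => ?_⟩
      have h3 := hav (n - (m + 1))
      rw [shiftPath_apply, Nat.add_sub_cancel' hn, Set.mem_singleton_iff, ← h0] at h3
      exact h3
    refine ⟨fun n => ?_, hT, ?_, ?_⟩
    · rcases Nat.lt_trichotomy n m with h3 | h3 | h3
      · exact ha n h3
      · rw [h3, hm]
        exact fun h => h.2 rfl
      · obtain ⟨s, hs⟩ := (hnn.shiftPath (m + 1)).exists_eq_append hy0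
          (fun n h => hav n h) (n - (m + 1))
        rw [shiftPath_apply, Nat.add_sub_cancel' h3] at hs
        rw [hs]
        exact append_cons_notMem_ancestorSet s j x
    · have h3 : y (m + 1) = j :: x := by simpa using hy0
      rw [h3, lastLabel_cons]
    · rw [exitShift, hT]
      exact hCy

theorem apply_forall_ne_parent (hM : IsPathFamily W.wordStep M) (i : V) (r : List V) :
    M (i :: r) {y | ∀ n, y n ∉ ({r} : Set (List V))} = W.surv i := by
  have := hM.prob (i :: r)
  have h1 : {y : ℕ → List V | ∀ n, y n ∉ ({r} : Set (List V))}ᶜ =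
      ⋃ n, {y | (∀ k < n, y k ∉ ({r} : Set (List V))) ∧ y n = r} := by
    classical
    ext y
    simp only [Set.mem_compl_iff, Set.mem_ofPred_eq, not_forall, not_not, Set.mem_iUnion,
      Set.mem_singleton_iff]
    constructor
    · intro h
      exact ⟨Nat.find h, fun k hk => Nat.find_min h hk, Nat.find_spec h⟩
    · rintro ⟨n, -, h⟩
      exact ⟨n, h⟩
  have h2 : M (i :: r) {y : ℕ → List V | ∀ n, y n ∉ ({r} : Set (List V))}ᶜ = W.F i 1 := by
    rw [h1, measure_iUnion, F_one]
    · congr 1; funext n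
      rw [hM.apply_visit, pathProb_wordStep_parent]
    · intro n n' hn
      rw [Function.onFun, Set.disjoint_left]
      rintro y hy hy'
      rcases lt_or_gt_of_ne hn with h | h
      · exact hy'.1 n h hy.2
      · exact hy.1 n' h hy'.2
    · exact fun n => measurableSet_visit _ _ _
  have h3 := prob_compl_eq_one_sub (μ := M (i :: r)) (measurableSet_forall_notMem {r}).compl
  rw [compl_compl, h2] at h3
  exact h3

theorem apply_exit_univ (hM : IsPathFamily W.wordStep M) (x : List V) :
    M x {y | (∀ n, y n ∉ ancestorSet x) ∧ exitTime y ≠ 0} =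
      (∑' m, pathProb W.wordStep (ancestorSet x) m x x) *
        ∑' j, W.fwd (W.lastLabel x) j * W.surv j := by
  have h1 : {y : ℕ → List V | (∀ n, y n ∉ ancestorSet x) ∧ exitTime y ≠ 0} =
      ⋃ p : ℕ × V, {y | (∀ n, y n ∉ ancestorSet x) ∧ exitTime y = p.1 + 1 ∧
        W.lastLabel (y (p.1 + 1)) = p.2 ∧ exitShift y ∈ Set.univ} := by
    ext y
    simp only [Set.mem_ofPred_eq, Set.mem_iUnion, exitTime_ne_zero_iff]
    constructor
    · rintro ⟨h, m, hm⟩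
      exact ⟨(m, W.lastLabel (y (m + 1))), h, hm, rfl, trivial⟩
    · rintro ⟨p, h, hm, -⟩
      exact ⟨h, p.1, hm⟩
  rw [h1, measure_iUnion]
  · simp only [W.apply_exit hM x _ _ MeasurableSet.univ, Set.inter_univ,
      W.apply_forall_ne_parent hM]
    rw [ENNReal.tsum_prod (f := fun m j => pathProb W.wordStep (ancestorSet x) m x x *
      W.fwd (W.lastLabel x) j * W.surv j), ← ENNReal.tsum_mul_right]
    congr 1; funext m
    rw [← ENNReal.tsum_mul_left]
    congr 1; funext j
    ring
  · intro p p' hp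
    rw [Function.onFun, Set.disjoint_left]
    rintro y ⟨-, h2, h3, -⟩ ⟨-, h2', h3', -⟩
    apply hp
    have h4 : p.1 = p'.1 := by omega
    exact Prod.ext h4 (by rw [← h3, ← h3', h4])
  · intro p
    have h2 : MeasurableSet {y : ℕ → List V | exitTime y = p.1 + 1} :=
      measurable_exitTime (measurableSet_singleton (p.1 + 1))
    have h3 : MeasurableSet {y : ℕ → List V | W.lastLabel (y (p.1 + 1)) = p.2} :=
      measurable_pi_apply (X := fun _ : ℕ => List V) (p.1 + 1)
        (MeasurableSet.of_discrete (s := {v | W.lastLabel v = p.2}))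
    have h4 : {y : ℕ → List V | (∀ n, y n ∉ ancestorSet x) ∧ exitTime y = p.1 + 1 ∧
        W.lastLabel (y (p.1 + 1)) = p.2 ∧ exitShift y ∈ Set.univ} =
        {y | ∀ n, y n ∉ ancestorSet x} ∩ ({y | exitTime y = p.1 + 1} ∩
          {y | W.lastLabel (y (p.1 + 1)) = p.2}) := by
      ext y; simp
    rw [h4]
    exact (measurableSet_forall_notMem _).inter (h2.inter h3)

/-- In a cone that the walk never leaves, the exit times are finite. -/
theorem ae_exitTime_ne_zero (hM : IsPathFamily W.wordStep M) (i : V) (r : List V) :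
    ∀ᵐ y ∂M (i :: r), (∀ n, y n ∉ ({r} : Set (List V))) → exitTime y ≠ 0 := by
  have := hM.prob (i :: r)
  have h1 := W.apply_exit_univ hM (i :: r)
  simp only [ancestorSet_cons, pathProb_wordStep_self, lastLabel_cons] at h1
  have h2 : M (i :: r) {y | (∀ n, y n ∉ ({r} : Set (List V))) ∧ exitTime y ≠ 0} =
      M (i :: r) {y | ∀ n, y n ∉ ({r} : Set (List V))} := by
    rw [h1, W.apply_forall_ne_parent hM, W.surv_eq i]
    rfl
  have hm : MeasurableSet {y : ℕ → List V |
      (∀ n, y n ∉ ({r} : Set (List V))) ∧ exitTime y ≠ 0} :=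
    (measurableSet_forall_notMem _).inter
      (measurable_exitTime (MeasurableSet.of_discrete (s := {0}ᶜ)))
  have h3 := ae_eq_of_subset_of_measure_ge (fun y hy => hy.1) h2.ge hm.nullMeasurableSet
    (measure_ne_top (M (i :: r)) {y | ∀ n, y n ∉ ({r} : Set (List V))})
  filter_upwards [h3] with y hy hn
  exact (hy.mpr hn).2

/-- A transient walk leaves the root for ever. -/
theorem ae_exitTime_root_ne_zero (hM : IsPathFamily W.wordStep M) (ht : W.IsTransient) :
    ∀ᵐ y ∂M [], exitTime y ≠ 0 := by
  have := hM.prob []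
  have h1 := W.apply_exit_univ hM []
  simp only [ancestorSet_nil, Set.mem_empty_iff_false, not_false_eq_true, implies_true,
    true_and] at h1
  have h2 : M [] {y | exitTime y ≠ 0} = 1 := by
    rw [h1, ← W.rootTotal_mul_eq_one ht]
    rfl
  exact (mem_ae_iff_prob_eq_one
    (measurable_exitTime (MeasurableSet.of_discrete (s := {0}ᶜ)))).2 h2

/-- What holds almost surely for walks that stay in a cone holds almost surely after the exit from
the root. -/
theorem ae_exitShift_root (hM : IsPathFamily W.wordStep M) (ht : W.IsTransient)
    {p : (ℕ → List V) → Prop}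
    (hp : ∀ j, ∀ᵐ y ∂M [j], (∀ n, y n ∉ ({[]} : Set (List V))) → p y) :
    ∀ᵐ y ∂M [], p (exitShift y) := by
  let B : V → Set (ℕ → List V) := fun j =>
    toMeasurable (M [j]) {y | ¬ ((∀ n, y n ∉ ({[]} : Set (List V))) → p y)}
  have hB : ∀ m j, M [] {y | (∀ n, y n ∉ ancestorSet []) ∧ exitTime y = m + 1 ∧
      W.lastLabel (y (m + 1)) = j ∧ exitShift y ∈ B j} = 0 := by
    intro m j
    rw [W.apply_exit hM [] j m (measurableSet_toMeasurable _ _)]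
    have h1 : M [j] (B j) = 0 := by
      rw [measure_toMeasurable]
      exact hp j
    rw [measure_mono_null Set.inter_subset_right h1, mul_zero]
  have hB' : ∀ᵐ y ∂M [], ∀ m j, ¬ ((∀ n, y n ∉ ancestorSet []) ∧ exitTime y = m + 1 ∧
      W.lastLabel (y (m + 1)) = j ∧ exitShift y ∈ B j) :=
    ae_all_iff.2 fun m => ae_all_iff.2 fun j => measure_eq_zero_iff_ae_notMem.1 (hB m j)
  filter_upwards [hB', W.ae_exitTime_root_ne_zero hM ht, hM.ae_start []] with y hy hT h0
  by_contra hpy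
  obtain ⟨m, hm⟩ := (exitTime_ne_zero_iff y).1 hT
  refine hy m _ ⟨?_, hm, rfl, subset_toMeasurable _ _ ?_⟩
  · simp [ancestorSet_nil]
  · intro h
    refine hpy (h fun n => ?_)
    rw [Set.mem_singleton_iff, ← h0]
    exact exitShift_ne y hT n

end Measure

end CoverWalk

/-! ### The chain of exit marks -/

namespace CoverWalk

variable {V : Type*} (W : CoverWalk V)

/-- The law of the mark of an exit from a vertex with label `i`, given that the walk never leaves
the cone of that vertex: the next label and the holding time are independent. -/
noncomputable def markLaw (i : V) (c : V × V × ℕ) : ℝ≥0∞ :=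
  open Classical in if i = c.1 then W.q i c.2.1 * W.holdLaw i c.2.2 else 0

/-- The transition matrix of the chain of marks. -/
noncomputable def markStep (c c' : V × V × ℕ) : ℝ≥0∞ := W.markLaw c.2.1 c'

theorem markLaw_of_eq (i j : V) (m : ℕ) :
    W.markLaw i (i, j, m) = W.q i j * W.holdLaw i m := if_pos rfl

theorem markLaw_of_ne {i i' : V} (h : i ≠ i') (d : V × ℕ) : W.markLaw i (i', d) = 0 := if_neg h

theorem tsum_markLaw_mul (i : V) (f : V × V × ℕ → ℝ≥0∞) :
    ∑' c, W.markLaw i c * f c = ∑' j, ∑' m, W.q i j * W.holdLaw i m * f (i, j, m) := by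
  rw [ENNReal.tsum_prod (f := fun a d => W.markLaw i (a, d) * f (a, d)), tsum_eq_single i]
  · rw [ENNReal.tsum_prod (f := fun j m => W.markLaw i (i, j, m) * f (i, j, m))]
    simp only [markLaw_of_eq]
  · intro i' hi'
    simp only [W.markLaw_of_ne hi'.symm, zero_mul, tsum_zero]

theorem tsum_markLaw (ht : W.IsTransient) (i : V) : ∑' c, W.markLaw i c = 1 := by
  have h := W.tsum_markLaw_mul i fun _ => 1
  simp only [mul_one, ENNReal.tsum_mul_left, tsum_holdLaw, W.tsum_q ht] at h
  exact h

theorem tsum_markStep (ht : W.IsTransient) (c : V × V × ℕ) : ∑' c', W.markStep c c' = 1 :=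
  W.tsum_markLaw ht c.2.1

/-- The joint law of the label, the next label and the holding time in the stationary regime. -/
noncomputable def stationaryMark (ht : W.IsTransient) (ν : PMF V) : PMF (V × V × ℕ) :=
  ⟨fun c => ν c.1 * W.markLaw c.1 c, by
    have h : ∑' c : V × V × ℕ, ν c.1 * W.markLaw c.1 c = 1 := by
      rw [ENNReal.tsum_prod (f := fun i d => ν i * W.markLaw i (i, d)), ← ν.tsum_coe]
      congr 1; funext i
      rw [ENNReal.tsum_mul_left, ENNReal.tsum_prod (f := fun j m => W.markLaw i (i, j, m))]
      simp only [markLaw_of_eq, ENNReal.tsum_mul_left, tsum_holdLaw, mul_one, W.tsum_q ht]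
    rw [← h]
    exact ENNReal.summable.hasSum⟩

theorem stationaryMark_apply (ht : W.IsTransient) (ν : PMF V) (i j : V) (m : ℕ) :
    W.stationaryMark ht ν (i, j, m) = ν i * (W.q i j * W.holdLaw i m) := by
  change ν i * W.markLaw i (i, j, m) = _
  rw [markLaw_of_eq]

theorem tsum_stationaryMark_mul (ht : W.IsTransient) (ν : PMF V) (f : V × V × ℕ → ℝ≥0∞) :
    ∑' c, W.stationaryMark ht ν c * f c =
      ∑' i, ν i * ∑' j, W.q i j * ∑' m, W.holdLaw i m * f (i, j, m) := by
  rw [ENNReal.tsum_prod (f := fun i d => W.stationaryMark ht ν (i, d) * f (i, d))]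
  congr 1; funext i
  rw [ENNReal.tsum_prod (f := fun j m => W.stationaryMark ht ν (i, j, m) * f (i, j, m)),
    ← ENNReal.tsum_mul_left]
  congr 1; funext j
  rw [← ENNReal.tsum_mul_left, ← ENNReal.tsum_mul_left]
  congr 1; funext m
  rw [stationaryMark_apply]
  ring

theorem isInvariantLaw_stationaryMark (ht : W.IsTransient) {ν : PMF V}
    (hν : IsInvariantLaw W.q ν) : IsInvariantLaw W.markStep (W.stationaryMark ht ν) := by
  rintro ⟨i', d⟩
  rw [W.tsum_stationaryMark_mul ht ν]
  change ∑' i, ν i * ∑' j, W.q i j * ∑' m, W.holdLaw i m * W.markLaw j (i', d) =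
    ν i' * W.markLaw i' (i', d)
  rw [← hν i', ← ENNReal.tsum_mul_right]
  congr 1; funext i
  rw [mul_assoc]
  congr 1
  rw [tsum_eq_single i']
  · rw [ENNReal.tsum_mul_right, tsum_holdLaw, one_mul]
  · intro j hj
    simp only [W.markLaw_of_ne hj, mul_zero, tsum_zero]

/-- The mean holding time in the stationary regime is `Λ`. -/
theorem tsum_stationaryMark_mul_hold (ht : W.IsTransient) (ν : PMF V) :
    ∑' c, W.stationaryMark ht ν c * (c.2.2 : ℝ≥0∞) = W.Lam ν := by
  rw [W.tsum_stationaryMark_mul ht ν, Lam]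
  congr 1; funext i
  have h : ∑' m : ℕ, W.holdLaw i m * (m : ℝ≥0∞) = W.F' i 1 / W.F i 1 := by
    rw [← tsum_mul_holdLaw]
    congr 1; funext m
    rw [mul_comm]
  simp only [h, ENNReal.tsum_mul_right, W.tsum_q ht, one_mul]

/-- An invariant law of `Q` charges every label, since `Q` is irreducible. -/
theorem invariant_ne_zero (ht : W.IsTransient) {ν : PMF V} (hν : IsInvariantLaw W.q ν) (i : V) :
    ν i ≠ 0 := by
  obtain ⟨k, hk⟩ := ν.support_nonempty
  have hk : ν k ≠ 0 := (PMF.mem_support_iff _ _).1 hk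
  induction W.connected k i with
  | refl => exact hk
  | @tail b c _ hbc ih =>
    intro h
    have h1 := hν c
    rw [h, ENNReal.tsum_eq_zero] at h1
    exact mul_ne_zero ih (W.q_ne_zero_of_adj ht hbc) (h1 b)

theorem stationaryMark_ne_zero_of_markLaw (ht : W.IsTransient) {ν : PMF V}
    (hν : IsInvariantLaw W.q ν) {i : V} {c : V × V × ℕ} (h : W.markLaw i c ≠ 0) :
    W.stationaryMark ht ν c ≠ 0 := by
  have h1 : i = c.1 := by
    by_contra h1
    exact h (if_neg h1)
  subst h1
  exact mul_ne_zero (W.invariant_ne_zero ht hν _) h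

/-- The chain of marks is irreducible on its relevant states: along any path of the graph, it can
move with all holding times equal to one. -/
theorem exists_pathProb_markStep_ne_zero (ht : W.IsTransient) {ν : PMF V}
    (c c' : V × V × ℕ) (hc' : W.stationaryMark ht ν c' ≠ 0) :
    ∃ n, pathProb W.markStep ∅ n c c' ≠ 0 := by
  have key : ∀ k, Relation.ReflTransGen W.graph.Adj c.2.1 k →
      ∃ n d, d.2.1 = k ∧ pathProb W.markStep ∅ n c d ≠ 0 := by
    intro k hk
    induction hk with
    | refl => exact ⟨0, c, rfl, by rw [pathProb_zero_self]; exact one_ne_zero⟩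
    | @tail k l _ hkl ih =>
      obtain ⟨n, d, hd, hn⟩ := ih
      refine ⟨n + 1, (k, l, 1), rfl, fun h => ?_⟩
      have h1 := pathProb_mul_le (P := W.markStep) n 1 c d (k, l, 1)
      rw [h, nonpos_iff_eq_zero, pathProb_one, markStep, hd, markLaw_of_eq] at h1
      exact mul_ne_zero hn (mul_ne_zero (W.q_ne_zero_of_adj ht hkl) (W.holdLaw_one_ne_zero k)) h1
  obtain ⟨n, d, hd, hn⟩ := key c'.1 (W.connected _ _)
  refine ⟨n + 1, fun h => ?_⟩
  have h1 := pathProb_mul_le (P := W.markStep) n 1 c d c'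
  rw [h, nonpos_iff_eq_zero, pathProb_one, markStep, hd] at h1
  have h2 : ν c'.1 * W.markLaw c'.1 c' ≠ 0 := hc'
  exact mul_ne_zero hn (right_ne_zero_of_mul h2) h1

variable [Countable V] [MeasurableSpace V] [DiscreteMeasurableSpace V]
  {M : List V → Measure (ℕ → List V)}

/-- The exit marks of a walk that stays in the cone of a vertex with label `i` form a Markov chain
with transition matrix `markStep`. -/
theorem apply_exitMarks_pathCylinder (hM : IsPathFamily W.wordStep M) (ht : W.IsTransient)
    (n : ℕ) (i : V) (r : List V) (a : ℕ → V × V × ℕ) :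
    M (i :: r) ({y | ∀ n, y n ∉ ({r} : Set (List V))} ∩ W.exitMarks ⁻¹' pathCylinder n a) =
      W.surv i * (W.markLaw i (a 0) * ∏ k ∈ Finset.range n, W.markStep (a k) (a (k + 1))) := by
  -- the contribution of the first mark, `C` being the condition on the later ones
  have hfirst : ∀ (C : Set (ℕ → List V)) (w : ℝ≥0∞) (i : V) (r : List V) (c : V × V × ℕ),
      MeasurableSet C →
      M (c.2.1 :: i :: r) ({y | ∀ n, y n ∉ ({i :: r} : Set (List V))} ∩ C) = W.surv c.2.1 * w →
      M (i :: r) {y | (∀ n, y n ∉ ({r} : Set (List V))) ∧ W.exitMark y = c ∧ exitShift y ∈ C} =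
        W.surv i * (W.markLaw i c * w) := by
    rintro C w i r ⟨i', j, m⟩ hC hCw
    by_cases hi : i = i'
    · subst hi
      cases m with
      | zero =>
        rw [markLaw_of_eq, holdLaw, mul_zero, zero_mul, mul_zero]
        refine measure_eq_zero_iff_ae_notMem.2 ?_
        filter_upwards [W.ae_exitTime_ne_zero hM i r] with y hy ⟨h1, h2, _⟩
        exact hy h1 (congrArg (fun c => c.2.2) h2)
      | succ m =>
        have h1 := W.apply_exit hM (i :: r) j m hC
        rw [ancestorSet_cons, pathProb_wordStep_self, hCw, lastLabel_cons] at h1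
        rw [markLaw_of_eq]
        calc M (i :: r) {y | (∀ n, y n ∉ ({r} : Set (List V))) ∧
              W.exitMark y = (i, j, m + 1) ∧ exitShift y ∈ C}
            = W.stayProb i m * W.fwd i j * (W.surv j * w) := by
              rw [← h1]
              refine measure_congr ?_
              filter_upwards [hM.ae_start (i :: r)] with y h0
              refine propext ⟨?_, ?_⟩
              · rintro ⟨h2, h3, h4⟩
                have h5 : exitTime y = m + 1 := congrArg (fun c => c.2.2) h3
                have h6 : W.lastLabel (y (exitTime y)) = j := congrArg (fun c => c.2.1) h3
                exact ⟨h2, h5, by rw [← h5]; exact h6, h4⟩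
              · rintro ⟨h2, h3, h4, h5⟩
                refine ⟨h2, ?_, h5⟩
                rw [exitMark, h0, h3, h4, lastLabel_cons]
          _ = (W.stayProb i m * W.fwd i j * W.surv j) * w := by ring
          _ = _ := by rw [← W.surv_mul_q_mul_holdLaw ht]; ring
    · rw [W.markLaw_of_ne hi, zero_mul, mul_zero]
      refine measure_eq_zero_iff_ae_notMem.2 ?_
      filter_upwards [hM.ae_start (i :: r)] with y h0 ⟨_, h2, _⟩
      have h3 : W.lastLabel (y 0) = i' := congrArg (fun c => c.1) h2
      rw [h0, lastLabel_cons] at h3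
      exact hi h3
  induction n generalizing i r a with
  | zero =>
    rw [Finset.range_zero, Finset.prod_empty]
    rw [← hfirst Set.univ 1 i r (a 0) MeasurableSet.univ]
    · congr 1
      ext y
      simp only [Set.mem_inter_iff, Set.mem_ofPred_eq, Set.mem_preimage, pathCylinder,
        Set.mem_univ, and_true]
      refine and_congr_right fun _ => ⟨fun h => h 0 le_rfl, fun h k hk => ?_⟩
      rw [Nat.le_zero.1 hk]
      exact h
    · rw [Set.inter_univ, W.apply_forall_ne_parent hM, mul_one]
  | succ n ih =>
    have h1 := ih (a 0).2.1 (i :: r) fun k => a (k + 1)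
    have h2 := hfirst _ _ i r (a 0) (W.measurable_exitMarks (measurableSet_pathCylinder n _)) h1
    rw [Finset.prod_range_succ', mul_comm (∏ k ∈ Finset.range n, _)]
    refine Eq.trans ?_ h2
    congr 1
    ext y
    simp only [Set.mem_inter_iff, Set.mem_ofPred_eq, Set.mem_preimage, pathCylinder]
    refine and_congr_right fun _ => ?_
    rw [W.exitMarks_eq_consPath y]
    constructor
    · intro h
      exact ⟨h 0 (by omega), fun k hk => h (k + 1) (by omega)⟩
    · rintro ⟨h3, h4⟩ k hk
      cases k with
      | zero => exact h3
      | succ k => exact h4 k (by omega)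

theorem map_exitMarks (hM : IsPathFamily W.wordStep M) (ht : W.IsTransient)
    {N : V × V × ℕ → Measure (ℕ → V × V × ℕ)} (hN : IsPathFamily W.markStep N)
    (i : V) (r : List V) :
    ((M (i :: r)).restrict {y | ∀ n, y n ∉ ({r} : Set (List V))}).map W.exitMarks =
      W.surv i • mixedLaw N (W.markLaw i) := by
  have hp := hM.prob (i :: r)
  have hp' : IsProbabilityMeasure (mixedLaw N (W.markLaw i)) := by
    constructor
    rw [mixedLaw_apply _ _ MeasurableSet.univ, ← W.tsum_markLaw ht i]
    congr 1; funext z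
    have := hN.prob z
    simp
  have hfin : IsFiniteMeasure (W.surv i • mixedLaw N (W.markLaw i)) :=
    Measure.smul_finite _ (W.surv_ne_top i)
  refine ext_of_pathCylinder fun n a => ?_
  have hcyl := measurableSet_pathCylinder n a
  rw [Measure.map_apply W.measurable_exitMarks hcyl,
    Measure.restrict_apply (W.measurable_exitMarks hcyl), Set.inter_comm,
    W.apply_exitMarks_pathCylinder hM ht, Measure.smul_apply, smul_eq_mul,
    mixedLaw_apply _ _ hcyl, tsum_eq_single (a 0), hN.cyl, if_pos rfl]
  intro c hc
  rw [hN.cyl, if_neg hc.symm, mul_zero]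

/-- What holds almost surely for the stationary chain of marks holds almost surely for the exit
marks of a walk that stays in a cone. -/
theorem ae_exitMarks (hM : IsPathFamily W.wordStep M) (ht : W.IsTransient)
    {N : V × V × ℕ → Measure (ℕ → V × V × ℕ)} (hN : IsPathFamily W.markStep N)
    {ν : PMF V} (hν : IsInvariantLaw W.q ν) {p : (ℕ → V × V × ℕ) → Prop}
    (hp : ∀ c, W.stationaryMark ht ν c ≠ 0 → ∀ᵐ b ∂N c, p b) (i : V) (r : List V) :
    ∀ᵐ y ∂M (i :: r), (∀ n, y n ∉ ({r} : Set (List V))) → p (W.exitMarks y) := by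
  refine (ae_restrict_iff' (measurableSet_forall_notMem {r})).1 ?_
  refine ae_of_ae_map W.measurable_exitMarks.aemeasurable ?_
  rw [W.map_exitMarks hM ht hN i r, Measure.ae_ennreal_smul_measure_iff (W.surv_ne_zero ht i)]
  exact ae_mixedLaw_iff.2 fun c hc => hp c (W.stationaryMark_ne_zero_of_markLaw ht hν hc)

end CoverWalk

/-! ### Interpolation between exit times -/

section Interpolation

theorem exists_le_lt_succ_of_strictMono {e : ℕ → ℕ} (he : StrictMono e) :
    ∃ κ : ℕ → ℕ, Tendsto κ atTop atTop ∧
      ∀ᶠ n in atTop, e (κ n) ≤ n ∧ n < e (κ n + 1) := by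
  classical
  refine ⟨fun n => Nat.findGreatest (fun k => e k ≤ n) n, ?_, ?_⟩
  · refine tendsto_atTop.2 fun k => ?_
    filter_upwards [eventually_ge_atTop (e k)] with n hn
    exact Nat.le_findGreatest ((he.id_le k).trans hn) hn
  · filter_upwards [eventually_ge_atTop (e 0)] with n hn
    have h1 : e (Nat.findGreatest (fun k => e k ≤ n) n) ≤ n :=
      Nat.findGreatest_spec (P := fun k => e k ≤ n) (Nat.zero_le n) hn
    refine ⟨h1, ?_⟩
    by_contra h2
    rw [not_lt] at h2
    have h3 : Nat.findGreatest (fun k => e k ≤ n) n + 1 ≤ n := (he.id_le _).trans h2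
    exact Nat.not_succ_le_self _ (Nat.le_findGreatest (P := fun k => e k ≤ n) h3 h2)

theorem abs_sub_le_of_abs_succ_sub_le {b : ℕ → ℝ} {C : ℝ} (hC : ∀ n, |b (n + 1) - b n| ≤ C)
    {m n : ℕ} (h : m ≤ n) : |b n - b m| ≤ C * ((n : ℝ) - m) := by
  induction n, h using Nat.le_induction with
  | base => simp
  | succ n _ ih =>
    have h1 := hC n
    have h2 : b (n + 1) - b m = (b (n + 1) - b n) + (b n - b m) := by ring
    rw [h2]
    refine (abs_add_le _ _).trans ?_
    push_cast
    linarith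

theorem tendsto_succ_div {e : ℕ → ℝ} {L : ℝ}
    (h : Tendsto (fun k : ℕ => e k / k) atTop (𝓝 L)) :
    Tendsto (fun k : ℕ => e (k + 1) / k) atTop (𝓝 L) := by
  have h1 : Tendsto (fun k : ℕ => e (k + 1) / ((k + 1 : ℕ) : ℝ)) atTop (𝓝 L) :=
    h.comp (tendsto_add_atTop_nat 1)
  have h2 : Tendsto (fun k : ℕ => 1 + 1 / (k : ℝ)) atTop (𝓝 (1 + 0)) :=
    tendsto_const_nhds.add tendsto_one_div_atTop_nhds_zero_nat
  have h3 := h1.mul h2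
  rw [add_zero, mul_one] at h3
  refine h3.congr' ?_
  filter_upwards [eventually_gt_atTop 0] with k hk
  have hk' : (k : ℝ) ≠ 0 := by exact_mod_cast hk.ne'
  have hk2 : ((k + 1 : ℕ) : ℝ) ≠ 0 := by positivity
  field_simp
  push_cast
  ring

/-- A sequence with bounded increments whose values at the times `e k` grow at rate `c` per `k`,
where `e k` grows at rate `L`, grows at rate `c / L`. -/
theorem tendsto_div_of_tendsto_subseq_div {e : ℕ → ℕ} (he : StrictMono e) {b : ℕ → ℝ}
    {C L c : ℝ} (hC : ∀ n, |b (n + 1) - b n| ≤ C) (hL : 0 < L)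
    (h1 : Tendsto (fun k : ℕ => (e k : ℝ) / k) atTop (𝓝 L))
    (h2 : Tendsto (fun k : ℕ => b (e k) / k) atTop (𝓝 c)) :
    Tendsto (fun n : ℕ => b n / n) atTop (𝓝 (c * L⁻¹)) := by
  obtain ⟨κ, hκ, hev⟩ := exists_le_lt_succ_of_strictMono he
  have h1' := tendsto_succ_div h1
  have hC0 : 0 ≤ C := (abs_nonneg _).trans (hC 0)
  have hn : Tendsto (fun n : ℕ => (n : ℝ) / κ n) atTop (𝓝 L) := by
    refine tendsto_of_tendsto_of_tendsto_of_le_of_le' (h1.comp hκ) (h1'.comp hκ) ?_ ?_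
    · filter_upwards [hev] with n hn
      simp only [Function.comp]
      gcongr
      exact_mod_cast hn.1
    · filter_upwards [hev] with n hn
      simp only [Function.comp]
      gcongr
      exact_mod_cast hn.2.le
  have hd : Tendsto (fun n : ℕ => (b n - b (e (κ n))) / κ n) atTop (𝓝 0) := by
    have h3 : Tendsto (fun k : ℕ => C * ((e (k + 1) : ℝ) / k - (e k : ℝ) / k)) atTop
        (𝓝 (C * (L - L))) := (h1'.sub h1).const_mul C
    rw [sub_self, mul_zero] at h3
    refine squeeze_zero_norm' ?_ (h3.comp hκ)
    filter_upwards [hev] with n hn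
    have h4 := abs_sub_le_of_abs_succ_sub_le hC hn.1
    have h5 : (n : ℝ) ≤ e (κ n + 1) := by exact_mod_cast hn.2.le
    have h6 : |b n - b (e (κ n))| ≤ C * ((e (κ n + 1) : ℝ) - e (κ n)) :=
      h4.trans (mul_le_mul_of_nonneg_left (by linarith) hC0)
    simp only [Function.comp]
    rw [Real.norm_eq_abs, abs_div, Nat.abs_cast, ← sub_div, ← mul_div_assoc]
    gcongr
  have h3 := ((h2.comp hκ).add hd).div hn hL.ne'
  rw [add_zero, div_eq_mul_inv c L] at h3
  refine h3.congr' ?_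
  filter_upwards [hκ.eventually_gt_atTop 0, eventually_gt_atTop 0] with n hk hn0
  have hk' : (κ n : ℝ) ≠ 0 := by exact_mod_cast hk.ne'
  have hn' : (n : ℝ) ≠ 0 := by exact_mod_cast hn0.ne'
  simp only [Pi.div_apply, Function.comp, ← add_div, add_sub_cancel]
  field_simp

/-- If the times `e k` grow faster than `k` and `b (e k)` grows at most linearly in `k`, then
`|b n| / n` comes close to zero along the times `e k`. -/
theorem liminf_abs_div_eq_zero {e : ℕ → ℕ} (he : StrictMono e) {b : ℕ → ℝ} {C D : ℝ}
    (h1 : Tendsto (fun k : ℕ => (e k : ℝ) / k) atTop atTop)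
    (h2 : ∀ k : ℕ, |b (e k)| ≤ D + C * k) :
    liminf (fun n : ℕ => |b n| / n) atTop = 0 := by
  have hnonneg : ∀ n : ℕ, 0 ≤ |b n| / n := fun n => by positivity
  have hbdd : IsBoundedUnder (· ≥ ·) atTop fun n : ℕ => |b n| / n :=
    isBoundedUnder_of ⟨0, hnonneg⟩
  have hlim : Tendsto (fun k : ℕ => |b (e k)| / e k) atTop (𝓝 0) := by
    have h3 : Tendsto (fun k : ℕ => (D / k + C) / ((e k : ℝ) / k)) atTop (𝓝 0) := by
      have h4 : Tendsto (fun k : ℕ => D / (k : ℝ) + C) atTop (𝓝 (0 + C)) :=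
        (tendsto_const_div_atTop_nhds_zero_nat D).add tendsto_const_nhds
      exact h4.div_atTop h1
    refine squeeze_zero' (Eventually.of_forall fun k => by positivity) ?_ h3
    filter_upwards [eventually_gt_atTop 0] with k hk
    have hk' : (k : ℝ) ≠ 0 := by exact_mod_cast hk.ne'
    have h5 : (D / k + C) / ((e k : ℝ) / k) = (D + C * k) / e k := by
      have h6 : D / k + C = (D + C * k) / k := by field_simp
      rw [h6, div_div_div_cancel_right₀ hk']
    rw [h5]
    gcongr
    exact h2 k
  have hfreq : ∀ δ > 0, ∃ᶠ n in atTop, |b n| / (n : ℝ) ≤ δ := by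
    intro δ hδ
    have h3 : ∃ᶠ k in atTop, |b (e k)| / (e k : ℝ) ≤ δ :=
      (hlim.eventually (eventually_le_nhds hδ)).frequently
    exact he.tendsto_atTop.frequently h3
  refine le_antisymm (le_of_forall_pos_le_add fun δ hδ => ?_) ?_
  · rw [zero_add]
    exact liminf_le_of_frequently_le (hfreq δ hδ) hbdd
  · refine le_liminf_of_le ?_ (Eventually.of_forall hnonneg)
    exact IsCoboundedUnder.of_frequently_le (hfreq 1 one_pos)

end Interpolation

/-! ### Exit points and their weighted lengths -/

namespace CoverWalk

variable {V : Type*} (W : CoverWalk V)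

/-- The time of the `k`-th exit of `y`. -/
noncomputable def exitEpoch (y : ℕ → List V) (k : ℕ) : ℕ :=
  ∑ l ∈ Finset.range k, (W.exitMarks y l).2.2

theorem IsNearestNeighbour.abs_weightedLengthAux_sub_le {y : ℕ → List V}
    (h : IsNearestNeighbour y) {w : V → V → ℝ} {C : ℝ} (hC : ∀ i j, |w i j| ≤ C) (n : ℕ) :
    |Cover.weightedLengthAux w W.base (y (n + 1)) - Cover.weightedLengthAux w W.base (y n)| ≤ C := by
  have hC0 : 0 ≤ C := (abs_nonneg _).trans (hC W.base W.base)
  rcases h n with h1 | ⟨j, h1⟩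
  · rw [h1]
    cases y n with
    | nil => simpa using hC0
    | cons j s =>
      rw [List.tail_cons, Cover.weightedLengthAux, abs_sub_comm, add_sub_cancel_left]
      exact hC _ _
  · rw [h1, Cover.weightedLengthAux, add_sub_cancel_left]
    exact hC _ _

theorem IsNearestNeighbour.iterate_exitShift {y : ℕ → List V} (h : IsNearestNeighbour y)
    (ha : ∀ n, y n ∉ ancestorSet (y 0)) (hT : ∀ k, (W.exitMarks y k).2.2 ≠ 0) (k : ℕ) :
    exitShift^[k] y = _root_.shiftPath (W.exitEpoch y k) y ∧
      ∀ n, exitShift^[k] y n ∉ ancestorSet (exitShift^[k] y 0) := by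
  induction k with
  | zero => exact ⟨(shiftPath_zero y).symm, ha⟩
  | succ k ih =>
    obtain ⟨h1, h2⟩ := ih
    have hnn : IsNearestNeighbour (exitShift^[k] y) := by rw [h1]; exact h.shiftPath _
    have hTk : exitTime (exitShift^[k] y) ≠ 0 := hT k
    obtain ⟨j, hj⟩ := hnn.apply_exitTime h2 hTk
    rw [Function.iterate_succ_apply']
    constructor
    · have h3 : W.exitEpoch y (k + 1) = W.exitEpoch y k + exitTime (exitShift^[k] y) :=
        Finset.sum_range_succ _ _
      rw [exitShift, h3]
      conv_lhs => rw [h1]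
      rw [shiftPath_shiftPath, ← h1]
    · have h3 : exitShift (exitShift^[k] y) 0 = j :: exitShift^[k] y 0 := by
        rw [← hj]; rfl
      rw [h3, ancestorSet_cons]
      exact fun n => exitShift_ne _ hTk n

theorem IsNearestNeighbour.weightedLengthAux_exitEpoch {y : ℕ → List V}
    (h : IsNearestNeighbour y) (ha : ∀ n, y n ∉ ancestorSet (y 0))
    (hT : ∀ k, (W.exitMarks y k).2.2 ≠ 0) (w : V → V → ℝ) (k : ℕ) :
    Cover.weightedLengthAux w W.base (y (W.exitEpoch y k)) =
      Cover.weightedLengthAux w W.base (y 0) +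
        ∑ l ∈ Finset.range k, w (W.exitMarks y l).1 (W.exitMarks y l).2.1 := by
  induction k with
  | zero => simp [exitEpoch]
  | succ k ih =>
    obtain ⟨h1, h2⟩ := h.iterate_exitShift W ha hT k
    have hnn : IsNearestNeighbour (exitShift^[k] y) := by rw [h1]; exact h.shiftPath _
    have hTk : exitTime (exitShift^[k] y) ≠ 0 := hT k
    obtain ⟨j, hj⟩ := hnn.apply_exitTime h2 hTk
    have h3 : W.exitEpoch y (k + 1) = W.exitEpoch y k + exitTime (exitShift^[k] y) :=
      Finset.sum_range_succ _ _
    have h4 : y (W.exitEpoch y (k + 1)) = j :: y (W.exitEpoch y k) := by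
      have h5 : ∀ n, exitShift^[k] y n = y (W.exitEpoch y k + n) := fun n => by
        rw [h1]; rfl
      rw [h3, ← h5, hj, h5, add_zero]
    have h6 : (W.exitMarks y k).1 = W.lastLabel (y (W.exitEpoch y k)) := by
      change W.lastLabel (exitShift^[k] y 0) = _
      rw [h1]; rfl
    have h7 : (W.exitMarks y k).2.1 = j := by
      change W.lastLabel (exitShift^[k] y (exitTime (exitShift^[k] y))) = _
      rw [hj]; rfl
    rw [Finset.sum_range_succ, ← add_assoc, ← ih, h4, h6, h7]
    rfl

theorem strictMono_exitEpoch {y : ℕ → List V} (hT : ∀ k, (W.exitMarks y k).2.2 ≠ 0) :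
    StrictMono (W.exitEpoch y) := by
  refine strictMono_nat_of_lt_succ fun k => ?_
  rw [exitEpoch, exitEpoch, Finset.sum_range_succ]
  have := Nat.pos_of_ne_zero (hT k)
  omega

/-! ### Means in the stationary regime -/

theorem tsum_nu_mul_q (ht : W.IsTransient) (ν : PMF V) :
    ∑' e : V × V, ν e.1 * W.q e.1 e.2 = 1 := by
  rw [ENNReal.tsum_prod (f := fun i j => ν i * W.q i j)]
  simp only [ENNReal.tsum_mul_left, W.tsum_q ht, mul_one, ν.tsum_coe]

theorem summable_mul_nu_mul_q (ht : W.IsTransient) (ν : PMF V) {w : V → V → ℝ} {C : ℝ}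
    (hC : ∀ i j, |w i j| ≤ C) :
    Summable fun e : V × V => w e.1 e.2 * ((ν e.1).toReal * (W.q e.1 e.2).toReal) := by
  have h1 : Summable fun e : V × V => (ν e.1 * W.q e.1 e.2).toReal :=
    ENNReal.summable_toReal (by rw [W.tsum_nu_mul_q ht]; exact ENNReal.one_ne_top)
  refine Summable.of_norm_bounded (h1.mul_left C) fun e => ?_
  rw [← ENNReal.toReal_mul, norm_mul, Real.norm_eq_abs, Real.norm_eq_abs,
    abs_of_nonneg ENNReal.toReal_nonneg]
  exact mul_le_mul_of_nonneg_right (hC _ _) ENNReal.toReal_nonneg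

section Means

variable [Countable V] [MeasurableSpace V] [DiscreteMeasurableSpace V]

theorem integrable_weight (π : PMF (V × V × ℕ)) {w : V → V → ℝ} {C : ℝ}
    (hC : ∀ i j, |w i j| ≤ C) : Integrable (fun c : V × V × ℕ => w c.1 c.2.1) π.toMeasure :=
  Integrable.of_bound (measurable_of_countable _).aestronglyMeasurable C
    (Eventually.of_forall fun c => hC c.1 c.2.1)

theorem integral_weight_stationaryMark (ht : W.IsTransient) (ν : PMF V) {w : V → V → ℝ} {C : ℝ}
    (hC : ∀ i j, |w i j| ≤ C) :
    ∫ c, w c.1 c.2.1 ∂(W.stationaryMark ht ν).toMeasure =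
      ∑' e : V × V, w e.1 e.2 * ((ν e.1).toReal * (W.q e.1 e.2).toReal) := by
  set μ := (W.stationaryMark ht ν).toMeasure
  let g : V × V × ℕ → V × V := fun c => (c.1, c.2.1)
  have hg : Measurable g := measurable_of_countable g
  have hsing : ∀ e : V × V, μ.map g {e} = ν e.1 * W.q e.1 e.2 := by
    rintro ⟨i, j⟩
    rw [Measure.map_apply hg (measurableSet_singleton _)]
    have h1 : g ⁻¹' {(i, j)} = ⋃ m : ℕ, {(i, j, m)} := by
      ext ⟨a, b, m⟩
      simp [g, eq_comm]
    rw [h1, measure_iUnion]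
    · simp only [μ, PMF.toMeasure_apply_singleton _ _ (measurableSet_singleton _),
        stationaryMark_apply, ENNReal.tsum_mul_left, tsum_holdLaw, mul_one]
    · intro m m' hm
      rw [Function.onFun, Set.disjoint_singleton]
      intro h
      exact hm (congrArg (fun c => c.2.2) h)
    · exact fun m => measurableSet_singleton _
  have hint : Integrable (fun e : V × V => w e.1 e.2) (μ.map g) :=
    Integrable.of_bound (measurable_of_countable _).aestronglyMeasurable C
      (Eventually.of_forall fun e => hC e.1 e.2)
  have h2 : ∫ c, w c.1 c.2.1 ∂μ = ∫ e, w e.1 e.2 ∂(μ.map g) :=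
    (integral_map hg.aemeasurable hint.aestronglyMeasurable).symm
  rw [h2, integral_countable hint]
  congr 1; funext e
  rw [measureReal_def, hsing, ENNReal.toReal_mul, smul_eq_mul, mul_comm]

theorem lintegral_hold_stationaryMark (ht : W.IsTransient) (ν : PMF V) :
    ∫⁻ c, (c.2.2 : ℝ≥0∞) ∂(W.stationaryMark ht ν).toMeasure = W.Lam ν := by
  rw [lintegral_countable', ← W.tsum_stationaryMark_mul_hold ht]
  congr 1; funext c
  rw [PMF.toMeasure_apply_singleton _ _ (measurableSet_singleton c), mul_comm]

theorem integrable_hold (ht : W.IsTransient) {ν : PMF V} (h : W.Lam ν < ∞) :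
    Integrable (fun c : V × V × ℕ => (c.2.2 : ℝ)) (W.stationaryMark ht ν).toMeasure := by
  refine ⟨(measurable_of_countable _).aestronglyMeasurable, ?_⟩
  rw [hasFiniteIntegral_iff_ofReal (Eventually.of_forall fun c => Nat.cast_nonneg _)]
  simp only [ENNReal.ofReal_natCast]
  rw [W.lintegral_hold_stationaryMark]
  exact h

theorem integral_hold_stationaryMark (ht : W.IsTransient) (ν : PMF V) :
    ∫ c, (c.2.2 : ℝ) ∂(W.stationaryMark ht ν).toMeasure = (W.Lam ν).toReal := by
  rw [integral_eq_lintegral_of_nonneg_ae (Eventually.of_forall fun c => Nat.cast_nonneg _)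
    (measurable_of_countable _).aestronglyMeasurable]
  simp only [ENNReal.ofReal_natCast]
  rw [W.lintegral_hold_stationaryMark]

end Means

/-- Every mean holding time is at least one. -/
theorem one_le_Lam (ν : PMF V) : 1 ≤ W.Lam ν := by
  rw [← ν.tsum_coe]
  refine ENNReal.tsum_le_tsum fun i => ?_
  have h : 1 ≤ W.F' i 1 / W.F i 1 := by
    rw [← tsum_mul_holdLaw, ← W.tsum_holdLaw i]
    refine ENNReal.tsum_le_tsum fun m => ?_
    cases m with
    | zero => simp [holdLaw]
    | succ m =>
      refine le_mul_of_one_le_left zero_le ?_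
      exact_mod_cast (by omega : 1 ≤ m + 1)
  calc ν i = ν i * 1 := (mul_one _).symm
    _ ≤ _ := mul_le_mul_right h _

end CoverWalk

/-! ### The random walk on the directed cover -/

namespace CoverWalk

variable {V : Type*} (W : CoverWalk V)

theorem height_eq_weightedLengthAux (x : W.Tree) :
    (x.height : ℝ) = Cover.weightedLengthAux (fun _ _ => 1) W.base x.word := by
  have h : ∀ s : List V, (s.length : ℝ) = Cover.weightedLengthAux (fun _ _ => 1) W.base s := by
    intro s
    induction s with
    | nil => simp [Cover.weightedLengthAux]
    | cons j s ih => rw [Cover.weightedLengthAux, ← ih]; simp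
  exact h x.word

theorem weightedLengthAux_nonneg {w : V → V → ℝ} (hw : ∀ i j, 0 ≤ w i j) (s : List V) :
    0 ≤ Cover.weightedLengthAux w W.base s := by
  induction s with
  | nil => exact le_rfl
  | cons j s ih => exact add_nonneg ih (hw _ _)

variable [Countable V]

/-- The words visited by the walk on the directed cover form a chain with transition matrix
`wordStep`. -/
theorem map_word_eq {M : List V → Measure (ℕ → List V)} (hM : IsPathFamily W.wordStep M)
    {Ω : Type*} [MeasurableSpace Ω] {μ : Measure Ω} [IsProbabilityMeasure μ]
    {X : ℕ → Ω → W.Tree} (hX : IsMarkovChain μ X W.step Cover.root) :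
    (Measurable fun ω n => (X n ω).word) ∧ μ.map (fun ω n => (X n ω).word) = M [] := by
  have hword : Measurable (Cover.word : W.Tree → List V) := measurable_from_top
  have hmeas : Measurable fun ω n => (X n ω).word :=
    measurable_pi_lambda _ fun n => hword.comp (hX.measurable n)
  refine ⟨hmeas, ?_⟩
  have := hM.prob []
  refine ext_of_pathCylinder fun n a => ?_
  rw [Measure.map_apply hmeas (measurableSet_pathCylinder n a), hM.cyl]
  by_cases h0 : a 0 = []
  · rw [if_pos h0]
    by_cases hval : ∀ k ≤ n, IsCoverPath W.graph W.base (a k)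
    · have hex : ∀ k, ∃ z : W.Tree, k ≤ n → z.word = a k := fun k => by
        by_cases hk : k ≤ n
        · exact ⟨⟨a k, hval k hk⟩, fun _ => rfl⟩
        · exact ⟨Cover.root, fun h => absurd h hk⟩
      choose x hx using hex
      have hx0 : x 0 = Cover.root := by
        rw [Cover.eq_root_iff, hx 0 (Nat.zero_le n), h0]
      have h1 := hX.path n x hx0
      have h2 : (fun ω n => (X n ω).word) ⁻¹' pathCylinder n a =
          {ω | ∀ k ≤ n, X k ω = x k} := by
        ext ω
        simp only [Set.mem_preimage, pathCylinder, Set.mem_ofPred_eq]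
        refine forall_congr' fun k => forall_congr' fun hk => ?_
        rw [← hx k hk]
        exact Cover.word_injective.eq_iff
      rw [h2, h1]
      refine Finset.prod_congr rfl fun k hk => ?_
      have hk' := Finset.mem_range.1 hk
      rw [step_eq_wordStep, hx k (by omega), hx (k + 1) (by omega)]
    · have h2 : (fun ω n => (X n ω).word) ⁻¹' pathCylinder n a = ∅ := by
        ext ω
        simp only [Set.mem_preimage, Set.mem_empty_iff_false, iff_false]
        intro hω
        refine hval fun k hk => ?_
        rw [← hω k hk]
        exact (X k ω).isCoverPath_word
      rw [h2, measure_empty]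
      by_contra hne
      have hne' := Finset.prod_ne_zero_iff.1 (Ne.symm hne)
      refine hval fun k => ?_
      induction k with
      | zero => intro _; rw [h0]; trivial
      | succ k ih =>
        intro hk
        exact W.isCoverPath_of_wordStep_ne_zero (ih (by omega))
          (hne' k (Finset.mem_range.2 (by omega)))
  · rw [if_neg h0]
    refine measure_eq_zero_iff_ae_notMem.2 ?_
    filter_upwards [hX.start] with ω hω hmem
    apply h0
    have h1 : (X 0 ω).word = a 0 := hmem 0 (Nat.zero_le n)
    rw [← h1, hω]
    rfl

/-- Almost surely, the walk started at the root has successive exits from some time on, and their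
marks have any property that holds almost surely for the stationary chain of marks. -/
theorem ae_exits [MeasurableSpace V] [DiscreteMeasurableSpace V]
    {M : List V → Measure (ℕ → List V)} (hM : IsPathFamily W.wordStep M) (ht : W.IsTransient)
    {N : V × V × ℕ → Measure (ℕ → V × V × ℕ)} (hN : IsPathFamily W.markStep N)
    {ν : PMF V} (hν : IsInvariantLaw W.q ν) {p : (ℕ → V × V × ℕ) → Prop}
    (hp : ∀ c, W.stationaryMark ht ν c ≠ 0 → ∀ᵐ b ∂N c, p b) :
    ∀ᵐ y ∂M [], IsNearestNeighbour y ∧ y 0 = [] ∧ ∃ (e : ℕ → ℕ) (c : ℕ → V × V × ℕ) (T : ℕ),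
      p c ∧ StrictMono e ∧ (∀ k, e k = T + ∑ l ∈ Finset.range k, (c l).2.2) ∧
      ∀ (w : V → V → ℝ) (k : ℕ), Cover.weightedLengthAux w W.base (y (e k)) =
        Cover.weightedLengthAux w W.base (y T) + ∑ l ∈ Finset.range k, w (c l).1 (c l).2.1 := by
  -- the holding times in the stationary regime do not vanish
  have hpos : ∀ c, W.stationaryMark ht ν c ≠ 0 → ∀ᵐ b ∂N c, ∀ k, (b k).2.2 ≠ 0 := by
    intro c hc
    have hstep : ∀ c d, W.markStep c d ≠ 0 → d.2.2 ≠ 0 := by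
      rintro c ⟨i, j, m⟩ h hm
      apply h
      have hm' : m = 0 := hm
      subst hm'
      rw [markStep, markLaw, holdLaw, mul_zero, ite_self]
    filter_upwards [hN.ae_start c, hN.ae_step_ne_zero c] with b h0 hb k
    cases k with
    | zero =>
      rw [h0]
      obtain ⟨i, j, m⟩ := c
      intro hm
      have hm' : m = 0 := hm
      subst hm'
      rw [stationaryMark_apply, holdLaw, mul_zero, mul_zero] at hc
      exact hc rfl
    | succ k => exact hstep _ _ (hb k)
  have h1 : ∀ᵐ y ∂M [], p (W.exitMarks (exitShift y)) ∧
      ∀ k, (W.exitMarks (exitShift y) k).2.2 ≠ 0 :=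
    W.ae_exitShift_root hM ht (p := fun y => p (W.exitMarks y) ∧ ∀ k, (W.exitMarks y k).2.2 ≠ 0)
      fun j => W.ae_exitMarks hM ht hN hν (p := fun c => p c ∧ ∀ k, (c k).2.2 ≠ 0)
        (fun c hc => (hp c hc).and (hpos c hc)) j []
  filter_upwards [h1, hM.ae_start [], W.ae_isNearestNeighbour hM [],
    W.ae_exitTime_root_ne_zero hM ht] with y ⟨hpy, hT⟩ h0 hnn hT0
  refine ⟨hnn, h0, fun k => exitTime y + W.exitEpoch (exitShift y) k, W.exitMarks (exitShift y),
    exitTime y, hpy, fun k l hkl => ?_, fun k => rfl, fun w k => ?_⟩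
  · have := W.strictMono_exitEpoch hT hkl
    simp only
    omega
  · have hnn' : IsNearestNeighbour (exitShift y) := hnn.shiftPath _
    obtain ⟨j, hj⟩ := hnn.apply_exitTime (by rw [h0, ancestorSet_nil]; simp) hT0
    have ha : ∀ n, exitShift y n ∉ ancestorSet (exitShift y 0) := by
      have h3 : exitShift y 0 = j :: y 0 := hj
      rw [h3, ancestorSet_cons]
      exact fun n => exitShift_ne y hT0 n
    exact hnn'.weightedLengthAux_exitEpoch W ha hT w k

/-- The law of large numbers for the weighted length if `Λ` is finite. -/
theorem ae_tendsto_weightedLength_div [MeasurableSpace V] [DiscreteMeasurableSpace V]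
    {M : List V → Measure (ℕ → List V)} (hM : IsPathFamily W.wordStep M) (ht : W.IsTransient)
    {ν : PMF V} (hν : IsInvariantLaw W.q ν) (hLam : W.Lam ν < ∞) {w : V → V → ℝ} {C : ℝ}
    (hC : ∀ i j, |w i j| ≤ C) :
    ∀ᵐ y ∂M [], Tendsto (fun n : ℕ => Cover.weightedLengthAux w W.base (y n) / n) atTop
      (𝓝 ((∑' e : V × V, w e.1 e.2 * ((ν e.1).toReal * (W.q e.1 e.2).toReal))
        * (W.Lam ν).toReal⁻¹)) := by
  obtain ⟨N, hN⟩ := exists_isPathFamily W.markStep (W.tsum_markStep ht)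
  have hπ := W.isInvariantLaw_stationaryMark ht hν
  have hirr : ∀ c d, W.stationaryMark ht ν c ≠ 0 → W.stationaryMark ht ν d ≠ 0 →
      ∃ n, pathProb W.markStep ∅ n c d ≠ 0 := fun c d _ hd =>
    W.exists_pathProb_markStep_ne_zero ht c d hd
  have hL : 0 < (W.Lam ν).toReal :=
    ENNReal.toReal_pos (lt_of_lt_of_le one_pos (W.one_le_Lam ν)).ne' hLam.ne
  have hdiv : ∀ D : ℝ, Tendsto (fun k : ℕ => D / (k : ℝ)) atTop (𝓝 0) :=
    tendsto_const_div_atTop_nhds_zero_nat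
  filter_upwards [W.ae_exits hM ht hN hν fun c hc =>
    (hN.ae_tendsto_average hπ hirr (W.integrable_hold ht hLam) hc).and
      (hN.ae_tendsto_average hπ hirr (integrable_weight _ hC) hc)] with
    y ⟨hnn, _, e, c, T, ⟨h1, h2⟩, he, heT, hew⟩
  rw [W.integral_hold_stationaryMark] at h1
  rw [W.integral_weight_stationaryMark ht ν hC] at h2
  refine tendsto_div_of_tendsto_subseq_div he (hnn.abs_weightedLengthAux_sub_le W hC) hL ?_ ?_
  · have h3 := (hdiv T).add h1
    rw [zero_add] at h3
    refine h3.congr fun k => ?_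
    rw [← add_div, heT]
    push_cast
    rfl
  · have h3 := (hdiv (Cover.weightedLengthAux w W.base (y T))).add h2
    rw [zero_add] at h3
    refine h3.congr fun k => ?_
    rw [← add_div, hew]

/-- If `Λ` is infinite, then the weighted length is of smaller order than the time along the exit
times. -/
theorem ae_liminf_weightedLength_div [MeasurableSpace V] [DiscreteMeasurableSpace V]
    {M : List V → Measure (ℕ → List V)} (hM : IsPathFamily W.wordStep M) (ht : W.IsTransient)
    {ν : PMF V} (hν : IsInvariantLaw W.q ν) (hLam : W.Lam ν = ∞) {w : V → V → ℝ} {C : ℝ}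
    (hC : ∀ i j, |w i j| ≤ C) :
    ∀ᵐ y ∂M [],
      liminf (fun n : ℕ => |Cover.weightedLengthAux w W.base (y n)| / n) atTop = 0 := by
  obtain ⟨N, hN⟩ := exists_isPathFamily W.markStep (W.tsum_markStep ht)
  have hπ := W.isInvariantLaw_stationaryMark ht hν
  have hirr : ∀ c d, W.stationaryMark ht ν c ≠ 0 → W.stationaryMark ht ν d ≠ 0 →
      ∃ n, pathProb W.markStep ∅ n c d ≠ 0 := fun c d _ hd =>
    W.exists_pathProb_markStep_ne_zero ht c d hd
  rw [← W.tsum_stationaryMark_mul_hold ht] at hLam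
  filter_upwards [W.ae_exits hM ht hN hν fun c hc =>
    hN.ae_tendsto_average_atTop hπ hirr hLam hc] with y ⟨_, _, e, c, T, h1, he, heT, hew⟩
  refine liminf_abs_div_eq_zero (C := C)
    (D := |Cover.weightedLengthAux w W.base (y T)|) he ?_ fun k => ?_
  · refine tendsto_atTop_mono (fun k => ?_) h1
    rw [heT]
    push_cast
    gcongr
    exact le_add_of_nonneg_left (Nat.cast_nonneg T)
  · rw [hew]
    refine (abs_add_le _ _).trans (add_le_add le_rfl ?_)
    refine (Finset.abs_sum_le_sum_abs _ _).trans ?_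
    refine (Finset.sum_le_sum fun l _ => hC _ _).trans ?_
    simp [mul_comm]

end CoverWalk

theorem mainTheorem4 {V : Type*} [Countable V] (W : CoverWalk V)
    {Ω : Type*} [MeasurableSpace Ω] (μ : Measure Ω) [IsProbabilityMeasure μ]
    (X : ℕ → Ω → W.Tree) (hX : IsMarkovChain μ X W.step Cover.root)
    (htrans : W.IsTransient)
    (hQ : IsPositiveRecurrent W.q) (ν : PMF V) (hν : IsInvariantLaw W.q ν) :
    (W.Lam ν < ∞ →
      (∀ w : V → V → ℝ, (∃ C : ℝ, ∀ i j, |w i j| ≤ C) →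
        Summable (fun e : V × V => w e.1 e.2 * ((ν e.1).toReal * (W.q e.1 e.2).toReal)) ∧
        ∀ᵐ ω ∂μ, Tendsto (fun n : ℕ => (X n ω).weightedLength w / n) atTop
          (𝓝 ((∑' e : V × V, w e.1 e.2 * ((ν e.1).toReal * (W.q e.1 e.2).toReal))
            * (W.Lam ν).toReal⁻¹))) ∧
      (∃ ℓ : ℝ, 0 < ℓ ∧
        ∀ᵐ ω ∂μ, Tendsto (fun n : ℕ => ((X n ω).height : ℝ) / n) atTop (𝓝 ℓ))) ∧
    (W.spectralRadius < 1 → W.Lam ν < ∞) ∧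
    (W.Lam ν = ∞ →
      ∀ w : V → V → ℝ, (∃ C : ℝ, ∀ i j, |w i j| ≤ C) →
        (∀ᵐ ω ∂μ, liminf (fun n : ℕ => |(X n ω).weightedLength w| / n) atTop = 0) ∧
        ((∀ i j, 0 ≤ w i j) →
          ∀ᵐ ω ∂μ, liminf (fun n : ℕ => (X n ω).weightedLength w / n) atTop = 0)) := by
  let _ : MeasurableSpace V := ⊤
  have : DiscreteMeasurableSpace V := ⟨fun _ => trivial⟩
  obtain ⟨M, hM⟩ := exists_isPathFamily W.wordStep W.tsum_wordStep
  obtain ⟨hmeas, hlaw⟩ := W.map_word_eq hM hX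
  have htransfer : ∀ {p : (ℕ → List V) → Prop}, (∀ᵐ y ∂M [], p y) →
      ∀ᵐ ω ∂μ, p fun n => (X n ω).word := by
    intro p hp
    rw [← hlaw] at hp
    exact ae_of_ae_map hmeas.aemeasurable hp
  refine ⟨fun hLam => ⟨?_, ?_⟩, fun h => W.Lam_lt_top_of_spectralRadius_lt_one h ν,
    fun hLam => ?_⟩
  · rintro w ⟨C, hC⟩
    exact ⟨W.summable_mul_nu_mul_q htrans ν hC,
      htransfer (W.ae_tendsto_weightedLength_div hM htrans hν hLam hC)⟩
  · have hC : ∀ i j : V, |(fun _ _ => 1 : V → V → ℝ) i j| ≤ 1 := fun i j => by simp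
    have hone : ∑' e : V × V, (1 : ℝ) * ((ν e.1).toReal * (W.q e.1 e.2).toReal) = 1 := by
      simp only [one_mul, ← ENNReal.toReal_mul]
      rw [← ENNReal.tsum_toReal_eq, W.tsum_nu_mul_q htrans, ENNReal.toReal_one]
      intro e h
      have h1 := ENNReal.le_tsum (f := fun e : V × V => ν e.1 * W.q e.1 e.2) e
      rw [W.tsum_nu_mul_q htrans, h] at h1
      exact absurd h1 (by simp)
    refine ⟨1 * (W.Lam ν).toReal⁻¹, ?_, ?_⟩
    · rw [one_mul, inv_pos]
      exact ENNReal.toReal_pos (lt_of_lt_of_le one_pos (W.one_le_Lam ν)).ne' hLam.ne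
    · have h1 := htransfer (W.ae_tendsto_weightedLength_div hM htrans hν hLam hC)
      rw [hone] at h1
      simpa only [CoverWalk.height_eq_weightedLengthAux] using h1
  · rintro w ⟨C, hC⟩
    have h1 : ∀ᵐ ω ∂μ, liminf (fun n : ℕ => |(X n ω).weightedLength w| / n) atTop = 0 :=
      htransfer (W.ae_liminf_weightedLength_div hM htrans hν hLam hC)
    refine ⟨h1, fun hw => ?_⟩
    filter_upwards [h1] with ω hω
    rw [← hω]
    congr 1; funext n
    rw [abs_of_nonneg]
    exact W.weightedLengthAux_nonneg hw _
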